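/- **Proposition (Radiation fields in energy sub-critical space).** Let $d\ge 3$ and $\beta\in(0,1)$. For $s<d/2$ let $\dot H^s(\mathbb R^d)$ be the space of tempered distributions $f$ whose Fourier transform $\hat f$ is a locally integrable function with $\|f\|_{\dot H^s}^2=(2\pi)^{-d}\int |\xi|^{2s}|\hat f(\xi)|^2\,d\xi<\infty$, where $\hat f(\xi)=\int_{\mathbb R^d} e^{-i\xi\cdot x}f(x)\,dx$ for integrable $f$ (distributions and functions are complex valued); $\dot H^{\beta-1}(\mathbb R)$ is defined in the same way. Let $(u_0,u_1)\in\dot H^{\beta}\times\dot H^{\beta-1}(\mathbb R^d)$. There is a free wave $u$ with these data, that is, $(u,\partial_t u)\in C(\mathbb R;\dot H^\beta\times\dot H^{\beta-1})$ with $\partial_t^2u-\Delta u=0$ (the time derivatives being taken after pairing with Schwartz functions of $x$) and $(u,\partial_tu)|_{t=0}=(u_0,u_1)$. Let the radiation profiles $G_\pm=\mathbf T_\pm(u_0,u_1)\in L^2(\mathbb S^{d-1};\dot H^{\beta-1}(\mathbb R))$ be defined through their Fourier transforms in $s$, $(\mathcal F G)(\nu,\omega)=\int_{\mathbb R}e^{-i\nu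 s}G(s,\omega)\,ds$, by $$\mathcal F G_\pm(\nu,\omega)=c_d|\nu|^{\frac{d-1}{2}}\left[e^{i\tau}\mathbf 1_{\{\nu<0\}}+e^{-i\tau}\mathbf 1_{\{\nu>0\}}\right]\bigl(\hat u_1(\nu\omega)\mp i\nu\,\hat u_0(\nu\omega)\bigr),\qquad c_d=\frac{1}{2(2\pi)^{\frac{d-1}{2}}},\quad \tau=\frac{d-1}{4}\pi .$$ Then every such free wave $u$ satisfies $$\lim_{t\to+\infty}\left\|\nabla_{t,x}u(\cdot,t)-\frac{1}{|x|^{\frac{d-1}{2}}}\,G_+\!\left(|x|-t,\frac{x}{|x|}\right)\begin{pmatrix}1\\-x/|x|\end{pmatrix}\right\|_{(\dot H^{\beta-1}(\mathbb R^d))^{1+d}}=0,$$ $$\lim_{t\to-\infty}\left\|\nabla_{t,x}u(\cdot,t)-\frac{1}{|x|^{\frac{d-1}{2}}}\,G_-\!\left(|x|+t,\frac{x}{|x|}\right)\begin{pmatrix}1\\x/|x|\end{pmatrix}\right\|_{(\dot H^{\beta-1}(\mathbb R^d))^{1+d}}=0.$$ Here $\nabla_{t,x}u=(\partial_tu,\nabla_xu)$,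 and since $G_\pm$ are distributions in $s$, the terms containing them are the tempered distributions defined by polar coordinates $x=(s\pm t)\omega$, $\omega\in\mathbb S^{d-1}$: the pairing of such a term with a Schwartz function $\varphi$ is $$\int_{\mathbb S^{d-1}}\Bigl\langle G_\pm(\cdot,\omega),\ \mathbf 1_{\{s\pm t>0\}}(s\pm t)^{\frac{d-1}{2}}\varphi\bigl((s\pm t)\omega\bigr)\begin{pmatrix}1\\\mp\omega\end{pmatrix}\Bigr\rangle\,d\omega ,$$ where $\langle g,h\rangle=\frac1{2\pi}\int_{\mathbb R}\mathcal Fg(\nu)\,\mathcal Fh(-\nu)\,d\nu$ is the $\dot H^{\beta-1}(\mathbb R)$–$\dot H^{1-\beta}(\mathbb R)$ duality pairing extending $\int gh\,ds$. -/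

import Mathlib

open MeasureTheory Filter Topology
open scoped SchwartzMap FourierTransform Laplacian LineDeriv ENNReal

noncomputable section

namespace RadiationField

section Sobolev

variable {V : Type*} [NormedAddCommGroup V] [InnerProductSpace ℝ V] [FiniteDimensional ℝ V]
  [MeasurableSpace V] [BorelSpace V]

/-- The tempered distribution `T` is (given by integration against) the locally integrable
function `g`. -/
def HasDensity (T : 𝓢'(V, ℂ)) (g : V → ℂ) : Prop :=
  LocallyIntegrable g volume ∧
    ∀ φ : 𝓢(V, ℂ), Integrable (fun x => g x * φ x) volume ∧ T φ = ∫ x, g x * φ x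

/-- The tempered distribution given by the function `g` (zero if there is none). -/
def ofDensity (g : V → ℂ) : 𝓢'(V, ℂ) :=
  open Classical in if h : ∃ T : 𝓢'(V, ℂ), HasDensity T g then h.choose else 0

/-- The Fourier transform of `f`, as a function defined up to null sets, when `𝓕 f` is a locally
integrable function (zero otherwise). The kernel of `𝓕` is `exp (-2πi ⟨x, ξ⟩)`. -/
def fourierDensity (f : 𝓢'(V, ℂ)) : V → ℂ :=
  open Classical in if h : ∃ g : V → ℂ, HasDensity (𝓕 f) g then h.choose else 0

/-- The norm of the homogeneous Sobolev space of order `s`, that is, the `L²` norm of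
`|2πξ|^s 𝓕 f (ξ)`. It is `∞` if `𝓕 f` is not a locally integrable function. -/
def homSobolevENorm (s : ℝ) (f : 𝓢'(V, ℂ)) : ℝ≥0∞ :=
  ⨅ (g : V → ℂ) (_ : HasDensity (𝓕 f) g),
    eLpNorm (fun ξ => (((2 * Real.pi * ‖ξ‖) ^ s : ℝ) : ℂ) * g ξ) 2 volume

/-- Membership in the homogeneous Sobolev space of order `s`. -/
def MemHomSobolev (s : ℝ) (f : 𝓢'(V, ℂ)) : Prop :=
  homSobolevENorm s f < ∞

/-- The Hilbert norm on a finite power of the homogeneous Sobolev space of order `s`. -/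
def homSobolevVecENorm {n : ℕ} (s : ℝ) (F : Fin n → 𝓢'(V, ℂ)) : ℝ≥0∞ :=
  (∑ k, homSobolevENorm s (F k) ^ 2) ^ (1 / 2 : ℝ)

/-- `u` is a free wave with initial data `(u₀, u₁)` in `Ḣ^β × Ḣ^(β-1)` and time derivative `v`:
the pair `(u, v)` is a continuous curve in `Ḣ^β × Ḣ^(β-1)`, and `∂ₜ u = v`, `∂ₜ v = Δ u` hold
in the sense of tempered distributions. -/
structure IsFreeWave (β : ℝ) (u₀ u₁ : 𝓢'(V, ℂ)) (u v : ℝ → 𝓢'(V, ℂ)) : Prop where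
  mem_left : ∀ t, MemHomSobolev β (u t)
  mem_right : ∀ t, MemHomSobolev (β - 1) (v t)
  continuous_left : ∀ t, Tendsto (fun τ => homSobolevENorm β (u τ - u t)) (𝓝 t) (𝓝 0)
  continuous_right : ∀ t, Tendsto (fun τ => homSobolevENorm (β - 1) (v τ - v t)) (𝓝 t) (𝓝 0)
  deriv_left : ∀ (φ : 𝓢(V, ℂ)) (t : ℝ), HasDerivAt (fun τ => u τ φ) (v t φ) t
  deriv_right : ∀ (φ : 𝓢(V, ℂ)) (t : ℝ), HasDerivAt (fun τ => v τ φ) ((Δ (u t)) φ) t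
  init_left : u 0 = u₀
  init_right : v 0 = u₁

end Sobolev

/-- The pairing of `f ∈ Ḣ^(-b)(ℝ)` with `h ∈ Ḣ^b(ℝ)` that extends `∫ f h ds`. -/
def pairing (f : 𝓢'(ℝ, ℂ)) (h : ℝ → ℂ) : ℂ :=
  ∫ κ, fourierDensity f κ * (𝓕⁻ h) κ

variable {d : ℕ}

/-- The unit sphere of `ℝ^d`; its surface measure is `volume.toSphere`. -/
abbrev UnitSphere (d : ℕ) : Type := Metric.sphere (0 : EuclideanSpace ℝ (Fin d)) 1

/-- The space-time gradient `(∂ₜ u, ∇ₓ u)` at a fixed time, for `v = ∂ₜ u`. -/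
def spaceTimeGradient (u v : 𝓢'(EuclideanSpace ℝ (Fin d), ℂ)) :
    Fin (d + 1) → 𝓢'(EuclideanSpace ℝ (Fin d), ℂ) :=
  Fin.cons v fun j : Fin d => ∂_{EuclideanSpace.single j (1 : ℝ)} u

/-- The partial Fourier transform in `s` of the radiation profile `G_σ`, `σ = ±1`, at the angular
frequency `ν = 2πκ`:
`c_d |ν|^((d-1)/2) (exp(iτ) 1_{ν<0} + exp(-iτ) 1_{ν≥0}) (û₁(νω) - σ i ν û₀(νω))`,
where `û(νω) = ∫ exp(-iν ω·x) u(x) dx`, `c_d = (2π)^(-(d-1)/2) / 2` and `τ = (d-1)π/4`. -/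
def profileHat (σ : ℝ) (u₀ u₁ : 𝓢'(EuclideanSpace ℝ (Fin d), ℂ)) (ω : UnitSphere d) (κ : ℝ) : ℂ :=
  let c : ℝ := 1 / (2 * (2 * Real.pi) ^ (((d : ℝ) - 1) / 2))
  let τ : ℝ := ((d : ℝ) - 1) / 4 * Real.pi
  let ν : ℝ := 2 * Real.pi * κ
  ((c * |ν| ^ (((d : ℝ) - 1) / 2) : ℝ) : ℂ) *
    (if ν < 0 then Complex.exp (Complex.I * τ) else Complex.exp (-(Complex.I * τ))) *
    (fourierDensity u₁ (κ • (ω : EuclideanSpace ℝ (Fin d)))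
      - σ * Complex.I * ν * fourierDensity u₀ (κ • (ω : EuclideanSpace ℝ (Fin d))))

/-- The radiation profile `G_σ = T_σ(u₀, u₁)`, `σ = ±1`, as a family, defined for almost every
direction `ω`, of tempered distributions `G_σ(·, ω)` on the line. -/
def radiationProfile (σ : ℝ) (u₀ u₁ : 𝓢'(EuclideanSpace ℝ (Fin d), ℂ)) (ω : UnitSphere d) :
    𝓢'(ℝ, ℂ) :=
  𝓕⁻ (ofDensity (profileHat σ u₀ u₁ ω))

/-- The components of the vector `(1, -σ ω)`. -/
def directionCoeff (σ : ℝ) (ω : UnitSphere d) : Fin (d + 1) → ℝ :=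
  Fin.cons 1 fun j : Fin d => -σ * (ω : EuclideanSpace ℝ (Fin d)) j

/-- The test function `φ` in the coordinates `x = (s + σ t) ω`, with its weight:
`(s + σ t)^((d-1)/2) φ((s + σ t) ω)` times the `k`-th component of `(1, -σ ω)` if `s + σ t > 0`,
and zero otherwise. -/
def pulledTest (σ t : ℝ) (k : Fin (d + 1)) (φ : 𝓢(EuclideanSpace ℝ (Fin d), ℂ))
    (ω : UnitSphere d) (s : ℝ) : ℂ :=
  if 0 < s + σ * t then
    (((s + σ * t) ^ (((d : ℝ) - 1) / 2) * directionCoeff σ ω k : ℝ) : ℂ) *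
      φ ((s + σ * t) • (ω : EuclideanSpace ℝ (Fin d)))
  else 0

/-- The `k`-th component of `|x|^(-(d-1)/2) G(|x| - σ t, x/|x|) (1, -σ x/|x|)` as a tempered
distribution in `x`. Since `G` is a distribution in `s`, this is understood through integration
in polar coordinates `x = (s + σ t) ω`: its value at `φ` is the integral over the sphere of the
pairing of `G(·, ω)` with `pulledTest σ t k φ ω`. -/
def radiationTerm (σ : ℝ) (G : UnitSphere d → 𝓢'(ℝ, ℂ)) (t : ℝ) (k : Fin (d + 1)) :
    𝓢'(EuclideanSpace ℝ (Fin d), ℂ) :=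
  open Classical in
  if h : ∃ W : 𝓢'(EuclideanSpace ℝ (Fin d), ℂ), ∀ φ : 𝓢(EuclideanSpace ℝ (Fin d), ℂ),
      W φ = ∫ ω : UnitSphere d, pairing (G ω) (pulledTest σ t k φ ω)
        ∂((volume : Measure (EuclideanSpace ℝ (Fin d))).toSphere)
  then h.choose else 0

end RadiationField

end

open MeasureTheory Filter Topology
open scoped SchwartzMap FourierTransform Laplacian LineDeriv ENNReal

set_option linter.unusedSectionVars false

noncomputable section

namespace RadiationField

/-! ### Homogeneous weights and weighted `L²` duality -/

section Weights

variable {V : Type*} [NormedAddCommGroup V] [InnerProductSpace ℝ V] [FiniteDimensional ℝ V]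
  [MeasurableSpace V] [BorelSpace V]

/-! With `D = |∇|`, the space-time gradient of a free wave is half the sum of two half waves
`exp(∓itD) w`, where the data `w` lie in the homogeneous Sobolev space of order `β - 1`. Complex
conjugation exchanges the two, and `t → -t` exchanges the two limits, so everything rests on one
statement about a single half wave. Put `θ = 1 - β ∈ (0, 1)`. In polar coordinates, the radiation
field of the half wave pairs with a test function `φ` through an operator `outgoing`, which replaces
`𝓕⁻ φ` at `κω` by a constant times `κ^(-(d-1)/2)` times the one-dimensional transform of
`r^((d-1)/2) φ(rω)`. The error therefore pairs with `φ` as `farField t w φ = ∫ exp(-it|2πξ|) w (𝓕⁻ φ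
- outgoing φ)`. By duality (`exists_homSobolev_of_bound`) it suffices that this is at most `ε` times
the norm of order `θ` of `φ`, for all `φ` at once and all large `t`; this is `farFieldDecay`, a
uniform bound combined with a dense class of data.

Uniform bound. `outgoing` is a contraction at order `0` by Plancherel on each ray. At order `1` it
is one by a Hardy-type inequality: `∫ |∂ᵣ(r^m φ)|² ≤ ∫ r^(2m) |∂ᵣφ|²` with `m = (d-1)/2`, since the
two sides differ by the integral of an exact derivative and a term with coefficient `m(m-1)`,
nonnegative exactly because `d ≥ 3`. Real interpolation, with the explicit splitting of `φ` by a
resolvent multiplier, gives boundedness at order `θ` (`wnorm_outgoing_le`).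

Dense class. For the data `exp(-2π|ξ|) exp(-2πi⟨ξ, y⟩)` the half wave is the Poisson kernel
continued analytically to the height `1 + it` (`integral_poisson`), hence explicit. Along rays it
converges, after the shift by `t` and multiplication by `r^((d-1)/2)`, to an explicit profile, with
an integrable majorant of its square; so the error tends to zero in `L²`. Smallness at order `0` and
boundedness at order `1` interpolate to smallness at order `θ` (`norm_le_of_split`). Linear
combinations of such data are dense, because an orthogonal function would have vanishing Fourier
transform.

Existence of the wave is written down on the Fourier side. Uniqueness (`IsFreeWave.unique`) tests
against band-limited functions: there all time derivatives of the pairing are bounded by `M R^k`, so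
the pairing is an entire function of time with zero Taylor coefficients. -/

/-- The homogeneous weight `|2πξ|^s`. -/
def wt (s : ℝ) (ξ : V) : ℝ := (2 * Real.pi * ‖ξ‖) ^ s

/-- The weighted `L²` norm that underlies the homogeneous Sobolev norm of order `s`. -/
def wnorm (s : ℝ) (g : V → ℂ) : ℝ≥0∞ :=
  eLpNorm (fun ξ => (wt s ξ : ℂ) * g ξ) 2 volume

lemma wt_nonneg (s : ℝ) (ξ : V) : 0 ≤ wt s ξ := by unfold wt; positivity

lemma wt_pos (s : ℝ) {ξ : V} (h : ξ ≠ 0) : 0 < wt s ξ := by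
  have := norm_pos_iff.2 h
  unfold wt; positivity

lemma wt_zero (ξ : V) : wt 0 ξ = 1 := by simp [wt]

lemma wt_one (ξ : V) : wt 1 ξ = 2 * Real.pi * ‖ξ‖ := by simp [wt]

lemma wt_neg_arg (s : ℝ) (ξ : V) : wt s (-ξ) = wt s ξ := by simp [wt]

lemma wt_add (s r : ℝ) {ξ : V} (h : ξ ≠ 0) : wt (s + r) ξ = wt s ξ * wt r ξ := by
  have := norm_pos_iff.2 h
  exact Real.rpow_add (by positivity) s r

lemma wt_mul_wt_neg (s : ℝ) {ξ : V} (h : ξ ≠ 0) : wt s ξ * wt (-s) ξ = 1 := by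
  rw [← wt_add s (-s) h, add_neg_cancel, wt_zero]

lemma measurable_wt (s : ℝ) : Measurable (wt s : V → ℝ) := by
  unfold wt; fun_prop

lemma ae_ne_zero [Nontrivial V] : ∀ᵐ ξ : V, ξ ≠ 0 := by
  simp [ae_iff, measure_singleton]

lemma aestronglyMeasurable_wt_mul (s : ℝ) {g : V → ℂ} (hg : AEStronglyMeasurable g volume) :
    AEStronglyMeasurable (fun ξ => (wt s ξ : ℂ) * g ξ) volume :=
  (Complex.measurable_ofReal.comp (measurable_wt s)).aestronglyMeasurable.mul hg

lemma memLp_wt_mul {s : ℝ} {g : V → ℂ} (hg : AEStronglyMeasurable g volume)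
    (h : wnorm s g < ∞) : MemLp (fun ξ => (wt s ξ : ℂ) * g ξ) 2 volume :=
  ⟨aestronglyMeasurable_wt_mul s hg, h⟩

lemma wnorm_congr_ae {s : ℝ} {g g' : V → ℂ} (h : g =ᵐ[volume] g') : wnorm s g = wnorm s g' :=
  eLpNorm_congr_ae (h.mono fun x hx => by simp only [hx])

lemma wnorm_mono {s r : ℝ} {f g : V → ℂ}
    (h : ∀ᵐ ξ, wt s ξ * ‖f ξ‖ ≤ wt r ξ * ‖g ξ‖) : wnorm s f ≤ wnorm r g := by
  refine eLpNorm_mono_ae (h.mono fun ξ hξ => ?_)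
  simpa [abs_of_nonneg (wt_nonneg _ ξ)] using hξ

lemma wnorm_add_le {s : ℝ} {f g : V → ℂ} (hf : AEStronglyMeasurable f volume)
    (hg : AEStronglyMeasurable g volume) :
    wnorm s (fun ξ => f ξ + g ξ) ≤ wnorm s f + wnorm s g := by
  have := eLpNorm_add_le (aestronglyMeasurable_wt_mul s hf) (aestronglyMeasurable_wt_mul s hg)
    (p := 2) one_le_two
  refine le_trans (le_of_eq ?_) this
  unfold wnorm
  congr 1; ext ξ; simp [mul_add]

lemma wnorm_const_mul (s : ℝ) (c : ℂ) (f : V → ℂ) :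
    wnorm s (fun ξ => c * f ξ) = ‖c‖ₑ * wnorm s f := by
  unfold wnorm
  rw [← eLpNorm_const_smul]
  congr 1; ext ξ; simp only [Pi.smul_apply, smul_eq_mul]; ring

lemma wnorm_neg_arg (s : ℝ) {f : V → ℂ} (hf : AEStronglyMeasurable f volume) :
    wnorm s (fun ξ => f (-ξ)) = wnorm s f := by
  unfold wnorm
  rw [← eLpNorm_comp_measurePreserving (aestronglyMeasurable_wt_mul s hf)
    (Measure.measurePreserving_neg (volume : Measure V))]
  congr 1; ext ξ; simp [wt_neg_arg]

/-- Cauchy–Schwarz after inserting `wt s * wt (-s) = 1`, which fails at most at the origin, a null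
set. This is the duality of the orders `s` and `-s` used throughout. -/
lemma integrable_mul_of_wnorm [Nontrivial V] {s : ℝ} {g f : V → ℂ}
    (hg : AEStronglyMeasurable g volume)
    (hf : AEStronglyMeasurable f volume) (h1 : wnorm s g < ∞) (h2 : wnorm (-s) f < ∞) :
    Integrable (fun ξ => g ξ * f ξ) volume ∧
      ‖∫ ξ, g ξ * f ξ‖ ≤ (wnorm s g).toReal * (wnorm (-s) f).toReal := by
  have e : (fun ξ => ((wt s ξ : ℂ) * g ξ) * ((wt (-s) ξ : ℂ) * f ξ)) =ᵐ[volume]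
      fun ξ => g ξ * f ξ := by
    filter_upwards [ae_ne_zero] with ξ hξ
    have : (wt s ξ : ℂ) * (wt (-s) ξ : ℂ) = 1 := by
      rw [← Complex.ofReal_mul, wt_mul_wt_neg s hξ, Complex.ofReal_one]
    linear_combination g ξ * f ξ * this
  have m1 := memLp_wt_mul hg h1
  have m2 := memLp_wt_mul hf h2
  have i : Integrable (fun ξ => ((wt s ξ : ℂ) * g ξ) * ((wt (-s) ξ : ℂ) * f ξ)) volume :=
    m1.integrable_mul m2
  refine ⟨i.congr e, ?_⟩
  rw [← integral_congr_ae e]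
  have := eLpNorm_smul_le_mul_eLpNorm (p := 2) (q := 2) (r := 1) m2.1 m1.1
  have h3 : ‖∫ ξ, ((wt s ξ : ℂ) * g ξ) * ((wt (-s) ξ : ℂ) * f ξ)‖ₑ ≤ wnorm s g * wnorm (-s) f := by
    refine (enorm_integral_le_lintegral_enorm _).trans ?_
    rw [← eLpNorm_one_eq_lintegral_enorm]
    exact this
  rw [← ENNReal.toReal_mul, ← toReal_enorm]
  exact ENNReal.toReal_mono (ENNReal.mul_lt_top h1 h2).ne h3

/-- In polar coordinates the squared integrand is `r^(n-1+2s) (1+r)^(-2k)` up to a constant. The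
hypothesis is integrability at the origin; a large `k` takes care of infinity. -/
lemma exists_memLp_wt_mul_inv_one_add_pow [Nontrivial V] {s : ℝ}
    (hs : -(Module.finrank ℝ V : ℝ) < 2 * s) :
    ∃ k : ℕ, MemLp (fun x : V => wt s x * ((1 + ‖x‖) ^ k)⁻¹) 2 volume := by
  -- This choice, with `N ≥ 1`, makes the exponent `n - 1 + 2s - 2N` at most `-2` on `r > 1`.
  obtain ⟨N, hN⟩ := exists_nat_gt (2 * |s| + Module.finrank ℝ V)
  refine ⟨N, ?_⟩
  have hmeas : AEStronglyMeasurable (fun x : V => wt s x * ((1 + ‖x‖) ^ N)⁻¹) volume := by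
    refine (measurable_wt s).aestronglyMeasurable.mul ?_
    exact Measurable.aestronglyMeasurable (by fun_prop)
  rw [memLp_two_iff_integrable_sq_norm hmeas]
  have e : (fun x : V => ‖wt s x * ((1 + ‖x‖) ^ N)⁻¹‖ ^ 2)
      = fun x : V => (fun y : ℝ => (2 * Real.pi * y) ^ (2 * s) * ((1 + y) ^ (2 * N))⁻¹) ‖x‖ := by
    ext x
    rw [Real.norm_eq_abs, sq_abs, mul_pow, wt, ← Real.rpow_natCast, ← Real.rpow_mul (by positivity)]
    simp only [inv_pow, ← pow_mul]
    norm_num [mul_comm]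
  have hn : 1 ≤ Module.finrank ℝ V := Module.finrank_pos
  rw [e]
  refine (integrable_fun_norm_addHaar (f := fun y : ℝ =>
    (2 * Real.pi * y) ^ (2 * s) * ((1 + y) ^ (2 * N))⁻¹) volume).2 ?_
  rw [← Set.Ioc_union_Ioi_eq_Ioi zero_le_one, integrableOn_union]
  have m : Measurable fun y : ℝ => y ^ (Module.finrank ℝ V - 1) •
      ((2 * Real.pi * y) ^ (2 * s) * ((1 + y) ^ (2 * N))⁻¹) := by fun_prop
  have key : ∀ y : ℝ, 0 < y → ‖y ^ (Module.finrank ℝ V - 1) •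
      ((2 * Real.pi * y) ^ (2 * s) * ((1 + y) ^ (2 * N))⁻¹)‖ =
      (2 * Real.pi) ^ (2 * s) * (y ^ ((Module.finrank ℝ V : ℝ) - 1 + 2 * s) *
        ((1 + y) ^ (2 * N))⁻¹) := by
    intro y hy
    rw [Real.norm_of_nonneg (by positivity), smul_eq_mul, Real.mul_rpow (by positivity) hy.le,
      Real.rpow_add hy, ← Real.rpow_natCast y, Nat.cast_sub hn, Nat.cast_one]
    ring
  constructor
  · have i1 : IntegrableOn (fun y : ℝ => (2 * Real.pi) ^ (2 * s) *
        y ^ ((Module.finrank ℝ V : ℝ) - 1 + 2 * s)) (Set.Ioc 0 1) := by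
      refine Integrable.const_mul ?_ _
      exact (intervalIntegrable_iff_integrableOn_Ioc_of_le zero_le_one).1
        (intervalIntegral.intervalIntegrable_rpow' (by linarith))
    refine i1.mono' m.aestronglyMeasurable ?_
    filter_upwards [ae_restrict_mem measurableSet_Ioc] with y hy
    rw [key y hy.1]
    have h0 := hy.1
    have : ((1 + y) ^ (2 * N))⁻¹ ≤ 1 := inv_le_one_of_one_le₀ (one_le_pow₀ (by linarith))
    gcongr
    exact mul_le_of_le_one_right (by positivity) this
  · have i1 : IntegrableOn (fun y : ℝ => (2 * Real.pi) ^ (2 * s) * y ^ (-2 : ℝ)) (Set.Ioi 1) :=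
      (integrableOn_Ioi_rpow_of_lt (by norm_num) one_pos).const_mul _
    refine i1.mono' m.aestronglyMeasurable ?_
    filter_upwards [ae_restrict_mem measurableSet_Ioi] with y hy
    have hy1 : (1 : ℝ) < y := hy
    have h0 : 0 < y := by linarith
    rw [key y h0]
    gcongr
    calc _ ≤ y ^ ((Module.finrank ℝ V : ℝ) - 1 + 2 * s) * (y ^ (2 * N))⁻¹ := by
          gcongr; linarith
      _ = y ^ ((Module.finrank ℝ V : ℝ) - 1 + 2 * s - 2 * N) := by
          rw [Real.rpow_sub h0, ← Real.rpow_natCast y]; push_cast; rfl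
      _ ≤ y ^ (-2 : ℝ) := by
          refine Real.rpow_le_rpow_of_exponent_le hy1.le ?_
          have := le_abs_self s
          have : (1 : ℝ) ≤ N := by
            have : 0 < N := by
              have : (0 : ℝ) < N := lt_of_le_of_lt (by positivity) hN
              exact_mod_cast this
            exact_mod_cast this
          linarith [abs_nonneg s, (Nat.cast_nonneg (Module.finrank ℝ V) : (0:ℝ) ≤ _)]

lemma one_add_pow_mul_schwartz_le (φ : 𝓢(V, ℂ)) (k : ℕ) (x : V) :
    ‖φ x‖ ≤ ((1 + ‖x‖) ^ k)⁻¹ *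
      (2 ^ k * (Finset.Iic (k, 0)).sup (schwartzSeminormFamily ℂ V ℂ) φ) := by
  have := SchwartzMap.one_add_le_sup_seminorm_apply (𝕜 := ℂ) (m := (k, 0)) le_rfl le_rfl φ x
  rw [norm_iteratedFDeriv_zero] at this
  rw [inv_mul_eq_div, le_div_iff₀ (by positivity), mul_comm]
  exact this

lemma wnorm_schwartz_lt_top [Nontrivial V] {s : ℝ} (hs : -(Module.finrank ℝ V : ℝ) < 2 * s)
    (φ : 𝓢(V, ℂ)) : wnorm s φ < ∞ := by
  obtain ⟨k, hk⟩ := exists_memLp_wt_mul_inv_one_add_pow hs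
  have := hk.const_mul (2 ^ k * (Finset.Iic (k, 0)).sup (schwartzSeminormFamily ℂ V ℂ) φ)
  refine lt_of_le_of_lt (eLpNorm_mono fun x => ?_) this.2
  rw [norm_mul, Complex.norm_real, Real.norm_of_nonneg (wt_nonneg _ _)]
  refine (mul_le_mul_of_nonneg_left (one_add_pow_mul_schwartz_le φ k x) (wt_nonneg _ _)).trans ?_
  refine le_trans (le_of_eq ?_) (le_abs_self _)
  ring

end Weights

/-! ### Densities of tempered distributions and Sobolev duality -/

section Density

variable {V : Type*} [NormedAddCommGroup V] [InnerProductSpace ℝ V] [FiniteDimensional ℝ V]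
  [MeasurableSpace V] [BorelSpace V]

lemma ae_eq_zero_of_forall_integral_mul_schwartz {g : V → ℂ} (hg : LocallyIntegrable g volume)
    (h : ∀ φ : 𝓢(V, ℂ), HasCompactSupport φ → ∫ x, g x * φ x = 0) : g =ᵐ[volume] 0 := by
  refine ae_eq_zero_of_integral_contDiff_smul_eq_zero hg fun ψ hψ hc => ?_
  have h₁ : HasCompactSupport (Complex.ofRealCLM ∘ ψ) := hc.comp_left rfl
  have h₂ : ContDiff ℝ ((⊤ : ℕ∞) : WithTop ℕ∞) (Complex.ofRealCLM ∘ ψ) :=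
    Complex.ofRealCLM.contDiff.comp hψ
  rw [← h (h₁.toSchwartzMap h₂) h₁]
  refine integral_congr_ae (.of_forall fun x => ?_)
  simp [mul_comm]

lemma HasDensity.ae_eq {T : 𝓢'(V, ℂ)} {g g' : V → ℂ} (h : HasDensity T g)
    (h' : HasDensity T g') : g =ᵐ[volume] g' := by
  have : (fun x => g x - g' x) =ᵐ[volume] 0 := by
    refine ae_eq_zero_of_forall_integral_mul_schwartz (h.1.sub h'.1) fun φ _ => ?_
    simp_rw [sub_mul]
    rw [integral_sub (h.2 φ).1 (h'.2 φ).1, ← (h.2 φ).2, ← (h'.2 φ).2, sub_self]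
  filter_upwards [this] with x hx
  exact sub_eq_zero.1 hx

lemma HasDensity.ext {T T' : 𝓢'(V, ℂ)} {g : V → ℂ} (h : HasDensity T g)
    (h' : HasDensity T' g) : T = T' := by
  ext φ; rw [(h.2 φ).2, (h'.2 φ).2]

lemma HasDensity.congr {T : 𝓢'(V, ℂ)} {g g' : V → ℂ} (h : HasDensity T g)
    (e : g =ᵐ[volume] g') : HasDensity T g' := by
  have e' : ∀ φ : 𝓢(V, ℂ), (fun x => g x * φ x) =ᵐ[volume] fun x => g' x * φ x := fun φ =>
    e.mono fun x hx => by simp only [hx]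
  refine ⟨fun x => ?_, fun φ => ⟨(h.2 φ).1.congr (e' φ), ?_⟩⟩
  · exact (h.1 x).congr e
  · rw [(h.2 φ).2, integral_congr_ae (e' φ)]

lemma HasDensity.sub {T T' : 𝓢'(V, ℂ)} {g g' : V → ℂ} (h : HasDensity T g)
    (h' : HasDensity T' g') : HasDensity (T - T') (fun x => g x - g' x) := by
  have e : ∀ φ : 𝓢(V, ℂ), (fun x => (g x - g' x) * φ x) = fun x => g x * φ x - g' x * φ x :=
    fun φ => by ext x; ring
  refine ⟨h.1.sub h'.1, fun φ => ⟨?_, ?_⟩⟩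
  · rw [e]; exact (h.2 φ).1.sub (h'.2 φ).1
  · rw [e, integral_sub (h.2 φ).1 (h'.2 φ).1, ← (h.2 φ).2, ← (h'.2 φ).2]; rfl

/-- For `2s < n` some `(1+|x|)^(-k)` lies in the dual weighted space, so `g (1+|x|)^(-k)` is
integrable. This yields local integrability of `g` and bounds the pairing by a Schwartz seminorm. -/
lemma exists_hasDensity_of_wnorm [Nontrivial V] {s : ℝ} (hs : 2 * s < Module.finrank ℝ V)
    {g : V → ℂ} (hg : AEStronglyMeasurable g volume) (h : wnorm s g < ∞) :
    ∃ T : 𝓢'(V, ℂ), HasDensity T g := by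
  obtain ⟨k, hk⟩ := exists_memLp_wt_mul_inv_one_add_pow (V := V) (s := -s) (by linarith)
  have hi : Integrable (fun x => g x * (((1 + ‖x‖) ^ k)⁻¹ : ℝ)) volume := by
    have hk' : wnorm (-s) (fun x : V => ((((1 + ‖x‖) ^ k)⁻¹ : ℝ) : ℂ)) < ∞ := by
      refine lt_of_le_of_lt (eLpNorm_mono fun x => ?_) hk.2
      rw [← Complex.ofReal_mul, Complex.norm_real]
    refine (integrable_mul_of_wnorm hg ?_ h hk').1
    exact Measurable.aestronglyMeasurable (by fun_prop)
  have hl : LocallyIntegrable g volume := by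
    have h2 : Continuous fun x : V => (1 + ‖x‖) ^ k := by fun_prop
    have := (locallyIntegrableOn_univ.2 hi.locallyIntegrable).continuousOn_smul
      isClosed_univ.isLocallyClosed h2.continuousOn
    refine locallyIntegrableOn_univ.1 (this.congr (.of_forall fun x => ?_))
    have : ((1 + ‖x‖) ^ k : ℂ) ≠ 0 := by
      have : (1 + ‖x‖) ^ k ≠ 0 := by positivity
      exact_mod_cast this
    simp only [Complex.real_smul]
    push_cast
    field_simp
  have hφ : ∀ φ : 𝓢(V, ℂ), ∀ x, ‖g x * φ x‖ ≤
      ‖g x * (((1 + ‖x‖) ^ k)⁻¹ : ℝ)‖ *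
        (2 ^ k * (Finset.Iic (k, 0)).sup (schwartzSeminormFamily ℂ V ℂ) φ) := by
    intro φ x
    rw [norm_mul, norm_mul, Complex.norm_real, Real.norm_of_nonneg (by positivity), mul_assoc]
    exact mul_le_mul_of_nonneg_left (one_add_pow_mul_schwartz_le φ k x) (norm_nonneg _)
  have hint : ∀ φ : 𝓢(V, ℂ), Integrable (fun x => g x * φ x) volume := fun φ =>
    (hi.norm.mul_const _).mono' (hg.mul φ.continuous.aestronglyMeasurable) (.of_forall (hφ φ))
  let T : 𝓢(V, ℂ) →L[ℂ] ℂ := SchwartzMap.mkCLMtoNormedSpace (fun φ => ∫ x, g x * φ x)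
    (fun φ ψ => by
      rw [← integral_add (hint φ) (hint ψ)]
      simp [mul_add])
    (fun a φ => by
      rw [RingHom.id_apply, smul_eq_mul, ← integral_const_mul]
      simp [mul_left_comm])
    ⟨Finset.Iic (k, 0), (∫ x, ‖g x * (((1 + ‖x‖) ^ k)⁻¹ : ℝ)‖) * 2 ^ k, by positivity, fun φ => by
      rw [mul_assoc, ← integral_mul_const]
      exact norm_integral_le_of_norm_le (hi.norm.mul_const _) (.of_forall (hφ φ))⟩
  exact ⟨ContinuousLinearMap.toPointwiseConvergenceCLM _ _ _ _ T, hl, fun φ => ⟨hint φ, rfl⟩⟩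

lemma hasDensity_ofDensity {g : V → ℂ} (h : ∃ T : 𝓢'(V, ℂ), HasDensity T g) :
    HasDensity (ofDensity g) g := by
  unfold ofDensity
  rw [dif_pos h]
  exact h.choose_spec

lemma hasDensity_fourierDensity {f : 𝓢'(V, ℂ)} (h : ∃ g : V → ℂ, HasDensity (𝓕 f) g) :
    HasDensity (𝓕 f) (fourierDensity f) := by
  unfold fourierDensity
  rw [dif_pos h]
  exact h.choose_spec

/-- The infimum in the norm runs over densities of the same distribution; these agree almost
everywhere, so it is an infimum of a constant. -/
lemma homSobolevENorm_eq {s : ℝ} {f : 𝓢'(V, ℂ)} {g : V → ℂ} (h : HasDensity (𝓕 f) g) :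
    homSobolevENorm s f = wnorm s g := by
  refine le_antisymm (iInf₂_le g h) (le_iInf₂ fun g' h' => ?_)
  exact (wnorm_congr_ae (h.ae_eq h')).le

/-- Without a density the infimum is over the empty family, hence infinite. -/
lemma MemHomSobolev.hasDensity {s : ℝ} {f : 𝓢'(V, ℂ)} (h : MemHomSobolev s f) :
    HasDensity (𝓕 f) (fourierDensity f) := by
  refine hasDensity_fourierDensity ?_
  by_contra hc
  push Not at hc
  unfold MemHomSobolev homSobolevENorm at h
  simp [hc] at h

lemma MemHomSobolev.wnorm_lt_top {s : ℝ} {f : 𝓢'(V, ℂ)} (h : MemHomSobolev s f) :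
    wnorm s (fourierDensity f) < ∞ := by
  rw [← homSobolevENorm_eq h.hasDensity]; exact h

lemma HasDensity.apply_eq {f : 𝓢'(V, ℂ)} {g : V → ℂ} (h : HasDensity (𝓕 f) g) (φ : 𝓢(V, ℂ)) :
    Integrable (fun ξ => g ξ * (𝓕⁻ φ) ξ) volume ∧ f φ = ∫ ξ, g ξ * (𝓕⁻ φ) ξ := by
  refine ⟨(h.2 _).1, ?_⟩
  rw [← (h.2 _).2, TemperedDistribution.fourier_apply, FourierTransform.fourier_fourierInv_eq]

/-- A linear functional on Schwartz functions that is bounded for the homogeneous Sobolev norm of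
order `s` is a distribution in the homogeneous Sobolev space of order `-s`. -/
lemma exists_homSobolev_of_bound [Nontrivial V] {s : ℝ} (hs : -(Module.finrank ℝ V : ℝ) < 2 * s)
    (L : 𝓢(V, ℂ) →ₗ[ℂ] ℂ) {M : ℝ} (hM : 0 ≤ M)
    (hL : ∀ φ, ‖L φ‖ ≤ M * (wnorm s (𝓕⁻ φ : 𝓢(V, ℂ))).toReal) :
    ∃ W : 𝓢'(V, ℂ), (∀ φ, W φ = L φ) ∧ homSobolevENorm (-s) W ≤ ENNReal.ofReal M := by
  have hm : ∀ φ : 𝓢(V, ℂ), MemLp (fun ξ => (wt s ξ : ℂ) * φ ξ) 2 volume := fun φ =>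
    memLp_wt_mul φ.continuous.aestronglyMeasurable (wnorm_schwartz_lt_top hs φ)
  let j : 𝓢(V, ℂ) →ₗ[ℂ] Lp ℂ 2 (volume : Measure V) :=
    { toFun := fun φ => (hm φ).toLp _
      map_add' := fun φ ψ => by
        rw [← MemLp.toLp_add]
        congr 1; ext ξ; simp [mul_add]
      map_smul' := fun c φ => by
        rw [RingHom.id_apply, ← MemLp.toLp_const_smul]
        congr 1; ext ξ; simp [mul_left_comm] }
  have hj : ∀ φ, ‖j φ‖ = (wnorm s φ).toReal := fun φ => Lp.norm_toLp _ (hm φ)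
  let L' : 𝓢(V, ℂ) →ₗ[ℂ] ℂ := L ∘ₗ (FourierTransform.fourierCLM ℂ 𝓢(V, ℂ)).toLinearMap
  have hL' : ∀ φ, ‖L' φ‖ ≤ M * ‖j φ‖ := fun φ => by
    refine (hL (𝓕 φ)).trans (le_of_eq ?_)
    rw [hj, FourierTransform.fourierInv_fourier_eq]
  -- The bound forces `L'` to factor through the embedding `j` into `L²`. The induced functional on
  -- the range is extended by Hahn–Banach without increasing its norm, then represented by Riesz as
  -- the inner product with some `v`.
  have hker : ∀ φ ψ, j φ = j ψ → L' φ = L' ψ := fun φ ψ h => by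
    have := hL' (φ - ψ)
    rw [map_sub, map_sub, h, sub_self, norm_zero, mul_zero] at this
    exact sub_eq_zero.1 (norm_le_zero_iff.1 this)
  have hex : ∀ y : LinearMap.range j, ∃ φ, j φ = y := fun y => y.2
  choose q hq using hex
  let ℓ : LinearMap.range j →ₗ[ℂ] ℂ :=
    { toFun := fun y => L' (q y)
      map_add' := fun x y => by
        rw [← map_add]; apply hker; rw [map_add, hq, hq, hq]; rfl
      map_smul' := fun c x => by
        rw [RingHom.id_apply, ← map_smul]; apply hker; rw [map_smul, hq, hq]; rfl }
  let ℓ' : StrongDual ℂ (LinearMap.range j) := ℓ.mkContinuous M fun y => by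
    refine (hL' _).trans (le_of_eq ?_)
    rw [hq]; rfl
  obtain ⟨F, hF, hFn⟩ := exists_extension_norm_eq _ ℓ'
  let v : Lp ℂ 2 (volume : Measure V) := (InnerProductSpace.toDual ℂ _).symm F
  have hv : ‖v‖ ≤ M := by
    rw [LinearIsometryEquiv.norm_map, hFn]
    exact LinearMap.mkContinuous_norm_le _ hM _
  have hLv : ∀ φ, L' φ = inner ℂ v (j φ) := fun φ => by
    rw [InnerProductSpace.toDual_symm_apply]
    have := hF ⟨j φ, φ, rfl⟩
    rw [this]
    exact hker _ _ (hq ⟨j φ, φ, rfl⟩).symm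
  -- The inner product of `v` with `wt s * χ` is the integral of `w χ`: the weight moves to `v`, and
  -- the conjugate compensates for the conjugate-linear slot.
  let w : V → ℂ := fun ξ => (wt s ξ : ℂ) * (starRingEnd ℂ) (v ξ)
  have hvm : AEStronglyMeasurable (fun ξ => (starRingEnd ℂ) (v ξ)) volume :=
    Complex.continuous_conj.comp_aestronglyMeasurable (Lp.aestronglyMeasurable v)
  have hwm : AEStronglyMeasurable w volume := aestronglyMeasurable_wt_mul s hvm
  have hw : wnorm (-s) w ≤ ENNReal.ofReal M := by
    have : wnorm (-s) w = ‖v‖ₑ := by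
      rw [Lp.enorm_def]
      refine eLpNorm_congr_norm_ae ?_
      filter_upwards [ae_ne_zero] with ξ hξ
      have := wt_mul_wt_neg s hξ
      simp only [w]
      rw [← mul_assoc, ← Complex.ofReal_mul, mul_comm (wt (-s) ξ), this]
      simp
    rw [this, ← ofReal_norm]
    exact ENNReal.ofReal_le_ofReal hv
  obtain ⟨T, hT⟩ := exists_hasDensity_of_wnorm (s := -s) (by linarith) hwm
    (hw.trans_lt ENNReal.ofReal_lt_top)
  refine ⟨𝓕⁻ T, fun φ => ?_, ?_⟩
  · rw [TemperedDistribution.fourierInv_apply, (hT.2 _).2]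
    have : L φ = L' (𝓕⁻ φ) := by
      change L φ = L (𝓕 (𝓕⁻ φ))
      rw [FourierTransform.fourier_fourierInv_eq]
    rw [this, hLv, L2.inner_def]
    refine integral_congr_ae ?_
    filter_upwards [(hm (𝓕⁻ φ)).coeFn_toLp] with ξ hξ
    change w ξ * _ = inner ℂ (v ξ) ((hm (𝓕⁻ φ)).toLp _ ξ)
    rw [hξ]
    simp only [w, RCLike.inner_apply]
    ring
  · have : HasDensity (𝓕 (𝓕⁻ T)) w := by rwa [FourierTransform.fourier_fourierInv_eq]
    rw [homSobolevENorm_eq this]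
    exact hw

end Density

/-! ### Plancherel for integrable square integrable functions -/

section Plancherel

variable {V : Type*} [NormedAddCommGroup V] [InnerProductSpace ℝ V] [FiniteDimensional ℝ V]
  [MeasurableSpace V] [BorelSpace V]

lemma continuous_fourier_of_integrable {f : V → ℂ} (hf : Integrable f volume) :
    Continuous (𝓕 f) :=
  VectorFourier.fourierIntegral_continuous Real.continuous_fourierChar
    (by exact continuous_inner) hf

lemma integral_mul_fourier_eq {f g : V → ℂ} (hf : Integrable f volume)
    (hg : Integrable g volume) : ∫ x, f x * 𝓕 g x = ∫ x, 𝓕 f x * g x := by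
  have := VectorFourier.integral_fourierIntegral_smul_eq_flip (e := Real.fourierChar)
    (μ := (volume : Measure V)) (ν := (volume : Measure V)) (L := innerₗ V) (f := f) (g := g)
    Real.continuous_fourierChar (by exact continuous_inner) hf hg
  rw [flip_innerₗ] at this
  exact this.symm

lemma integral_mul_fourierInv_eq {f g : V → ℂ} (hf : Integrable f volume)
    (hg : Integrable g volume) : ∫ x, f x * 𝓕⁻ g x = ∫ x, 𝓕⁻ f x * g x := by
  have e : ∀ h : V → ℂ, ∀ x, 𝓕⁻ h x = 𝓕 h (-x) := fun h x => Real.fourierInv_eq_fourier_neg h x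
  have e' : ∀ x, 𝓕 f (-x) = 𝓕 (fun y => f (-y)) x := fun x => by
    rw [← e, Real.fourierInv_eq_fourier_comp_neg]
  simp_rw [e]
  rw [← integral_neg_eq_self (fun x => f x * 𝓕 g (-x))]
  simp_rw [e', neg_neg]
  exact integral_mul_fourier_eq hf.comp_neg hg

/-- Plancherel's theorem for integrable square integrable functions. -/
lemma eLpNorm_fourier {f : V → ℂ} (hf : Integrable f volume) (hf2 : MemLp f 2 volume) :
    eLpNorm (𝓕 f) 2 volume = eLpNorm f 2 volume := by
  let F : Lp ℂ 2 (volume : Measure V) := hf2.toLp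
  have hlp : LocallyIntegrable (fun x => (𝓕 F : Lp ℂ 2 (volume : Measure V)) x) volume :=
    (Lp.memLp _).locallyIntegrable one_le_two
  have hlf : LocallyIntegrable (𝓕 f) volume :=
    (continuous_fourier_of_integrable hf).locallyIntegrable
  -- The `L²` transform and the integral transform are both locally integrable, so they agree as
  -- soon as they agree against compactly supported Schwartz functions.
  have key : (fun x => (𝓕 F : Lp ℂ 2 (volume : Measure V)) x - 𝓕 f x) =ᵐ[volume] 0 := by
    refine ae_eq_zero_of_forall_integral_mul_schwartz (hlp.sub hlf) fun φ hφ => ?_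
    have h1 : ∫ x, (𝓕 F : Lp ℂ 2 (volume : Measure V)) x * φ x = ∫ x, 𝓕 f x * φ x := by
      have h2 := congrArg (fun T : 𝓢'(V, ℂ) => T φ) (Lp.fourier_toTemperedDistribution_eq F)
      simp only [TemperedDistribution.fourier_apply, Lp.toTemperedDistribution_apply,
        smul_eq_mul] at h2
      rw [← integral_mul_fourier_eq hf φ.integrable]
      have : ∫ x, f x * 𝓕 (φ : V → ℂ) x = ∫ x, (𝓕 φ : 𝓢(V, ℂ)) x * F x := by
        refine integral_congr_ae (hf2.coeFn_toLp.mono fun x hx => ?_)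
        simp only [F]
        rw [hx, mul_comm]; rfl
      rw [this, h2]
      simp_rw [mul_comm]
    have i1 := hlp.integrable_smul_right_of_hasCompactSupport φ.continuous hφ
    have i2 := hlf.integrable_smul_right_of_hasCompactSupport φ.continuous hφ
    simp only [smul_eq_mul] at i1 i2
    simp_rw [sub_mul]
    rw [integral_sub i1 i2, h1, sub_self]
  have e : (𝓕 F : Lp ℂ 2 (volume : Measure V)) =ᵐ[volume] 𝓕 f := by
    filter_upwards [key] with x hx using sub_eq_zero.1 hx
  rw [← eLpNorm_congr_ae e, ← eLpNorm_congr_ae hf2.coeFn_toLp]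
  have := Lp.norm_fourier_eq F
  rw [Lp.norm_def, Lp.norm_def, ENNReal.toReal_eq_toReal_iff' (Lp.eLpNorm_ne_top _)
    (Lp.eLpNorm_ne_top _)] at this
  exact this

lemma eLpNorm_fourierInv {f : V → ℂ} (hf : Integrable f volume) (hf2 : MemLp f 2 volume) :
    eLpNorm (𝓕⁻ f) 2 volume = eLpNorm f 2 volume := by
  rw [← eLpNorm_fourier hf hf2, ← eLpNorm_comp_measurePreserving
    (continuous_fourier_of_integrable hf).aestronglyMeasurable
    (Measure.measurePreserving_neg (volume : Measure V))]
  congr 1; ext x; exact Real.fourierInv_eq_fourier_neg f x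

lemma lintegral_enorm_sq_fourierInv {f : V → ℂ} (hf : Integrable f volume)
    (hf2 : MemLp f 2 volume) : ∫⁻ x, ‖𝓕⁻ f x‖ₑ ^ 2 = ∫⁻ x, ‖f x‖ₑ ^ 2 := by
  have := eLpNorm_fourierInv hf hf2
  have h := congrArg (fun y => y ^ (2 : ℝ)) this
  simp only [eLpNorm_eq_lintegral_rpow_enorm_toReal two_ne_zero ENNReal.ofNat_ne_top,
    ENNReal.toReal_ofNat, ← ENNReal.rpow_mul] at h
  simpa using h

end Plancherel

/-! ### Polar coordinates -/

section Polar

variable {V : Type*} [NormedAddCommGroup V] [InnerProductSpace ℝ V] [FiniteDimensional ℝ V]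
  [MeasurableSpace V] [BorelSpace V]

/-- The radial part `r^n dr` of Lebesgue measure in polar coordinates. -/
def radialMeasure (n : ℕ) : Measure ℝ :=
  (volume.restrict (Set.Ioi 0)).withDensity fun r => ENNReal.ofReal (r ^ n)

instance (n : ℕ) : SFinite (radialMeasure n) := by unfold radialMeasure; infer_instance

lemma measurePreserving_val_volumeIoiPow (n : ℕ) :
    MeasurePreserving (Subtype.val : Set.Ioi (0 : ℝ) → ℝ) (Measure.volumeIoiPow n)
      (radialMeasure n) := by
  refine ⟨measurable_subtype_coe, Measure.ext fun s hs => ?_⟩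
  rw [Measure.map_apply measurable_subtype_coe hs, Measure.volumeIoiPow, radialMeasure,
    withDensity_apply _ (measurable_subtype_coe hs), withDensity_apply _ hs,
    setLIntegral_subtype measurableSet_Ioi _ fun a : ℝ => ENNReal.ofReal (a ^ n),
    Measure.restrict_restrict hs, Subtype.image_preimage_coe, Set.inter_comm]

/-- The radial variable ranges over `ℝ`, with a measure concentrated on the half line, so that
one-dimensional Fourier analysis applies on rays without subtypes. -/
lemma measurePreserving_polar [Nontrivial V] :
    MeasurePreserving (fun p : Metric.sphere (0 : V) 1 × ℝ => p.2 • (p.1 : V))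
      ((volume : Measure V).toSphere.prod (radialMeasure (Module.finrank ℝ V - 1))) volume := by
  have hg : Measurable fun p : Metric.sphere (0 : V) 1 × ℝ => p.2 • (p.1 : V) := by fun_prop
  have h1 := (MeasurePreserving.id (volume : Measure V).toSphere).prod
    (measurePreserving_val_volumeIoiPow (Module.finrank ℝ V - 1))
  have h2 := (Measure.measurePreserving_homeomorphUnitSphereProd (volume : Measure V)).symm
    (e := (homeomorphUnitSphereProd V).toMeasurableEquiv)
  have h3 : MeasurePreserving (Subtype.val : ({0}ᶜ : Set V) → V)
      ((volume : Measure V).comap Subtype.val) volume := by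
    refine ⟨measurable_subtype_coe, ?_⟩
    rw [(MeasurableEmbedding.subtype_coe (measurableSet_singleton _).compl).map_comap,
      Subtype.range_coe, restrict_compl_singleton]
  refine ⟨hg, ?_⟩
  rw [← h1.map_eq, Measure.map_map hg h1.measurable]
  exact (h3.comp h2).map_eq

/-- The density `r^(n-1)` is positive on the half line, so the radial measure and Lebesgue measure
have the same null sets there. -/
lemma ae_polar [Nontrivial V] {p : V → Prop} (h : ∀ᵐ x, p x) :
    ∀ᵐ ω : Metric.sphere (0 : V) 1 ∂(volume : Measure V).toSphere, ∀ᵐ r ∂(volume.restrict (Set.Ioi (0 : ℝ))),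
      p (r • (ω : V)) := by
  have h1 := measurePreserving_polar.quasiMeasurePreserving.ae h
  filter_upwards [Measure.ae_ae_of_ae_prod h1] with ω hω
  rw [radialMeasure, ae_withDensity_iff (by fun_prop)] at hω
  filter_upwards [hω, ae_restrict_mem measurableSet_Ioi] with r hr h0
  exact hr (by have : (0 : ℝ) < r := h0; simp; positivity)

lemma lintegral_radialMeasure (n : ℕ) {f : ℝ → ℝ≥0∞} (hf : Measurable f) :
    ∫⁻ r, f r ∂(radialMeasure n) = ∫⁻ r in Set.Ioi 0, ENNReal.ofReal (r ^ n) * f r := by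
  rw [radialMeasure, lintegral_withDensity_eq_lintegral_mul _ (by fun_prop) hf]
  rfl

lemma lintegral_polar [Nontrivial V] {f : V → ℝ≥0∞} (hf : AEMeasurable f volume) :
    ∫⁻ x, f x = ∫⁻ ω, (∫⁻ r in Set.Ioi (0 : ℝ),
      ENNReal.ofReal (r ^ (Module.finrank ℝ V - 1)) * f (r • (ω : V)))
        ∂(volume : Measure V).toSphere := by
  have e1 : ∫⁻ ω, (∫⁻ r in Set.Ioi (0 : ℝ),
      ENNReal.ofReal (r ^ (Module.finrank ℝ V - 1)) * f (r • (ω : V)))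
        ∂(volume : Measure V).toSphere = ∫⁻ ω, (∫⁻ r in Set.Ioi (0 : ℝ),
      ENNReal.ofReal (r ^ (Module.finrank ℝ V - 1)) * hf.mk f (r • (ω : V)))
        ∂(volume : Measure V).toSphere := by
    refine lintegral_congr_ae ?_
    filter_upwards [ae_polar hf.ae_eq_mk] with ω hω
    refine lintegral_congr_ae ?_
    filter_upwards [hω] with r hr
    rw [hr]
  have hm : Measurable fun p : Metric.sphere (0 : V) 1 × ℝ => hf.mk f (p.2 • (p.1 : V)) :=
    hf.measurable_mk.comp (by fun_prop)
  rw [e1, lintegral_congr_ae hf.ae_eq_mk, ← measurePreserving_polar.lintegral_comp hf.measurable_mk,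
    lintegral_prod _ hm.aemeasurable]
  refine lintegral_congr fun ω => ?_
  exact lintegral_radialMeasure _ (hm.comp measurable_prodMk_left)

lemma integral_polar [Nontrivial V] {f : V → ℂ} (hf : Integrable f volume) :
    Integrable (fun ω : Metric.sphere (0 : V) 1 => ∫ r in Set.Ioi (0 : ℝ),
      ((r ^ (Module.finrank ℝ V - 1) : ℝ) : ℂ) * f (r • (ω : V))) (volume : Measure V).toSphere ∧
    ∫ x, f x = ∫ ω, (∫ r in Set.Ioi (0 : ℝ),
      ((r ^ (Module.finrank ℝ V - 1) : ℝ) : ℂ) * f (r • (ω : V)))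
        ∂(volume : Measure V).toSphere := by
  have h1 := measurePreserving_polar.integrable_comp_of_integrable hf
  have e : ∀ ω : Metric.sphere (0 : V) 1,
      ∫ r, f (r • (ω : V)) ∂radialMeasure (Module.finrank ℝ V - 1) = ∫ r in Set.Ioi (0 : ℝ),
        ((r ^ (Module.finrank ℝ V - 1) : ℝ) : ℂ) * f (r • (ω : V)) := by
    intro ω
    have : (fun r : ℝ => ENNReal.ofReal (r ^ (Module.finrank ℝ V - 1)))
      = fun r => ((Real.toNNReal (r ^ (Module.finrank ℝ V - 1)) : NNReal) : ℝ≥0∞) := rfl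
    rw [radialMeasure, this, integral_withDensity_eq_integral_smul (by fun_prop)]
    refine setIntegral_congr_fun measurableSet_Ioi fun r hr => ?_
    have hr : 0 < r := hr
    simp only [NNReal.smul_def, Complex.real_smul]
    rw [Real.coe_toNNReal _ (by positivity)]
  refine ⟨?_, ?_⟩
  · refine h1.integral_prod_left.congr (.of_forall fun ω => ?_)
    exact e ω
  · have h2 := integral_map (μ := (volume : Measure V).toSphere.prod
      (radialMeasure (Module.finrank ℝ V - 1)))
      measurePreserving_polar.measurable.aemeasurable (f := f)
      (by rw [measurePreserving_polar.map_eq]; exact hf.1)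
    rw [measurePreserving_polar.map_eq] at h2
    rw [h2]
    refine (integral_prod _ h1).trans ?_
    exact integral_congr_ae (.of_forall fun ω => e ω)

lemma integrable_polar [Nontrivial V] {f : V → ℂ} (hf : Integrable f volume) :
    ∀ᵐ ω : Metric.sphere (0 : V) 1 ∂(volume : Measure V).toSphere, IntegrableOn (fun r : ℝ =>
      ((r ^ (Module.finrank ℝ V - 1) : ℝ) : ℂ) * f (r • (ω : V))) (Set.Ioi 0) := by
  have h1 := measurePreserving_polar.integrable_comp_of_integrable hf
  filter_upwards [h1.prod_right_ae] with ω hω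
  have : (fun r : ℝ => ENNReal.ofReal (r ^ (Module.finrank ℝ V - 1)))
    = fun r => ((Real.toNNReal (r ^ (Module.finrank ℝ V - 1)) : NNReal) : ℝ≥0∞) := rfl
  rw [radialMeasure, this, integrable_withDensity_iff_integrable_smul (by fun_prop)] at hω
  refine IntegrableOn.congr_fun hω (fun r hr => ?_) measurableSet_Ioi
  have hr : 0 < r := hr
  simp only [Function.comp, NNReal.smul_def, Complex.real_smul]
  rw [Real.coe_toNNReal _ (by positivity)]

end Polar

/-! ### Weighted restrictions to rays and a Hardy-type inequality -/

section RadialPull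

variable {d : ℕ}

/-- The function `r ↦ r^((d-1)/2) φ(rθ)` on the half line `r > 0`, extended by zero. -/
def radialPull (φ : EuclideanSpace ℝ (Fin d) → ℂ) (θ : EuclideanSpace ℝ (Fin d)) (r : ℝ) : ℂ :=
  if 0 < r then ((r ^ (((d : ℝ) - 1) / 2) : ℝ) : ℂ) * φ (r • θ) else 0

/-- The derivative of `radialPull φ θ` on the half line `r > 0`, extended by zero. -/
def radialPullDeriv (φ : 𝓢(EuclideanSpace ℝ (Fin d), ℂ)) (θ : EuclideanSpace ℝ (Fin d))
    (r : ℝ) : ℂ :=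
  if 0 < r then ((r ^ (((d : ℝ) - 1) / 2) : ℝ) : ℂ) * (∂_{θ} φ) (r • θ) +
    ((((d : ℝ) - 1) / 2 * r ^ (((d : ℝ) - 1) / 2 - 1) : ℝ) : ℂ) * φ (r • θ) else 0

/-- Uniformity in the direction is the point. The exponent `-2` makes restrictions to rays both
integrable and square integrable. -/
lemma exists_rpow_mul_norm_schwartz_le (ψ : 𝓢(EuclideanSpace ℝ (Fin d), ℂ)) {p : ℝ}
    (hp : 0 ≤ p) : ∃ C : ℝ, 0 ≤ C ∧ ∀ θ : EuclideanSpace ℝ (Fin d), ‖θ‖ = 1 → ∀ r : ℝ, 0 < r →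
      r ^ p * ‖ψ (r • θ)‖ ≤ C * (1 + r) ^ (-2 : ℝ) := by
  obtain ⟨N, hN⟩ := exists_nat_gt (p + 2)
  refine ⟨2 ^ N * (Finset.Iic (N, 0)).sup (schwartzSeminormFamily ℂ _ ℂ) ψ, by positivity,
    fun θ hθ r hr => ?_⟩
  have h := one_add_pow_mul_schwartz_le ψ N (r • θ)
  rw [norm_smul, hθ, mul_one, Real.norm_of_nonneg hr.le] at h
  have h1 : r ^ p * ((1 + r) ^ N)⁻¹ ≤ (1 + r) ^ (-2 : ℝ) := by
    calc _ ≤ (1 + r) ^ p * ((1 + r) ^ N)⁻¹ := by gcongr; linarith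
      _ = (1 + r) ^ (p - N) := by rw [Real.rpow_sub (by positivity), Real.rpow_natCast]; rfl
      _ ≤ _ := Real.rpow_le_rpow_of_exponent_le (by linarith) (by linarith)
  set S := 2 ^ N * (Finset.Iic (N, 0)).sup (schwartzSeminormFamily ℂ _ ℂ) ψ with hS
  have hS0 : 0 ≤ S := by positivity
  calc r ^ p * ‖ψ (r • θ)‖ ≤ r ^ p * (((1 + r) ^ N)⁻¹ * S) := by gcongr
    _ = (r ^ p * ((1 + r) ^ N)⁻¹) * S := by ring
    _ ≤ (1 + r) ^ (-2 : ℝ) * S := by gcongr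
    _ = S * (1 + r) ^ (-2 : ℝ) := by ring

lemma integrable_one_add_abs_rpow : Integrable (fun r : ℝ => (1 + |r|) ^ (-2 : ℝ)) volume := by
  have := integrable_one_add_norm (E := ℝ) (μ := volume) (r := 2) (by simp)
  simpa using this

lemma integrable_and_memLp_of_decay {f : ℝ → ℂ} (hf : Measurable f) {C : ℝ}
    (h0 : ∀ r ≤ 0, f r = 0) (h : ∀ r, 0 < r → ‖f r‖ ≤ C * (1 + r) ^ (-2 : ℝ)) :
    Integrable f volume ∧ MemLp f 2 volume := by
  have hC : 0 ≤ C := by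
    have := (norm_nonneg _).trans (h 1 one_pos)
    exact nonneg_of_mul_nonneg_left this (by positivity)
  have hb : ∀ r, ‖f r‖ ≤ C * (1 + |r|) ^ (-2 : ℝ) := by
    intro r
    rcases le_or_gt r 0 with hr | hr
    · rw [h0 r hr, norm_zero]; positivity
    · rw [abs_of_pos hr]; exact h r hr
  have hi := integrable_one_add_abs_rpow
  refine ⟨(hi.const_mul C).mono' hf.aestronglyMeasurable (.of_forall hb), ?_⟩
  rw [memLp_two_iff_integrable_sq_norm hf.aestronglyMeasurable]
  refine (hi.const_mul (C ^ 2)).mono' (hf.norm.pow_const 2).aestronglyMeasurable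
    (.of_forall fun r => ?_)
  rw [Real.norm_of_nonneg (by positivity)]
  have h1 : (1 + |r|) ^ (-2 : ℝ) ≤ 1 :=
    Real.rpow_le_one_of_one_le_of_nonpos (by linarith [abs_nonneg r]) (by norm_num)
  have h2 : 0 ≤ (1 + |r|) ^ (-2 : ℝ) := by positivity
  calc ‖f r‖ ^ 2 ≤ (C * (1 + |r|) ^ (-2 : ℝ)) ^ 2 := by gcongr; exact hb r
    _ = C ^ 2 * ((1 + |r|) ^ (-2 : ℝ) * (1 + |r|) ^ (-2 : ℝ)) := by ring
    _ ≤ C ^ 2 * ((1 + |r|) ^ (-2 : ℝ) * 1) := by gcongr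
    _ = _ := by ring

lemma measurable_radialPull_uncurry {φ : EuclideanSpace ℝ (Fin d) → ℂ} (hφ : Measurable φ) :
    Measurable fun p : EuclideanSpace ℝ (Fin d) × ℝ => radialPull φ p.1 p.2 := by
  unfold radialPull
  refine Measurable.ite (measurableSet_lt measurable_const measurable_snd) ?_ measurable_const
  exact (by fun_prop : Measurable fun p : EuclideanSpace ℝ (Fin d) × ℝ =>
    ((p.2 ^ (((d : ℝ) - 1) / 2) : ℝ) : ℂ)).mul (hφ.comp (by fun_prop))

lemma measurable_radialPull {φ : EuclideanSpace ℝ (Fin d) → ℂ} (hφ : Measurable φ)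
    (θ : EuclideanSpace ℝ (Fin d)) : Measurable (radialPull φ θ) :=
  (measurable_radialPull_uncurry hφ).comp measurable_prodMk_left

lemma measurable_radialPullDeriv (φ : 𝓢(EuclideanSpace ℝ (Fin d), ℂ))
    (θ : EuclideanSpace ℝ (Fin d)) : Measurable (radialPullDeriv φ θ) := by
  unfold radialPullDeriv
  refine Measurable.ite (measurableSet_lt measurable_const measurable_id) ?_ measurable_const
  have h1 := φ.continuous.measurable
  have h2 := (∂_{θ} φ : 𝓢(EuclideanSpace ℝ (Fin d), ℂ)).continuous.measurable
  fun_prop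

lemma exists_radialPull_le (hd : 1 ≤ d) (φ : 𝓢(EuclideanSpace ℝ (Fin d), ℂ)) :
    ∃ C : ℝ, 0 ≤ C ∧ ∀ θ : EuclideanSpace ℝ (Fin d), ‖θ‖ = 1 → ∀ r : ℝ, 0 < r →
      ‖radialPull φ θ r‖ ≤ C * (1 + r) ^ (-2 : ℝ) := by
  have hd' : (1 : ℝ) ≤ d := by exact_mod_cast hd
  obtain ⟨C, hC, h⟩ := exists_rpow_mul_norm_schwartz_le φ (p := ((d : ℝ) - 1) / 2) (by linarith)
  refine ⟨C, hC, fun θ hθ r hr => ?_⟩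
  rw [radialPull, if_pos hr, norm_mul, Complex.norm_real, Real.norm_of_nonneg (by positivity)]
  exact h θ hθ r hr

lemma radialPull_of_nonpos (φ : EuclideanSpace ℝ (Fin d) → ℂ) (θ : EuclideanSpace ℝ (Fin d))
    {r : ℝ} (hr : r ≤ 0) : radialPull φ θ r = 0 := if_neg (not_lt.2 hr)

lemma integrable_and_memLp_radialPull (hd : 1 ≤ d) (φ : 𝓢(EuclideanSpace ℝ (Fin d), ℂ))
    {θ : EuclideanSpace ℝ (Fin d)} (hθ : ‖θ‖ = 1) :
    Integrable (radialPull φ θ) volume ∧ MemLp (radialPull φ θ) 2 volume := by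
  obtain ⟨C, hC, h⟩ := exists_radialPull_le hd φ
  exact integrable_and_memLp_of_decay (measurable_radialPull φ.continuous.measurable θ)
    (fun r hr => radialPull_of_nonpos _ _ hr) (h θ hθ)

lemma integrable_and_memLp_radialPullDeriv (hd : 3 ≤ d) (φ : 𝓢(EuclideanSpace ℝ (Fin d), ℂ))
    {θ : EuclideanSpace ℝ (Fin d)} (hθ : ‖θ‖ = 1) :
    Integrable (radialPullDeriv φ θ) volume ∧ MemLp (radialPullDeriv φ θ) 2 volume := by
  have hd' : (3 : ℝ) ≤ d := by exact_mod_cast hd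
  obtain ⟨C, hC, h⟩ := exists_rpow_mul_norm_schwartz_le (∂_{θ} φ) (p := ((d : ℝ) - 1) / 2)
    (by linarith)
  obtain ⟨C', hC', h'⟩ := exists_rpow_mul_norm_schwartz_le φ (p := ((d : ℝ) - 1) / 2 - 1)
    (by linarith)
  refine integrable_and_memLp_of_decay (C := C + ((d : ℝ) - 1) / 2 * C')
    (measurable_radialPullDeriv φ θ)
    (fun r hr => if_neg (not_lt.2 hr)) fun r hr => ?_
  have hm : (0 : ℝ) ≤ ((d : ℝ) - 1) / 2 := by linarith
  rw [radialPullDeriv, if_pos hr]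
  refine (norm_add_le _ _).trans ?_
  rw [norm_mul, norm_mul, Complex.norm_real, Complex.norm_real, Real.norm_of_nonneg (by positivity),
    Real.norm_of_nonneg (by positivity), add_mul, mul_assoc, mul_assoc]
  exact add_le_add (h θ hθ r hr) (mul_le_mul_of_nonneg_left (h' θ hθ r hr) hm)

lemma hasDerivAt_schwartz_ray (φ : 𝓢(EuclideanSpace ℝ (Fin d), ℂ))
    (θ : EuclideanSpace ℝ (Fin d)) (r : ℝ) :
    HasDerivAt (fun r : ℝ => φ (r • θ)) ((∂_{θ} φ) (r • θ)) r := by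
  have h1 : HasDerivAt (fun r : ℝ => r • θ) θ r := by
    simpa using (hasDerivAt_id r).smul_const θ
  have h2 := (φ.differentiableAt (x := r • θ)).hasFDerivAt.comp_hasDerivAt r h1
  rwa [SchwartzMap.lineDerivOp_apply_eq_fderiv]

lemma hasDerivAt_radialPull (φ : 𝓢(EuclideanSpace ℝ (Fin d), ℂ))
    (θ : EuclideanSpace ℝ (Fin d)) {r : ℝ} (hr : 0 < r) :
    HasDerivAt (radialPull φ θ) (radialPullDeriv φ θ r) r := by
  have h1 : HasDerivAt (fun r : ℝ => ((r ^ (((d : ℝ) - 1) / 2) : ℝ) : ℂ))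
      ((((d : ℝ) - 1) / 2 * r ^ (((d : ℝ) - 1) / 2 - 1) : ℝ) : ℂ) r :=
    (Real.hasDerivAt_rpow_const (Or.inl hr.ne')).ofReal_comp
  have h2 := h1.mul (hasDerivAt_schwartz_ray φ θ r)
  rw [radialPullDeriv, if_pos hr, add_comm]
  refine h2.congr_of_eventuallyEq ?_
  filter_upwards [lt_mem_nhds hr] with x hx
  rw [radialPull, if_pos hx]; rfl

lemma tendsto_radialPull_atTop (hd : 1 ≤ d) (φ : 𝓢(EuclideanSpace ℝ (Fin d), ℂ))
    {θ : EuclideanSpace ℝ (Fin d)} (hθ : ‖θ‖ = 1) :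
    Tendsto (radialPull φ θ) atTop (𝓝 0) := by
  obtain ⟨C, hC, h⟩ := exists_radialPull_le hd φ
  have h1 : Tendsto (fun r : ℝ => C * (1 + r) ^ (-2 : ℝ)) atTop (𝓝 0) := by
    have := (tendsto_rpow_neg_atTop (y := 2) two_pos).comp
      (tendsto_atTop_add_const_left atTop (1 : ℝ) tendsto_id)
    simpa using this.const_mul C
  refine squeeze_zero_norm' ?_ h1
  filter_upwards [eventually_gt_atTop 0] with r hr using h θ hθ r hr

lemma tendsto_radialPull_zero (hd : 2 ≤ d) (φ : 𝓢(EuclideanSpace ℝ (Fin d), ℂ))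
    (θ : EuclideanSpace ℝ (Fin d)) :
    Tendsto (radialPull φ θ) (𝓝[>] 0) (𝓝 0) := by
  have hd' : (2 : ℝ) ≤ d := by exact_mod_cast hd
  have hm : (0 : ℝ) < ((d : ℝ) - 1) / 2 := by linarith
  have h1 : Continuous fun r : ℝ => ((r ^ (((d : ℝ) - 1) / 2) : ℝ) : ℂ) * φ (r • θ) := by
    have := φ.continuous
    have h3 := Real.continuous_rpow_const hm.le
    fun_prop
  have h2 := (h1.tendsto 0).mono_left (nhdsWithin_le_nhds (s := Set.Ioi (0 : ℝ)))
  rw [Real.zero_rpow hm.ne', Complex.ofReal_zero, zero_mul] at h2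
  refine h2.congr' ?_
  filter_upwards [self_mem_nhdsWithin] with r hr
  exact (if_pos hr).symm

/-- Integration by parts on the half line. There is no boundary term at `0` because `(d-1)/2 > 0`;
with `d ≥ 3` the derivative, of size `r^((d-1)/2 - 1)`, stays bounded there. -/
lemma fourierInv_radialPullDeriv (hd : 3 ≤ d) (φ : 𝓢(EuclideanSpace ℝ (Fin d), ℂ))
    {θ : EuclideanSpace ℝ (Fin d)} (hθ : ‖θ‖ = 1) (κ : ℝ) :
    𝓕⁻ (radialPullDeriv φ θ) κ =
      -(2 * Real.pi * Complex.I * κ * 𝓕⁻ (radialPull φ θ) κ) := by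
  have i1 := (integrable_and_memLp_radialPull (by omega) φ hθ).1
  have i2 := (integrable_and_memLp_radialPullDeriv hd φ hθ).1
  let e : ℝ → ℂ := fun r => Complex.exp (2 * Real.pi * Complex.I * κ * r)
  have he : ∀ r, HasDerivAt e (2 * Real.pi * Complex.I * κ * e r) r := fun r => by
    have h1 : HasDerivAt (fun r : ℝ => 2 * Real.pi * Complex.I * κ * (r : ℂ))
        (2 * Real.pi * Complex.I * κ) r := by
      simpa using (Complex.ofRealCLM.hasDerivAt (x := r)).const_mul (2 * Real.pi * Complex.I * κ)
    rw [mul_comm _ (e r)]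
    exact h1.cexp
  have hen : ∀ r, ‖e r‖ = 1 := fun r => by
    have : e r = Complex.exp (((2 * Real.pi * κ * r : ℝ) : ℂ) * Complex.I) := by
      simp only [e]; congr 1; push_cast; ring
    rw [this, Complex.norm_exp_ofReal_mul_I]
  have hec : Continuous e := continuous_iff_continuousAt.2 fun r => (he r).continuousAt
  have hmul : ∀ f : ℝ → ℂ, Integrable f volume → Integrable (fun r => e r * f r) volume :=
    fun f hf => hf.bdd_mul hec.aestronglyMeasurable (c := 1) (.of_forall fun r => (hen r).le)
  have hF : ∀ f : ℝ → ℂ, (∀ r ≤ 0, f r = 0) → 𝓕⁻ f κ = ∫ r in Set.Ioi 0, e r * f r := by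
    intro f hf
    rw [setIntegral_eq_integral_of_forall_compl_eq_zero fun r hr => by
      rw [hf r (not_lt.1 hr), mul_zero], Real.fourierInv_eq']
    congr 1; ext r
    simp only [e, smul_eq_mul, RCLike.inner_apply, conj_trivial]
    congr 2; push_cast; ring
  rw [hF (radialPullDeriv φ θ) fun r hr => if_neg (not_lt.2 hr),
    hF (radialPull φ θ) fun r hr => radialPull_of_nonpos _ _ hr]
  have hz : ContinuousWithinAt (fun r => e r * radialPull φ θ r) (Set.Ici 0) 0 := by
    rw [← continuousWithinAt_Ioi_iff_Ici, ContinuousWithinAt, radialPull_of_nonpos _ _ le_rfl]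
    exact ((hec.tendsto 0).mono_left (nhdsWithin_le_nhds (s := Set.Ioi (0 : ℝ)))).mul
      (tendsto_radialPull_zero (by omega) φ θ)
  have hinf : Tendsto (fun r => e r * radialPull φ θ r) atTop (𝓝 0) := by
    refine squeeze_zero_norm' (.of_forall fun r => ?_)
      (tendsto_zero_iff_norm_tendsto_zero.1 (tendsto_radialPull_atTop (by omega) φ hθ))
    rw [norm_mul, hen, one_mul]
  have key := integral_Ioi_of_hasDerivAt_of_tendsto hz
    (fun r hr => (he r).mul (hasDerivAt_radialPull φ θ hr))
    (Integrable.integrableOn (by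
      refine (((hmul _ i1).const_mul (2 * Real.pi * Complex.I * κ)).add (hmul _ i2)).congr
        (.of_forall fun r => ?_)
      simp only [Pi.add_apply]; ring)) hinf
  rw [radialPull_of_nonpos _ _ le_rfl, mul_zero, sub_zero] at key
  have e2 : ∀ r, 2 * Real.pi * Complex.I * κ * e r * radialPull φ θ r + e r * radialPullDeriv φ θ r
      = 2 * Real.pi * Complex.I * κ * (e r * radialPull φ θ r) + e r * radialPullDeriv φ θ r :=
    fun r => by ring
  simp_rw [e2] at key
  rw [integral_add ((hmul _ i1).const_mul _).integrableOn (hmul _ i2).integrableOn,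
    integral_const_mul] at key
  linear_combination key

lemma norm_sq_radialPull (φ : EuclideanSpace ℝ (Fin d) → ℂ) (hd : 1 ≤ d)
    (θ : EuclideanSpace ℝ (Fin d)) {r : ℝ} (hr : 0 < r) :
    ‖radialPull φ θ r‖ ^ 2 = r ^ (d - 1) * ‖φ (r • θ)‖ ^ 2 := by
  rw [radialPull, if_pos hr, norm_mul, Complex.norm_real, Real.norm_of_nonneg (by positivity),
    mul_pow, ← Real.rpow_natCast, ← Real.rpow_mul hr.le, ← Real.rpow_natCast r, Nat.cast_sub hd]
  congr 2; push_cast; ring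

/-- The derivative of the flux `m r^(n+1) |φ(rθ)|²` has zero integral over the half line. -/
lemma integral_deriv_flux_eq_zero (φ : 𝓢(EuclideanSpace ℝ (Fin d), ℂ))
    {θ : EuclideanSpace ℝ (Fin d)} (hθ : ‖θ‖ = 1) (n : ℕ) {m : ℝ} (hm : 0 ≤ m) :
    IntegrableOn (fun r : ℝ => m * ((n + 1) * r ^ n) * ‖φ (r • θ)‖ ^ 2 +
      m * r ^ (n + 1) * (2 * inner ℝ (φ (r • θ)) ((∂_{θ} φ) (r • θ)))) (Set.Ioi 0) ∧
    ∫ r in Set.Ioi (0 : ℝ), (m * ((n + 1) * r ^ n) * ‖φ (r • θ)‖ ^ 2 +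
      m * r ^ (n + 1) * (2 * inner ℝ (φ (r • θ)) ((∂_{θ} φ) (r • θ)))) = 0 := by
  set b : ℝ → ℂ := fun r => φ (r • θ) with hb
  set a : ℝ → ℂ := fun r => (∂_{θ} φ) (r • θ) with ha
  have hnb : ∀ r, HasDerivAt (fun r => ‖b r‖ ^ 2) (2 * inner ℝ (b r) (a r)) r := fun r =>
    (hasDerivAt_schwartz_ray φ θ r).norm_sq
  let G : ℝ → ℝ := fun r => m * r ^ (n + 1) * ‖b r‖ ^ 2
  let G' : ℝ → ℝ := fun r => m * ((n + 1) * r ^ n) * ‖b r‖ ^ 2 +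
    m * r ^ (n + 1) * (2 * inner ℝ (b r) (a r))
  have hG : ∀ r, HasDerivAt G (G' r) r := fun r => by
    have h1 : HasDerivAt (fun r : ℝ => m * r ^ (n + 1)) (m * ((n + 1) * r ^ n)) r := by
      simpa using (hasDerivAt_pow (n + 1) r).const_mul m
    exact h1.mul (hnb r)
  obtain ⟨C₀, hC₀, h₀⟩ := exists_rpow_mul_norm_schwartz_le φ (p := 0) le_rfl
  obtain ⟨C₁, hC₁, h₁⟩ := exists_rpow_mul_norm_schwartz_le φ (p := n) (Nat.cast_nonneg n)
  obtain ⟨C₂, hC₂, h₂⟩ := exists_rpow_mul_norm_schwartz_le φ (p := (n + 1 : ℕ)) (Nat.cast_nonneg _)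
  obtain ⟨C₃, hC₃, h₃⟩ := exists_rpow_mul_norm_schwartz_le (∂_{θ} φ) (p := 0) le_rfl
  have hle1 : ∀ r : ℝ, 0 < r → (1 + r) ^ (-2 : ℝ) ≤ 1 := fun r hr =>
    Real.rpow_le_one_of_one_le_of_nonpos (by linarith) (by norm_num)
  have hb0 : ∀ r, 0 < r → ‖b r‖ ≤ C₀ := fun r hr => by
    have := h₀ θ hθ r hr
    rw [Real.rpow_zero, one_mul] at this
    exact this.trans (mul_le_of_le_one_right hC₀ (hle1 r hr))
  have ha0 : ∀ r, 0 < r → ‖a r‖ ≤ C₃ := fun r hr => by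
    have := h₃ θ hθ r hr
    rw [Real.rpow_zero, one_mul] at this
    exact this.trans (mul_le_of_le_one_right hC₃ (hle1 r hr))
  have hbn : ∀ r, 0 < r → r ^ n * ‖b r‖ ≤ C₁ * (1 + r) ^ (-2 : ℝ) := fun r hr => by
    have := h₁ θ hθ r hr
    rwa [Real.rpow_natCast] at this
  have hbn1 : ∀ r, 0 < r → r ^ (n + 1) * ‖b r‖ ≤ C₂ * (1 + r) ^ (-2 : ℝ) := fun r hr => by
    have := h₂ θ hθ r hr
    rwa [Real.rpow_natCast] at this
  have hacont : Continuous a := (SchwartzMap.continuous _).comp (by fun_prop)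
  have hbcont : Continuous b := φ.continuous.comp (by fun_prop)
  have hG'cont : Continuous G' := by simp only [G']; fun_prop
  have hG'int : IntegrableOn G' (Set.Ioi 0) := by
    refine Integrable.mono' (g := fun r => (m * (n + 1) * C₀ * C₁ + m * 2 * C₃ * C₂) *
      (1 + |r|) ^ (-2 : ℝ)) (integrable_one_add_abs_rpow.const_mul _).integrableOn
      hG'cont.aestronglyMeasurable ?_
    filter_upwards [ae_restrict_mem measurableSet_Ioi] with r hr
    have hr : 0 < r := hr
    rw [abs_of_pos hr]
    have e1 : ‖m * ((n + 1) * r ^ n) * ‖b r‖ ^ 2‖ ≤ m * (n + 1) * C₀ * (C₁ * (1 + r) ^ (-2 : ℝ)) := by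
      rw [Real.norm_of_nonneg (by positivity)]
      calc _ = m * (n + 1) * ‖b r‖ * (r ^ n * ‖b r‖) := by ring
        _ ≤ m * (n + 1) * C₀ * (C₁ * (1 + r) ^ (-2 : ℝ)) :=
          mul_le_mul (mul_le_mul_of_nonneg_left (hb0 r hr) (by positivity)) (hbn r hr)
            (by positivity) (by positivity)
    have e2 : ‖m * r ^ (n + 1) * (2 * inner ℝ (b r) (a r))‖ ≤
        m * 2 * C₃ * (C₂ * (1 + r) ^ (-2 : ℝ)) := by
      rw [norm_mul, norm_mul 2, Real.norm_of_nonneg (by positivity), Real.norm_two]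
      calc _ ≤ m * r ^ (n + 1) * (2 * (‖b r‖ * ‖a r‖)) := by
            gcongr; exact norm_inner_le_norm _ _
        _ = m * 2 * ‖a r‖ * (r ^ (n + 1) * ‖b r‖) := by ring
        _ ≤ m * 2 * C₃ * (C₂ * (1 + r) ^ (-2 : ℝ)) :=
          mul_le_mul (mul_le_mul_of_nonneg_left (ha0 r hr) (by positivity)) (hbn1 r hr)
            (by positivity) (by positivity)
    refine (norm_add_le _ _).trans ((add_le_add e1 e2).trans (le_of_eq ?_))
    ring
  have hGinf : Tendsto G atTop (𝓝 0) := by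
    have h1 : Tendsto (fun r : ℝ => m * C₀ * (C₂ * (1 + r) ^ (-2 : ℝ))) atTop (𝓝 0) := by
      have := (tendsto_rpow_neg_atTop (y := 2) two_pos).comp
        (tendsto_atTop_add_const_left atTop (1 : ℝ) tendsto_id)
      simpa using (this.const_mul C₂).const_mul (m * C₀)
    refine squeeze_zero_norm' ?_ h1
    filter_upwards [eventually_gt_atTop 0] with r hr
    rw [Real.norm_of_nonneg (by positivity)]
    calc G r = m * ‖b r‖ * (r ^ (n + 1) * ‖b r‖) := by simp only [G]; ring
      _ ≤ m * C₀ * (C₂ * (1 + r) ^ (-2 : ℝ)) :=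
          mul_le_mul (mul_le_mul_of_nonneg_left (hb0 r hr) (by positivity)) (hbn1 r hr)
            (by positivity) (by positivity)
  refine ⟨hG'int, ?_⟩
  have := integral_Ioi_of_hasDerivAt_of_tendsto' (fun r _ => hG r) hG'int hGinf
  rw [this]
  simp [G]

/-- Here `a` and `b` stand for `∂ᵣφ` and `φ` at a point of a ray, and the bracket is the derivative
of the flux `m r^(2m-1) |φ|²`. Expanding the square, the right side exceeds the left by `m(m-1)
r^(2m-2) |b|²`. -/
lemma norm_sq_mul_add_mul_le (a b : ℂ) {m r : ℝ} {n : ℕ} (hmn : m = (n : ℝ) / 2 + 1)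
    (hr : 0 < r) :
    ‖((r ^ m : ℝ) : ℂ) * a + ((m * r ^ (m - 1) : ℝ) : ℂ) * b‖ ^ 2 ≤
      r ^ (n + 2) * ‖a‖ ^ 2 + (m * ((n + 1) * r ^ n) * ‖b‖ ^ 2 +
      m * r ^ (n + 1) * (2 * inner ℝ b a)) := by
  have hp1 : r ^ m = r ^ (m - 1) * r := by
    rw [Real.rpow_sub hr, Real.rpow_one]; field_simp
  have hp2 : (r ^ (m - 1)) ^ 2 = r ^ n := by
    rw [← Real.rpow_natCast, ← Real.rpow_mul hr.le, ← Real.rpow_natCast r n]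
    congr 1; rw [hmn]; push_cast; ring
  have e1 : ((r ^ m : ℝ) : ℂ) * a + ((m * r ^ (m - 1) : ℝ) : ℂ) * b
    = ((r ^ (m - 1) : ℝ) : ℂ) * ((r : ℂ) * a + (m : ℂ) * b) := by
    rw [hp1]; push_cast; ring
  have e2 : ‖(r : ℂ) * a + (m : ℂ) * b‖ ^ 2 =
      r ^ 2 * ‖a‖ ^ 2 + 2 * r * m * inner ℝ b a + m ^ 2 * ‖b‖ ^ 2 := by
    have := norm_add_sq_real (r • a) (m • b)
    rw [inner_smul_left, inner_smul_right, real_inner_comm, norm_smul, norm_smul, mul_pow,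
      mul_pow, Real.norm_eq_abs, Real.norm_eq_abs, sq_abs, sq_abs] at this
    simp only [Complex.real_smul, conj_trivial] at this
    rw [this]; ring
  rw [e1, norm_mul, mul_pow, Complex.norm_real, Real.norm_of_nonneg (by positivity), hp2, e2]
  have e3 : r ^ (n + 2) * ‖a‖ ^ 2 + (m * ((n + 1) * r ^ n) * ‖b‖ ^ 2 +
      m * r ^ (n + 1) * (2 * inner ℝ b a)) - r ^ n * (r ^ 2 * ‖a‖ ^ 2 +
      2 * r * m * inner ℝ b a + m ^ 2 * ‖b‖ ^ 2) =
      r ^ n * (m * (m - 1)) * ‖b‖ ^ 2 := by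
    have hn : (n : ℝ) = 2 * m - 2 := by rw [hmn]; ring
    rw [pow_add, pow_succ, hn]; ring
  -- Positivity needs `m ≥ 1`, that is, dimension at least three.
  have e4 : 0 ≤ r ^ n * (m * (m - 1)) * ‖b‖ ^ 2 := by
    have h1 : 0 ≤ m - 1 := by rw [hmn]; simp; positivity
    have h2 : 0 ≤ m := by linarith
    positivity
  linarith

/-- The pointwise inequality is integrated; the flux term contributes nothing. -/
lemma integral_norm_sq_radialPullDeriv_le (hd : 3 ≤ d) (φ : 𝓢(EuclideanSpace ℝ (Fin d), ℂ))
    {θ : EuclideanSpace ℝ (Fin d)} (hθ : ‖θ‖ = 1) :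
    ∫ r, ‖radialPullDeriv φ θ r‖ ^ 2 ≤
      ∫ r, ‖radialPull (∂_{θ} φ : 𝓢(EuclideanSpace ℝ (Fin d), ℂ)) θ r‖ ^ 2 := by
  obtain ⟨n, hn⟩ : ∃ n, d = n + 3 := ⟨d - 3, by omega⟩
  have hmn : ((d : ℝ) - 1) / 2 = (n : ℝ) / 2 + 1 := by rw [hn]; push_cast; ring
  obtain ⟨hGi, hG0⟩ := integral_deriv_flux_eq_zero φ hθ n (m := ((d : ℝ) - 1) / 2)
    (by rw [hmn]; positivity)
  have m1 := (integrable_and_memLp_radialPullDeriv hd φ hθ).2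
  have m2 := (integrable_and_memLp_radialPull (by omega) (∂_{θ} φ) hθ).2
  have i1 := (memLp_two_iff_integrable_sq_norm m1.1).1 m1
  have i2 := (memLp_two_iff_integrable_sq_norm m2.1).1 m2
  have z1 : ∀ r, r ∉ Set.Ioi (0 : ℝ) → ‖radialPullDeriv φ θ r‖ ^ 2 = 0 := fun r hr => by
    have : radialPullDeriv φ θ r = 0 := if_neg hr
    rw [this]; simp
  have z2 : ∀ r, r ∉ Set.Ioi (0 : ℝ) →
      ‖radialPull (∂_{θ} φ : 𝓢(EuclideanSpace ℝ (Fin d), ℂ)) θ r‖ ^ 2 = 0 := fun r hr => by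
    rw [radialPull_of_nonpos _ _ (not_lt.1 hr)]; simp
  rw [← setIntegral_eq_integral_of_forall_compl_eq_zero z1,
    ← setIntegral_eq_integral_of_forall_compl_eq_zero z2]
  refine (setIntegral_mono_on i1.integrableOn (i2.integrableOn.add hGi) measurableSet_Ioi
    fun r hr => ?_).trans (le_of_eq ?_)
  · have hr : 0 < r := hr
    have := norm_sq_mul_add_mul_le ((∂_{θ} φ) (r • θ)) (φ (r • θ)) hmn hr
    rw [Pi.add_apply, norm_sq_radialPull _ (by omega) θ hr, radialPullDeriv, if_pos hr,
      show d - 1 = n + 2 by omega]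
    exact this
  · simp only [Pi.add_apply]
    rw [integral_add i2.integrableOn hGi, hG0, add_zero]

lemma lintegral_enorm_sq_eq_ofReal {f : ℝ → ℂ} (hf : MemLp f 2 volume) :
    ∫⁻ r, ‖f r‖ₑ ^ 2 = ENNReal.ofReal (∫ r, ‖f r‖ ^ 2) := by
  rw [ofReal_integral_eq_lintegral_ofReal ((memLp_two_iff_integrable_sq_norm hf.1).1 hf)
    (.of_forall fun r => by positivity)]
  refine lintegral_congr fun r => ?_
  rw [ENNReal.ofReal_pow (norm_nonneg _), ofReal_norm]

lemma lintegral_enorm_sq_radialPull (hd : 1 ≤ d) (φ : EuclideanSpace ℝ (Fin d) → ℂ)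
    (θ : EuclideanSpace ℝ (Fin d)) :
    ∫⁻ r, ‖radialPull φ θ r‖ₑ ^ 2 =
      ∫⁻ r in Set.Ioi (0 : ℝ), ENNReal.ofReal (r ^ (d - 1)) * ‖φ (r • θ)‖ₑ ^ 2 := by
  rw [← lintegral_indicator measurableSet_Ioi]
  refine lintegral_congr fun r => ?_
  by_cases hr : 0 < r
  · rw [Set.indicator_of_mem (show r ∈ Set.Ioi 0 from hr), ← ofReal_norm, ← ofReal_norm,
      ← ENNReal.ofReal_pow (norm_nonneg _), norm_sq_radialPull φ hd θ hr,
      ENNReal.ofReal_mul (by positivity), ENNReal.ofReal_pow (norm_nonneg _)]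
  · rw [Set.indicator_of_notMem (by simpa using hr), radialPull_of_nonpos _ _ (not_lt.1 hr)]
    simp

lemma lintegral_weight_fourierInv_radialPull_le (hd : 3 ≤ d)
    (φ : 𝓢(EuclideanSpace ℝ (Fin d), ℂ)) {θ : EuclideanSpace ℝ (Fin d)} (hθ : ‖θ‖ = 1) :
    ∫⁻ κ : ℝ, ‖(2 * Real.pi * κ : ℂ) * 𝓕⁻ (radialPull φ θ) κ‖ₑ ^ 2 ≤
      ∫⁻ r in Set.Ioi (0 : ℝ), ENNReal.ofReal (r ^ (d - 1)) * ‖(∂_{θ} φ) (r • θ)‖ₑ ^ 2 := by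
  have m1 := integrable_and_memLp_radialPullDeriv hd φ hθ
  have m2 := integrable_and_memLp_radialPull (by omega) (∂_{θ} φ) hθ
  have e : ∀ κ : ℝ, ‖(2 * Real.pi * κ : ℂ) * 𝓕⁻ (radialPull φ θ) κ‖ₑ
      = ‖𝓕⁻ (radialPullDeriv φ θ) κ‖ₑ := fun κ => by
    rw [fourierInv_radialPullDeriv hd φ hθ, enorm_neg]
    have : (2 * Real.pi * Complex.I * κ * 𝓕⁻ (radialPull φ θ) κ : ℂ) =
      Complex.I * (2 * Real.pi * κ * 𝓕⁻ (radialPull φ θ) κ) := by ring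
    rw [this, ← ofReal_norm, ← ofReal_norm, norm_mul Complex.I, Complex.norm_I, one_mul]
  simp_rw [e]
  rw [lintegral_enorm_sq_fourierInv m1.1 m1.2, ← lintegral_enorm_sq_radialPull (by omega),
    lintegral_enorm_sq_eq_ofReal m1.2, lintegral_enorm_sq_eq_ofReal m2.2]
  exact ENNReal.ofReal_le_ofReal (integral_norm_sq_radialPullDeriv_le hd φ hθ)

end RadialPull

/-! ### The outgoing operator at the orders `0` and `1` -/

section Outgoing

variable {d : ℕ}

lemma wnorm_sq {V : Type*} [NormedAddCommGroup V] [InnerProductSpace ℝ V] [FiniteDimensional ℝ V]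
    [MeasurableSpace V] [BorelSpace V] (s : ℝ) (g : V → ℂ) :
    wnorm s g ^ 2 = ∫⁻ ξ, ‖(wt s ξ : ℂ) * g ξ‖ₑ ^ 2 := by
  rw [wnorm, eLpNorm_eq_lintegral_rpow_enorm_toReal two_ne_zero ENNReal.ofNat_ne_top,
    ← ENNReal.rpow_natCast, ← ENNReal.rpow_mul]
  simp

/-- The Fourier side of the outgoing radiation field of a test function: the value at `ξ = κω`,
`κ = |ξ|`, is `exp (-i(d-1)π/4) κ^(-(d-1)/2) ∫_0^∞ exp (2πiκr) r^((d-1)/2) φ(rω) dr`. -/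
def outgoing (φ : EuclideanSpace ℝ (Fin d) → ℂ) (ξ : EuclideanSpace ℝ (Fin d)) : ℂ :=
  Complex.exp (-(Complex.I * (((d : ℝ) - 1) / 4 * Real.pi : ℝ))) *
    (((‖ξ‖ ^ (((d : ℝ) - 1) / 2))⁻¹ : ℝ) : ℂ) * 𝓕⁻ (radialPull φ (‖ξ‖⁻¹ • ξ)) ‖ξ‖

lemma measurable_fourierInv_radialPull {φ : EuclideanSpace ℝ (Fin d) → ℂ} (hφ : Measurable φ) :
    Measurable fun p : EuclideanSpace ℝ (Fin d) × ℝ => 𝓕⁻ (radialPull φ p.1) p.2 := by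
  have h : StronglyMeasurable (Function.uncurry fun (p : EuclideanSpace ℝ (Fin d) × ℝ) (v : ℝ) =>
      Complex.exp (((2 * Real.pi * (v * p.2) : ℝ) : ℂ) * Complex.I) * radialPull φ p.1 v) := by
    refine Measurable.stronglyMeasurable ?_
    refine Measurable.mul (by fun_prop) ?_
    exact (measurable_radialPull_uncurry hφ).comp
      (measurable_fst.fst.prodMk measurable_snd)
  have h2 := (h.integral_prod_right (ν := volume)).measurable
  convert h2 using 2 with p
  rw [Real.fourierInv_eq']
  congr 1; ext v
  simp [mul_comm]

lemma measurable_outgoing {φ : EuclideanSpace ℝ (Fin d) → ℂ} (hφ : Measurable φ) :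
    Measurable (outgoing φ) := by
  unfold outgoing
  have h := (measurable_fourierInv_radialPull hφ).comp (by fun_prop :
    Measurable fun ξ : EuclideanSpace ℝ (Fin d) => (‖ξ‖⁻¹ • ξ, ‖ξ‖))
  exact Measurable.mul (by fun_prop) h

lemma outgoing_smul (φ : EuclideanSpace ℝ (Fin d) → ℂ) {θ : EuclideanSpace ℝ (Fin d)}
    (hθ : ‖θ‖ = 1) {r : ℝ} (hr : 0 < r) :
    outgoing φ (r • θ) = Complex.exp (-(Complex.I * (((d : ℝ) - 1) / 4 * Real.pi : ℝ))) *
    (((r ^ (((d : ℝ) - 1) / 2))⁻¹ : ℝ) : ℂ) * 𝓕⁻ (radialPull φ θ) r := by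
  have h1 : ‖r • θ‖ = r := by rw [norm_smul, hθ, mul_one, Real.norm_of_nonneg hr.le]
  rw [outgoing, h1, smul_smul, inv_mul_cancel₀ hr.ne', one_smul]

lemma norm_outgoing_smul (hd : 1 ≤ d) (φ : EuclideanSpace ℝ (Fin d) → ℂ)
    {θ : EuclideanSpace ℝ (Fin d)} (hθ : ‖θ‖ = 1) {r : ℝ} (hr : 0 < r) :
    r ^ (d - 1) * ‖outgoing φ (r • θ)‖ ^ 2 = ‖𝓕⁻ (radialPull φ θ) r‖ ^ 2 := by
  have h2 : ‖Complex.exp (-(Complex.I * (((d : ℝ) - 1) / 4 * Real.pi : ℝ)))‖ = 1 := by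
    rw [mul_comm, ← neg_mul, ← Complex.ofReal_neg, Complex.norm_exp_ofReal_mul_I]
  have h3 : (r ^ (((d : ℝ) - 1) / 2)) ^ 2 = r ^ (d - 1) := by
    rw [← Real.rpow_natCast, ← Real.rpow_mul hr.le, ← Real.rpow_natCast r, Nat.cast_sub hd]
    congr 1; push_cast; ring
  rw [outgoing_smul φ hθ hr, norm_mul, norm_mul, h2, one_mul, Complex.norm_real,
    Real.norm_of_nonneg (by positivity), mul_pow, inv_pow, h3]
  field_simp

/-- The factor `|ξ|^(-(d-1)/2)` in `outgoing` cancels the Jacobian `r^(d-1)` after squaring, which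
leaves weighted one-dimensional norms on rays. -/
lemma lintegral_weight_outgoing_le (hd : 1 ≤ d) [Nontrivial (EuclideanSpace ℝ (Fin d))] (s : ℝ)
    (φ : 𝓢(EuclideanSpace ℝ (Fin d), ℂ)) :
    wnorm s (outgoing φ) ^ 2 = ∫⁻ ω : UnitSphere d, (∫⁻ r in Set.Ioi (0 : ℝ),
      ‖((2 * Real.pi * r) ^ s : ℝ) * 𝓕⁻ (radialPull φ ω) r‖ₑ ^ 2)
      ∂(volume : Measure (EuclideanSpace ℝ (Fin d))).toSphere := by
  have hm := aestronglyMeasurable_wt_mul s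
    (measurable_outgoing φ.continuous.measurable).aestronglyMeasurable
  rw [wnorm_sq, lintegral_polar (hm.enorm.pow_const 2)]
  refine lintegral_congr fun ω => setLIntegral_congr_fun measurableSet_Ioi fun r hr => ?_
  have hr : 0 < r := hr
  have hω : ‖(ω : EuclideanSpace ℝ (Fin d))‖ = 1 := by simp
  have h1 : ‖r • (ω : EuclideanSpace ℝ (Fin d))‖ = r := by
    rw [norm_smul, hω, mul_one, Real.norm_of_nonneg hr.le]
  simp only [finrank_euclideanSpace_fin]
  rw [← ofReal_norm, ← ofReal_norm, ← ENNReal.ofReal_pow (norm_nonneg _),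
    ← ENNReal.ofReal_pow (norm_nonneg _), ← ENNReal.ofReal_mul (by positivity), norm_mul,
    norm_mul, mul_pow, mul_pow, mul_left_comm, norm_outgoing_smul hd _ hω hr, wt, h1]

/-- Plancherel on each ray. Only the positive frequencies of the ray enter `outgoing`, hence an
inequality. -/
lemma wnorm_zero_outgoing_le (hd : 1 ≤ d) (φ : 𝓢(EuclideanSpace ℝ (Fin d), ℂ)) :
    wnorm 0 (outgoing φ) ≤ wnorm 0 (𝓕⁻ φ : 𝓢(EuclideanSpace ℝ (Fin d), ℂ)) := by
  have : Nonempty (Fin d) := ⟨⟨0, hd⟩⟩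
  have h0 : wnorm 0 (𝓕⁻ φ : 𝓢(EuclideanSpace ℝ (Fin d), ℂ)) ^ 2 = ∫⁻ x, ‖φ x‖ₑ ^ 2 := by
    rw [← lintegral_enorm_sq_fourierInv φ.integrable (φ.memLp 2), wnorm_sq]
    refine lintegral_congr fun x => ?_
    rw [wt_zero, SchwartzMap.fourierInv_coe]; simp
  rw [← ENNReal.pow_le_pow_left_iff two_ne_zero, h0, lintegral_weight_outgoing_le hd,
    lintegral_polar (φ.continuous.measurable.enorm.pow_const 2).aemeasurable]
  refine lintegral_mono fun ω => ?_
  have hω : ‖(ω : EuclideanSpace ℝ (Fin d))‖ = 1 := by simp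
  have m := integrable_and_memLp_radialPull hd φ hω
  calc _ ≤ ∫⁻ r, ‖𝓕⁻ (radialPull φ ω) r‖ₑ ^ 2 := by
        simp only [Real.rpow_zero, Complex.ofReal_one, one_mul]
        exact setLIntegral_le_lintegral _ _
    _ = _ := by
        rw [lintegral_enorm_sq_fourierInv m.1 m.2, lintegral_enorm_sq_radialPull hd]
        simp

/-- The partial derivative of a Schwartz function in the direction of the `j`-th coordinate. -/
def coordDeriv (j : Fin d) (φ : 𝓢(EuclideanSpace ℝ (Fin d), ℂ)) :
    𝓢(EuclideanSpace ℝ (Fin d), ℂ) :=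
  ∂_{EuclideanSpace.single j (1 : ℝ)} φ

lemma fourierInv_coordDeriv_apply (j : Fin d) (φ : 𝓢(EuclideanSpace ℝ (Fin d), ℂ))
    (ξ : EuclideanSpace ℝ (Fin d)) :
    (𝓕⁻ (coordDeriv j φ) : 𝓢(EuclideanSpace ℝ (Fin d), ℂ)) ξ =
      -(2 * Real.pi * Complex.I * ξ j * (𝓕⁻ φ : 𝓢(EuclideanSpace ℝ (Fin d), ℂ)) ξ) := by
  rw [coordDeriv, SchwartzMap.fourierInv_lineDerivOp_eq, smul_apply,
    SchwartzMap.smulLeftCLM_apply_apply (by fun_prop), EuclideanSpace.inner_single_right]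
  simp
  ring

lemma enorm_sq_lineDeriv_le (φ : 𝓢(EuclideanSpace ℝ (Fin d), ℂ))
    {θ : EuclideanSpace ℝ (Fin d)} (hθ : ‖θ‖ = 1) (x : EuclideanSpace ℝ (Fin d)) :
    ‖(∂_{θ} φ) x‖ₑ ^ 2 ≤ ∑ j, ‖(coordDeriv j φ) x‖ₑ ^ 2 := by
  have h1 : (∂_{θ} φ) x = ∑ j, (θ j : ℂ) * (coordDeriv j φ) x := by
    simp only [coordDeriv, SchwartzMap.lineDerivOp_apply_eq_fderiv]
    conv_lhs => rw [← (EuclideanSpace.basisFun (Fin d) ℝ).sum_repr θ]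
    simp
  have h2 : ‖(∂_{θ} φ) x‖ ^ 2 ≤ ∑ j, ‖(coordDeriv j φ) x‖ ^ 2 := by
    have h3 : ‖(∂_{θ} φ) x‖ ≤ ∑ j, |θ j| * ‖(coordDeriv j φ) x‖ := by
      rw [h1]
      refine (norm_sum_le _ _).trans (le_of_eq ?_)
      -- Expanding `θ` in the standard basis, Cauchy–Schwarz with `|θ| = 1` then bounds the
      -- directional derivative by the full gradient.
      simp
    have h4 := Finset.sum_mul_sq_le_sq_mul_sq Finset.univ (fun j => |θ j|)
      (fun j => ‖(coordDeriv j φ) x‖)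
    have h5 : ∑ j, |θ j| ^ 2 = 1 := by
      have := EuclideanSpace.norm_sq_eq θ
      rw [hθ] at this
      simpa using this.symm
    rw [h5, one_mul] at h4
    exact (pow_le_pow_left₀ (norm_nonneg _) h3 2).trans h4
  have h6 := ENNReal.ofReal_le_ofReal h2
  rw [ENNReal.ofReal_sum_of_nonneg fun j _ => by positivity] at h6
  simpa only [ENNReal.ofReal_pow (norm_nonneg _), ofReal_norm] using h6

lemma wnorm_one_fourierInv_sq (φ : 𝓢(EuclideanSpace ℝ (Fin d), ℂ)) :
    ∫⁻ x, ∑ j, ‖(coordDeriv j φ) x‖ₑ ^ 2 =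
      wnorm 1 (𝓕⁻ φ : 𝓢(EuclideanSpace ℝ (Fin d), ℂ)) ^ 2 := by
  have hm : ∀ j : Fin d, Measurable fun x =>
      ‖(coordDeriv j φ) x‖ₑ ^ 2 := fun j =>
    (SchwartzMap.continuous _).measurable.enorm.pow_const 2
  have h1 : ∀ j : Fin d, ∫⁻ x, ‖(coordDeriv j φ) x‖ₑ ^ 2 =
      ∫⁻ ξ, ‖((2 * Real.pi * ξ j : ℝ) : ℂ) *
        (𝓕⁻ φ : 𝓢(EuclideanSpace ℝ (Fin d), ℂ)) ξ‖ₑ ^ 2 := fun j => by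
    rw [← lintegral_enorm_sq_fourierInv (coordDeriv j φ).integrable ((coordDeriv j φ).memLp 2),
      ← SchwartzMap.fourierInv_coe]
    refine lintegral_congr fun ξ => ?_
    rw [fourierInv_coordDeriv_apply]
    congr 1
    rw [← ofReal_norm, ← ofReal_norm]
    congr 1
    simp [abs_of_pos Real.pi_pos]
  rw [lintegral_finsetSum _ fun j _ => hm j, wnorm_sq]
  simp_rw [h1]
  rw [← lintegral_finsetSum _ fun j _ => by
    have := (𝓕⁻ φ : 𝓢(EuclideanSpace ℝ (Fin d), ℂ)).continuous.measurable
    fun_prop]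
  refine lintegral_congr fun ξ => ?_
  simp only [enorm_mul, mul_pow]
  rw [← Finset.sum_mul, wt_one]
  congr 1
  simp only [← ofReal_norm, Complex.norm_real, ← ENNReal.ofReal_pow (norm_nonneg _)]
  rw [← ENNReal.ofReal_sum_of_nonneg fun j _ => by positivity]
  congr 1
  simp only [Real.norm_eq_abs, sq_abs, mul_pow]
  rw [← Finset.mul_sum, EuclideanSpace.norm_sq_eq]
  simp

/-- The weight `2πκ` on a ray becomes a radial derivative, the Hardy-type inequality moves it onto
`φ`, and the directional derivative is dominated by the gradient. -/
lemma wnorm_one_outgoing_le (hd : 3 ≤ d) (φ : 𝓢(EuclideanSpace ℝ (Fin d), ℂ)) :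
    wnorm 1 (outgoing φ) ≤ wnorm 1 (𝓕⁻ φ : 𝓢(EuclideanSpace ℝ (Fin d), ℂ)) := by
  have : Nonempty (Fin d) := ⟨⟨0, by omega⟩⟩
  have hm : Measurable fun x => ∑ j : Fin d,
      ‖(coordDeriv j φ) x‖ₑ ^ 2 :=
    Finset.measurable_fun_sum _ fun j _ => (SchwartzMap.continuous _).measurable.enorm.pow_const 2
  rw [← ENNReal.pow_le_pow_left_iff two_ne_zero, ← wnorm_one_fourierInv_sq,
    lintegral_weight_outgoing_le (by omega), lintegral_polar hm.aemeasurable]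
  refine lintegral_mono fun ω => ?_
  have hω : ‖(ω : EuclideanSpace ℝ (Fin d))‖ = 1 := by simp
  calc _ ≤ ∫⁻ κ : ℝ, ‖(2 * Real.pi * κ : ℂ) * 𝓕⁻ (radialPull φ ω) κ‖ₑ ^ 2 := by
        simp only [Real.rpow_one]
        push_cast
        exact setLIntegral_le_lintegral _ _
    _ ≤ _ := lintegral_weight_fourierInv_radialPull_le hd φ hω
    _ ≤ _ := by
        simp only [finrank_euclideanSpace_fin]
        gcongr
        exact enorm_sq_lineDeriv_le φ hω _

end Outgoing

/-! ### Real interpolation between the orders `0` and `1` -/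

section Interpolation

variable {d : ℕ}

/-- The resolvent multiplier `λ² / (λ² + |2πξ|²)`. -/
def lowPass {V : Type*} [NormedAddCommGroup V] (l : ℝ) (ξ : V) : ℝ :=
  l ^ 2 / (l ^ 2 + (2 * Real.pi * ‖ξ‖) ^ 2)

lemma one_sub_lowPass {V : Type*} [NormedAddCommGroup V] {l : ℝ} (hl : 0 < l) (ξ : V) :
    1 - lowPass l ξ = (2 * Real.pi * ‖ξ‖) ^ 2 / (l ^ 2 + (2 * Real.pi * ‖ξ‖) ^ 2) := by
  unfold lowPass
  have : l ^ 2 + (2 * Real.pi * ‖ξ‖) ^ 2 ≠ 0 := by positivity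
  field_simp
  ring

lemma hasTemperateGrowth_lowPass {l : ℝ} (hl : 0 < l) :
    (fun ξ : EuclideanSpace ℝ (Fin d) => (lowPass l ξ : ℂ)).HasTemperateGrowth := by
  have h1 : (fun ξ : EuclideanSpace ℝ (Fin d) => lowPass l ξ) =
      (fun x : EuclideanSpace ℝ (Fin d) => (1 + ‖x‖ ^ 2) ^ (-1 : ℝ)) ∘
        ((2 * Real.pi / l) • ContinuousLinearMap.id ℝ (EuclideanSpace ℝ (Fin d))) := by
    ext ξ
    simp only [Function.comp, lowPass, smul_apply,
      ContinuousLinearMap.id_apply, norm_smul, Real.norm_eq_abs, Real.rpow_neg_one, mul_pow, sq_abs]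
    have : l ^ 2 + (2 * Real.pi * ‖ξ‖) ^ 2 ≠ 0 := by positivity
    field_simp
  have h2 := (Function.hasTemperateGrowth_one_add_norm_sq_rpow
    (EuclideanSpace ℝ (Fin d)) (-1)).comp
    (((2 * Real.pi / l) • ContinuousLinearMap.id ℝ (EuclideanSpace ℝ (Fin d))).hasTemperateGrowth)
  rw [← h1] at h2
  exact Function.HasTemperateGrowth.comp Function.Complex.hasTemperateGrowth_ofReal h2

/-- The resolvent multiplier is smooth of temperate growth, so both pieces remain Schwartz. It is
the pointwise minimiser `a` of `|a|² x²/l² + |1-a|²` with `x = |2πξ|`, which makes the interpolation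
below exact. -/
lemma exists_schwartz_split {l : ℝ} (hl : 0 < l) (φ : 𝓢(EuclideanSpace ℝ (Fin d), ℂ)) :
    ∃ φA φB : 𝓢(EuclideanSpace ℝ (Fin d), ℂ), φ = φA + φB ∧
      (∀ ξ, (𝓕⁻ φA : 𝓢(EuclideanSpace ℝ (Fin d), ℂ)) ξ =
        (lowPass l ξ : ℂ) * (𝓕⁻ φ : 𝓢(EuclideanSpace ℝ (Fin d), ℂ)) ξ) ∧
      ∀ ξ, (𝓕⁻ φB : 𝓢(EuclideanSpace ℝ (Fin d), ℂ)) ξ =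
        ((1 - lowPass l ξ : ℝ) : ℂ) * (𝓕⁻ φ : 𝓢(EuclideanSpace ℝ (Fin d), ℂ)) ξ := by
  let φA : 𝓢(EuclideanSpace ℝ (Fin d), ℂ) :=
    𝓕 (SchwartzMap.smulLeftCLM ℂ (fun ξ => (lowPass l ξ : ℂ)) (𝓕⁻ φ))
  have hA : ∀ ξ, (𝓕⁻ φA : 𝓢(EuclideanSpace ℝ (Fin d), ℂ)) ξ =
      (lowPass l ξ : ℂ) * (𝓕⁻ φ : 𝓢(EuclideanSpace ℝ (Fin d), ℂ)) ξ := fun ξ => by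
    rw [FourierTransform.fourierInv_fourier_eq,
      SchwartzMap.smulLeftCLM_apply_apply (hasTemperateGrowth_lowPass hl), smul_eq_mul]
  refine ⟨φA, φ - φA, by abel, hA, fun ξ => ?_⟩
  rw [sub_eq_add_neg, FourierTransform.fourierInv_add, FourierTransform.fourierInv_neg]
  simp only [add_apply, neg_apply, hA]
  push_cast; ring

lemma fourierInv_add_of_integrable {f g : ℝ → ℂ} (hf : Integrable f volume)
    (hg : Integrable g volume) (x : ℝ) : 𝓕⁻ (f + g) x = 𝓕⁻ f x + 𝓕⁻ g x := by
  have h : ∀ {f : ℝ → ℂ}, Integrable f volume →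
      Integrable (fun v => Complex.exp (((2 * Real.pi * inner ℝ v x : ℝ) : ℂ) * Complex.I) • f v)
        volume := fun {f} hf => by
    refine hf.bdd_mul (c := 1) (Continuous.aestronglyMeasurable (by fun_prop))
      (.of_forall fun v => ?_)
    rw [Complex.norm_exp_ofReal_mul_I]
  rw [Real.fourierInv_eq', Real.fourierInv_eq', Real.fourierInv_eq', ← integral_add (h hf) (h hg)]
  simp [mul_add]

lemma outgoing_add (hd : 2 ≤ d) (φ ψ : 𝓢(EuclideanSpace ℝ (Fin d), ℂ))
    (ξ : EuclideanSpace ℝ (Fin d)) :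
    outgoing (φ + ψ : 𝓢(EuclideanSpace ℝ (Fin d), ℂ)) ξ = outgoing φ ξ + outgoing ψ ξ := by
  have hd' : (2 : ℝ) ≤ d := by exact_mod_cast hd
  rcases eq_or_ne ξ 0 with rfl | hξ
  · have : ((d : ℝ) - 1) / 2 ≠ 0 := by linarith
    simp [outgoing, Real.zero_rpow this]
  · have hn : ‖‖ξ‖⁻¹ • ξ‖ = 1 := by
      rw [norm_smul, norm_inv, norm_norm, inv_mul_cancel₀ (norm_ne_zero_iff.2 hξ)]
    have h1 := integrable_and_memLp_radialPull (by omega) φ hn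
    have h2 := integrable_and_memLp_radialPull (by omega) ψ hn
    have h3 : radialPull (φ + ψ : 𝓢(EuclideanSpace ℝ (Fin d), ℂ)) (‖ξ‖⁻¹ • ξ) =
        radialPull φ (‖ξ‖⁻¹ • ξ) + radialPull ψ (‖ξ‖⁻¹ • ξ) := by
      ext r
      simp only [radialPull, Pi.add_apply, add_apply]
      split_ifs <;> ring
    rw [outgoing, outgoing, outgoing, h3, fourierInv_add_of_integrable h1.1 h2.1]
    ring

lemma outgoing_smul_fun (c : ℂ) (φ : EuclideanSpace ℝ (Fin d) → ℂ)
    (ξ : EuclideanSpace ℝ (Fin d)) :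
    outgoing (fun x => c * φ x) ξ = c * outgoing φ ξ := by
  have h3 : radialPull (fun x => c * φ x) (‖ξ‖⁻¹ • ξ) = fun r => c * radialPull φ (‖ξ‖⁻¹ • ξ) r := by
    ext r
    simp only [radialPull]
    split_ifs <;> ring
  rw [outgoing, outgoing, h3, Real.fourierInv_eq', Real.fourierInv_eq']
  simp_rw [smul_eq_mul, mul_left_comm _ c]
  rw [integral_const_mul]
  ring

lemma rpow_le_one_add_sq {y p : ℝ} (hy : 0 ≤ y) (hp0 : 0 ≤ p) (hp2 : p ≤ 2) :
    y ^ p ≤ 1 + y ^ 2 := by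
  rcases le_or_gt y 1 with h | h
  · have := Real.rpow_le_one hy h hp0
    nlinarith [sq_nonneg y]
  · have := Real.rpow_le_rpow_of_exponent_le h.le hp2
    rw [Real.rpow_two] at this
    linarith

/-- A linear functional on Schwartz functions that is bounded by `ε` for the homogeneous norm of
order `0` and by `C` for that of order `1` is small for the norms of intermediate order. -/
lemma norm_le_of_split {θ : ℝ} (h0 : 0 < θ) (h1 : θ < 1)
    (L : 𝓢(EuclideanSpace ℝ (Fin d), ℂ) → ℂ) (hL : ∀ φ ψ, L (φ + ψ) = L φ + L ψ) {ε C : ℝ}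
    (hε : 0 ≤ ε) (hC : 0 ≤ C)
    (b0 : ∀ φ, ‖L φ‖ ≤ ε * (wnorm 0 (𝓕⁻ φ : 𝓢(EuclideanSpace ℝ (Fin d), ℂ))).toReal)
    (b1 : ∀ φ, ‖L φ‖ ≤ C * (wnorm 1 (𝓕⁻ φ : 𝓢(EuclideanSpace ℝ (Fin d), ℂ))).toReal)
    (hd : 1 ≤ d) {l : ℝ} (hl : 0 < l) (φ : 𝓢(EuclideanSpace ℝ (Fin d), ℂ)) :
    ‖L φ‖ ≤ (ε * l ^ (-θ) + C * l ^ (1 - θ)) *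
      (wnorm θ (𝓕⁻ φ : 𝓢(EuclideanSpace ℝ (Fin d), ℂ))).toReal := by
  have : Nonempty (Fin d) := ⟨⟨0, hd⟩⟩
  obtain ⟨φA, φB, hs, hA, hB⟩ := exists_schwartz_split hl φ
  have hfin : wnorm θ (𝓕⁻ φ : 𝓢(EuclideanSpace ℝ (Fin d), ℂ)) < ∞ :=
    wnorm_schwartz_lt_top (by
      have : (0 : ℝ) ≤ Module.finrank ℝ (EuclideanSpace ℝ (Fin d)) := Nat.cast_nonneg _
      linarith) _
  have key : ∀ s : ℝ, ∀ p : ℝ, ∀ a : EuclideanSpace ℝ (Fin d) → ℝ, 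
      ∀ ψ : 𝓢(EuclideanSpace ℝ (Fin d), ℂ), 
      (∀ ξ, (𝓕⁻ ψ : 𝓢(EuclideanSpace ℝ (Fin d), ℂ)) ξ =
        (a ξ : ℂ) * (𝓕⁻ φ : 𝓢(EuclideanSpace ℝ (Fin d), ℂ)) ξ) →
      (∀ ξ, ξ ≠ 0 → wt s ξ * |a ξ| ≤ l ^ p * wt θ ξ) →
      (wnorm s (𝓕⁻ ψ : 𝓢(EuclideanSpace ℝ (Fin d), ℂ))).toReal ≤
        l ^ p * (wnorm θ (𝓕⁻ φ : 𝓢(EuclideanSpace ℝ (Fin d), ℂ))).toReal := by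
    intro s p a ψ h h'
    have h2 : wnorm s (𝓕⁻ ψ : 𝓢(EuclideanSpace ℝ (Fin d), ℂ)) ≤
        ENNReal.ofReal (l ^ p) * wnorm θ (𝓕⁻ φ : 𝓢(EuclideanSpace ℝ (Fin d), ℂ)) := by
      have h3 : ENNReal.ofReal (l ^ p) = ‖((l ^ p : ℝ) : ℂ)‖ₑ := by
        rw [← ofReal_norm, Complex.norm_real, Real.norm_of_nonneg (by positivity)]
      rw [h3, ← wnorm_const_mul]
      refine wnorm_mono ?_
      filter_upwards [ae_ne_zero] with ξ hξ
      rw [h, norm_mul, norm_mul, Complex.norm_real, Complex.norm_real, Real.norm_eq_abs,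
        Real.norm_of_nonneg (by positivity), ← mul_assoc, ← mul_assoc]
      refine mul_le_mul_of_nonneg_right ?_ (norm_nonneg _)
      rw [mul_comm (wt θ ξ)]
      exact h' ξ hξ
    have := ENNReal.toReal_mono (ENNReal.mul_lt_top ENNReal.ofReal_lt_top hfin).ne h2
    rwa [ENNReal.toReal_mul, ENNReal.toReal_ofReal (by positivity)] at this
  have x1 : ∀ ξ : EuclideanSpace ℝ (Fin d), ξ ≠ 0 → ∃ y : ℝ, 0 < y ∧
      2 * Real.pi * ‖ξ‖ = l * y := fun ξ hξ => by
    have := norm_pos_iff.2 hξ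
    exact ⟨2 * Real.pi * ‖ξ‖ / l, by positivity, by field_simp⟩
  -- With `|2πξ| = l y` the claim is `y²/(1+y²) ≤ y^θ`, that is, `y^(2-θ) ≤ 1 + y²`.
  have kB := key 0 (-θ) _ φB hB fun ξ hξ => by
    obtain ⟨y, hy, e⟩ := x1 ξ hξ
    rw [one_sub_lowPass hl, wt_zero, wt, e, abs_of_nonneg (by positivity),
      Real.mul_rpow hl.le hy.le, ← mul_assoc, ← Real.rpow_add hl, neg_add_cancel, Real.rpow_zero,
      one_mul, one_mul]
    have := rpow_le_one_add_sq (p := 2 - θ) hy.le (by linarith) (by linarith)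
    rw [Real.rpow_sub hy, Real.rpow_two, div_le_iff₀ (by positivity)] at this
    rw [div_le_iff₀ (by positivity)]
    nlinarith [sq_nonneg l]
  -- Here the claim is `y/(1+y²) ≤ y^θ`, that is, `y^(1-θ) ≤ 1 + y²`.
  have kA := key 1 (1 - θ) _ φA hA fun ξ hξ => by
    obtain ⟨y, hy, e⟩ := x1 ξ hξ
    rw [lowPass, wt, wt, Real.rpow_one, e, abs_of_nonneg (by positivity),
      Real.mul_rpow hl.le hy.le, ← mul_assoc, ← Real.rpow_add hl, sub_add_cancel, Real.rpow_one]
    have := rpow_le_one_add_sq (p := 1 - θ) hy.le (by linarith) (by linarith)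
    rw [Real.rpow_sub hy, Real.rpow_one, div_le_iff₀ (by positivity)] at this
    rw [← mul_div_assoc, div_le_iff₀ (by positivity)]
    have h3 : 0 < l ^ 3 := by positivity
    nlinarith
  rw [hs, hL, ← hs]
  calc _ ≤ ‖L φA‖ + ‖L φB‖ := norm_add_le _ _
    _ ≤ C * _ + ε * _ := add_le_add ((b1 _).trans (mul_le_mul_of_nonneg_left kA hC))
      ((b0 _).trans (mul_le_mul_of_nonneg_left kB hε))
    _ = _ := by ring

lemma integrableOn_kernel {θ : ℝ} (h0 : 0 < θ) (h1 : θ < 1) :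
    IntegrableOn (fun l : ℝ => l ^ (2 * θ - 1) / (l ^ 2 + 1)) (Set.Ioi 0) := by
  have hm : AEStronglyMeasurable (fun l : ℝ => l ^ (2 * θ - 1) / (l ^ 2 + 1)) volume :=
    Measurable.aestronglyMeasurable (by fun_prop)
  rw [← Set.Ioc_union_Ioi_eq_Ioi zero_le_one, integrableOn_union]
  constructor
  · refine Integrable.mono' (g := fun l => l ^ (2 * θ - 1))
      ((intervalIntegrable_iff_integrableOn_Ioc_of_le zero_le_one).1
        (intervalIntegral.intervalIntegrable_rpow' (by linarith))) hm.restrict ?_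
    filter_upwards [ae_restrict_mem measurableSet_Ioc] with l hl
    have := hl.1
    rw [Real.norm_of_nonneg (by positivity)]
    exact div_le_self (by positivity) (by nlinarith)
  · refine Integrable.mono' (g := fun l => l ^ (2 * θ - 3))
      (integrableOn_Ioi_rpow_of_lt (by linarith) one_pos) hm.restrict ?_
    filter_upwards [ae_restrict_mem measurableSet_Ioi] with l hl
    have hl' : 0 < l := one_pos.trans hl
    rw [Real.norm_of_nonneg (by positivity), div_le_iff₀ (by positivity)]
    have : l ^ (2 * θ - 1) = l ^ (2 * θ - 3) * l ^ 2 := by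
      rw [← Real.rpow_two, ← Real.rpow_add hl']; congr 1; ring
    rw [this, mul_add, mul_one]
    have : 0 < l ^ (2 * θ - 3) := by positivity
    linarith

/-- Scaling `l` by `x` pulls out `x^(2θ)`. The remaining integral of `l^(2θ-1)/(l²+1)` converges at
`0` because `θ > 0` and at infinity because `θ < 1`. -/
lemma exists_lintegral_kernel {θ : ℝ} (h0 : 0 < θ) (h1 : θ < 1) :
    ∃ c : ℝ≥0∞, c ≠ 0 ∧ c ≠ ∞ ∧ ∀ x : ℝ, 0 < x →
      ∫⁻ l in Set.Ioi (0 : ℝ), ENNReal.ofReal (l ^ (2 * θ - 1) * (x ^ 2 / (l ^ 2 + x ^ 2))) =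
        c * ENNReal.ofReal (x ^ (2 * θ)) := by
  have hi := integrableOn_kernel h0 h1
  set c := ∫ l in Set.Ioi (0 : ℝ), l ^ (2 * θ - 1) / (l ^ 2 + 1) with hc
  have hc0 : 0 < c := by
    rw [hc, setIntegral_pos_iff_support_of_nonneg_ae ?_ hi]
    · have : Set.Ioi (0 : ℝ) ⊆ Function.support (fun l : ℝ => l ^ (2 * θ - 1) / (l ^ 2 + 1)) :=
        fun l hl => by
          have hl : 0 < l := hl
          rw [Function.mem_support]; positivity
      rw [Set.inter_eq_right.2 this]; simp
    · filter_upwards [ae_restrict_mem measurableSet_Ioi] with l hl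
      have hl : 0 < l := hl
      simp only [Pi.zero_apply]; positivity
  refine ⟨ENNReal.ofReal c, by simpa using hc0, ENNReal.ofReal_ne_top, fun x hx => ?_⟩
  have e : ∀ l ∈ Set.Ioi (0 : ℝ), l ^ (2 * θ - 1) * (x ^ 2 / (l ^ 2 + x ^ 2)) =
      x ^ (2 * θ - 1) * (fun l : ℝ => l ^ (2 * θ - 1) / (l ^ 2 + 1)) (x⁻¹ * l) := fun l hl => by
    have hl : 0 < l := hl
    simp only
    rw [Real.mul_rpow (by positivity) hl.le, Real.inv_rpow hx.le]
    field_simp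
  have hi' : IntegrableOn (fun l : ℝ => l ^ (2 * θ - 1) * (x ^ 2 / (l ^ 2 + x ^ 2)))
      (Set.Ioi 0) := by
    have h2 : IntegrableOn (fun l : ℝ => (fun l : ℝ => l ^ (2 * θ - 1) / (l ^ 2 + 1)) (x⁻¹ * l))
        (Set.Ioi 0) := by
      refine (integrableOn_Ioi_comp_mul_left_iff
        (fun l : ℝ => l ^ (2 * θ - 1) / (l ^ 2 + 1)) 0 (by positivity)).2 ?_
      rwa [mul_zero]
    exact IntegrableOn.congr_fun (h2.const_mul (x ^ (2 * θ - 1))) (fun l hl => (e l hl).symm)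
      measurableSet_Ioi
  rw [← ofReal_integral_eq_lintegral_ofReal hi', ← ENNReal.ofReal_mul hc0.le]
  · congr 1
    rw [setIntegral_congr_fun measurableSet_Ioi e, integral_const_mul,
      integral_comp_mul_left_Ioi (fun l : ℝ => l ^ (2 * θ - 1) / (l ^ 2 + 1)) 0
        (by positivity : 0 < x⁻¹), mul_zero, inv_inv, smul_eq_mul, ← hc, ← mul_assoc,
      mul_comm c, Real.rpow_sub hx, Real.rpow_one]
    field_simp
  · filter_upwards [ae_restrict_mem measurableSet_Ioi] with l hl
    have hl : 0 < l := hl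
    simp only [Pi.zero_apply]; positivity

/-- By Tonelli, the squared norm of order `θ` is a superposition over `l` of the quadratic forms of
`1 - lowPass l`, so operator bounds can be checked for each `l` separately. -/
lemma lintegral_kernel_wnorm (hd : 1 ≤ d) {θ : ℝ} {c : ℝ≥0∞}
    (hc : ∀ x : ℝ, 0 < x →
      ∫⁻ l in Set.Ioi (0 : ℝ), ENNReal.ofReal (l ^ (2 * θ - 1) * (x ^ 2 / (l ^ 2 + x ^ 2))) =
        c * ENNReal.ofReal (x ^ (2 * θ)))
    {g : EuclideanSpace ℝ (Fin d) → ℂ} (hg : Measurable g) :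
    c * wnorm θ g ^ 2 = ∫⁻ l in Set.Ioi (0 : ℝ), ENNReal.ofReal (l ^ (2 * θ - 1)) *
      ∫⁻ ξ, ENNReal.ofReal (1 - lowPass l ξ) * ‖g ξ‖ₑ ^ 2 := by
  have : Nonempty (Fin d) := ⟨⟨0, hd⟩⟩
  have hgm := hg.enorm.pow_const 2
  have hlow : Measurable fun p : EuclideanSpace ℝ (Fin d) × ℝ => 1 - lowPass p.2 p.1 := by
    unfold lowPass; fun_prop
  have hlow2 : ∀ l : ℝ, Measurable fun ξ : EuclideanSpace ℝ (Fin d) => 1 - lowPass l ξ := fun l =>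
    hlow.comp measurable_prodMk_right
  have e1 : c * wnorm θ g ^ 2 = ∫⁻ ξ, ∫⁻ l in Set.Ioi (0 : ℝ),
      ENNReal.ofReal (l ^ (2 * θ - 1)) * (ENNReal.ofReal (1 - lowPass l ξ) * ‖g ξ‖ₑ ^ 2) := by
    have hwm : Measurable fun ξ => ‖(wt θ ξ : ℂ) * g ξ‖ₑ ^ 2 :=
      (((Complex.measurable_ofReal.comp (measurable_wt θ)).mul hg).enorm).pow_const 2
    rw [wnorm_sq, ← lintegral_const_mul c hwm]
    refine lintegral_congr_ae ?_
    filter_upwards [ae_ne_zero] with ξ hξ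
    have hx : 0 < 2 * Real.pi * ‖ξ‖ := by
      have := norm_pos_iff.2 hξ
      positivity
    have h1 : ‖(wt θ ξ : ℂ) * g ξ‖ₑ ^ 2 =
        ENNReal.ofReal ((2 * Real.pi * ‖ξ‖) ^ (2 * θ)) * ‖g ξ‖ₑ ^ 2 := by
      rw [enorm_mul, mul_pow, ← ofReal_norm, Complex.norm_real, Real.norm_of_nonneg (wt_nonneg _ _),
        ← ENNReal.ofReal_pow (wt_nonneg _ _), wt, ← Real.rpow_natCast, ← Real.rpow_mul hx.le]
      congr 3; push_cast; ring
    rw [h1, ← mul_assoc, ← hc _ hx, ← lintegral_mul_const _ (by fun_prop)]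
    refine setLIntegral_congr_fun measurableSet_Ioi fun l hl => ?_
    have hl : 0 < l := hl
    rw [one_sub_lowPass hl, ENNReal.ofReal_mul (by positivity), mul_assoc]
  rw [e1, lintegral_lintegral_swap]
  · refine lintegral_congr fun l => ?_
    rw [lintegral_const_mul _ (by have := hlow2 l; fun_prop)]
  · refine Measurable.aemeasurable ?_
    have h2 : Measurable fun p : EuclideanSpace ℝ (Fin d) × ℝ => ‖g p.1‖ₑ ^ 2 :=
      hgm.comp measurable_fst
    have h3 : Measurable fun p : EuclideanSpace ℝ (Fin d) × ℝ =>
      ENNReal.ofReal (p.2 ^ (2 * θ - 1)) := by fun_prop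
    exact h3.mul (hlow.ennreal_ofReal.mul h2)

/-- The multiplier `1 - lowPass l` is at most both `|2πξ|²/l²` and `1`. The first bound is used on
the low-frequency piece, with the estimate of order `1`, and the second on the high-frequency piece,
with that of order `0`. With `p = lowPass l` and `x = |2πξ|`, the identity `p² x²/l² + (1-p)² = 1 -
p` reassembles the right side. -/
lemma lintegral_one_sub_lowPass_outgoing_le (hd : 3 ≤ d) (φ : 𝓢(EuclideanSpace ℝ (Fin d), ℂ))
    {l : ℝ} (hl : 0 < l) :
    ∫⁻ ξ, ENNReal.ofReal (1 - lowPass l ξ) * ‖outgoing φ ξ‖ₑ ^ 2 ≤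
      2 * ∫⁻ ξ, ENNReal.ofReal (1 - lowPass l ξ) *
        ‖(𝓕⁻ φ : 𝓢(EuclideanSpace ℝ (Fin d), ℂ)) ξ‖ₑ ^ 2 := by
  obtain ⟨φA, φB, hs, hA, hB⟩ := exists_schwartz_split hl φ
  have hx : ∀ ξ : EuclideanSpace ℝ (Fin d), 0 ≤ 1 - lowPass l ξ := fun ξ => by
    rw [one_sub_lowPass hl]; positivity
  have hx1 : ∀ ξ : EuclideanSpace ℝ (Fin d), 1 - lowPass l ξ ≤ 1 := fun ξ => by
    rw [lowPass, sub_le_self_iff]; positivity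
  have hx2 : ∀ ξ : EuclideanSpace ℝ (Fin d), 1 - lowPass l ξ ≤ (l ^ 2)⁻¹ * wt 1 ξ ^ 2 := fun ξ => by
    rw [one_sub_lowPass hl, wt_one, ← div_eq_inv_mul]
    gcongr
    exact le_add_of_nonneg_right (by positivity)
  have mB := (measurable_outgoing φB.continuous.measurable).enorm.pow_const 2
  have n0 := pow_le_pow_left' (wnorm_zero_outgoing_le (by omega) φB) 2
  have n1 := pow_le_pow_left' (wnorm_one_outgoing_le hd φA) 2
  rw [wnorm_sq, wnorm_sq] at n0 n1
  have step1 : ∫⁻ ξ, ENNReal.ofReal (1 - lowPass l ξ) * ‖outgoing φ ξ‖ₑ ^ 2 ≤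
      2 * (ENNReal.ofReal (l ^ 2)⁻¹ * ∫⁻ ξ, ‖(wt 1 ξ : ℂ) * outgoing φA ξ‖ₑ ^ 2) +
      2 * ∫⁻ ξ, ‖(wt 0 ξ : ℂ) * outgoing φB ξ‖ₑ ^ 2 := by
    rw [← lintegral_const_mul' _ _ ENNReal.ofReal_ne_top, ← lintegral_const_mul' _ _ (by simp),
      ← lintegral_const_mul' _ _ (by simp), ← lintegral_add_right _ (by
        simp only [wt_zero, Complex.ofReal_one, one_mul]; exact mB.const_mul 2)]
    refine lintegral_mono fun ξ => ?_
    rw [hs, outgoing_add (by omega), wt_zero, Complex.ofReal_one, one_mul]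
    have e1 : ‖outgoing φA ξ + outgoing φB ξ‖ ^ 2 ≤
        2 * ‖outgoing φA ξ‖ ^ 2 + 2 * ‖outgoing φB ξ‖ ^ 2 := by
      have := pow_le_pow_left₀ (norm_nonneg _) (norm_add_le (outgoing φA ξ) (outgoing φB ξ)) 2
      nlinarith [sq_nonneg (‖outgoing φA ξ‖ - ‖outgoing φB ξ‖)]
    have e2 : (1 - lowPass l ξ) * ‖outgoing φA ξ + outgoing φB ξ‖ ^ 2 ≤
        2 * ((l ^ 2)⁻¹ * ‖(wt 1 ξ : ℂ) * outgoing φA ξ‖ ^ 2) + 2 * ‖outgoing φB ξ‖ ^ 2 := by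
      rw [norm_mul, Complex.norm_real, Real.norm_of_nonneg (wt_nonneg _ _), mul_pow]
      have a0 := sq_nonneg ‖outgoing φA ξ‖
      have b0 := sq_nonneg ‖outgoing φB ξ‖
      calc _ ≤ (1 - lowPass l ξ) * (2 * ‖outgoing φA ξ‖ ^ 2 + 2 * ‖outgoing φB ξ‖ ^ 2) :=
            mul_le_mul_of_nonneg_left e1 (hx ξ)
        _ = 2 * ((1 - lowPass l ξ) * ‖outgoing φA ξ‖ ^ 2) +
            2 * ((1 - lowPass l ξ) * ‖outgoing φB ξ‖ ^ 2) := by ring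
        _ ≤ 2 * (((l ^ 2)⁻¹ * wt 1 ξ ^ 2) * ‖outgoing φA ξ‖ ^ 2) +
            2 * (1 * ‖outgoing φB ξ‖ ^ 2) := by
            gcongr
            · exact hx2 ξ
            · exact hx1 ξ
        _ = _ := by ring
    have e3 := ENNReal.ofReal_le_ofReal e2
    rw [ENNReal.ofReal_mul (hx ξ), ENNReal.ofReal_add (by positivity) (by positivity),
      ENNReal.ofReal_mul two_pos.le, ENNReal.ofReal_mul two_pos.le,
      ENNReal.ofReal_mul (by positivity)] at e3
    simpa only [ENNReal.ofReal_pow (norm_nonneg _), ofReal_norm, ENNReal.ofReal_ofNat] using e3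
  refine step1.trans ?_
  have mA := ((𝓕⁻ φA : 𝓢(EuclideanSpace ℝ (Fin d), ℂ)).continuous.measurable)
  calc _ ≤ 2 * (ENNReal.ofReal (l ^ 2)⁻¹ *
        ∫⁻ ξ, ‖(wt 1 ξ : ℂ) * (𝓕⁻ φA : 𝓢(EuclideanSpace ℝ (Fin d), ℂ)) ξ‖ₑ ^ 2) +
        2 * ∫⁻ ξ, ‖(wt 0 ξ : ℂ) * (𝓕⁻ φB : 𝓢(EuclideanSpace ℝ (Fin d), ℂ)) ξ‖ₑ ^ 2 := by
        gcongr
    _ = 2 * ∫⁻ ξ, (ENNReal.ofReal (l ^ 2)⁻¹ *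
          ‖(wt 1 ξ : ℂ) * (𝓕⁻ φA : 𝓢(EuclideanSpace ℝ (Fin d), ℂ)) ξ‖ₑ ^ 2 +
        ‖(wt 0 ξ : ℂ) * (𝓕⁻ φB : 𝓢(EuclideanSpace ℝ (Fin d), ℂ)) ξ‖ₑ ^ 2) := by
        rw [← mul_add, ← lintegral_const_mul' _ _ ENNReal.ofReal_ne_top, ← lintegral_add_left]
        have := measurable_wt (V := EuclideanSpace ℝ (Fin d)) 1
        fun_prop
    _ = _ := by
        congr 1
        refine lintegral_congr fun ξ => ?_
        rw [hA, hB, wt_zero, Complex.ofReal_one, one_mul]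
        simp only [← ofReal_norm, ← ENNReal.ofReal_pow (norm_nonneg _)]
        rw [← ENNReal.ofReal_mul (by positivity), ← ENNReal.ofReal_add (by positivity)
          (by positivity), ← ENNReal.ofReal_mul (hx ξ)]
        congr 1
        rw [norm_mul, norm_mul, norm_mul, Complex.norm_real, Complex.norm_real, Complex.norm_real,
          mul_pow, mul_pow, mul_pow, Real.norm_eq_abs, Real.norm_eq_abs, Real.norm_eq_abs, sq_abs,
          sq_abs, sq_abs, one_sub_lowPass hl, wt_one, lowPass]
        have : l ^ 2 + (2 * Real.pi * ‖ξ‖) ^ 2 ≠ 0 := by positivity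
        field_simp

/-- The outgoing operator is bounded for the homogeneous norms of order between `0` and `1`. -/
lemma wnorm_outgoing_le (hd : 3 ≤ d) {θ : ℝ} (h0 : 0 < θ) (h1 : θ < 1)
    (φ : 𝓢(EuclideanSpace ℝ (Fin d), ℂ)) :
    wnorm θ (outgoing φ) ≤ 2 * wnorm θ (𝓕⁻ φ : 𝓢(EuclideanSpace ℝ (Fin d), ℂ)) := by
  obtain ⟨c, hc0, hc, h⟩ := exists_lintegral_kernel h0 h1
  have e1 := lintegral_kernel_wnorm (by omega) h (measurable_outgoing φ.continuous.measurable)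
  have e2 := lintegral_kernel_wnorm (by omega) h
    (𝓕⁻ φ : 𝓢(EuclideanSpace ℝ (Fin d), ℂ)).continuous.measurable
  have e3 : c * wnorm θ (outgoing φ) ^ 2 ≤
      c * (2 * wnorm θ (𝓕⁻ φ : 𝓢(EuclideanSpace ℝ (Fin d), ℂ)) ^ 2) := by
    rw [mul_left_comm, e1, e2, ← lintegral_const_mul' _ _ (by simp)]
    refine setLIntegral_mono' measurableSet_Ioi fun l hl => ?_
    rw [mul_left_comm]
    gcongr
    exact lintegral_one_sub_lowPass_outgoing_le hd φ hl
  rw [ENNReal.mul_le_mul_iff_right hc0 hc] at e3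
  -- The squared norms compare with the constant `2`, which is at most `2²`.
  rw [← ENNReal.pow_le_pow_left_iff two_ne_zero, mul_pow]
  refine e3.trans ?_
  gcongr
  norm_num

end Interpolation

/-! ### The Poisson kernel at complex heights -/

section PoissonKernel

/-- The substitution `v = a w - b/w` maps the half line bijectively onto `ℝ`, with inverse `h`. Its
Jacobian `(1 + v/S)/(2a)` is a constant plus an odd function, and the odd part integrates to zero
against the Gaussian. -/
lemma integral_exp_neg_sq_sub_div {a b : ℝ} (ha : 0 < a) (hb : 0 < b) :
    IntegrableOn (fun w : ℝ => Real.exp (-(a * w - b / w) ^ 2)) (Set.Ioi 0) ∧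
    ∫ w in Set.Ioi (0 : ℝ), Real.exp (-(a * w - b / w) ^ 2) = √Real.pi / (2 * a) := by
  set S : ℝ → ℝ := fun v => √(v ^ 2 + 4 * a * b)
  set h : ℝ → ℝ := fun v => (v + S v) / (2 * a)
  have hab : 0 < 4 * a * b := by positivity
  have hS : ∀ v, S v ^ 2 = v ^ 2 + 4 * a * b := fun v => Real.sq_sqrt (by positivity)
  have hS0 : ∀ v, |v| < S v := fun v => by
    rw [← Real.sqrt_sq_eq_abs]; exact Real.sqrt_lt_sqrt (sq_nonneg v) (by linarith)
  have hvS : ∀ v, 0 < v + S v := fun v => by linarith [hS0 v, neg_abs_le v]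
  have hpos : ∀ v, 0 < h v := fun v => div_pos (hvS v) (by positivity)
  have hgh : ∀ v, a * h v - b / h v = v := fun v => by
    have h1 := hvS v
    have : b / h v = (S v - v) / 2 := by
      simp only [h]; rw [div_div_eq_mul_div, div_eq_div_iff h1.ne' two_ne_zero]
      nlinarith [hS v]
    rw [this]; simp only [h]; field_simp; ring
  have hhg : ∀ w, 0 < w → h (a * w - b / w) = w := fun w hw => by
    have : S (a * w - b / w) = a * w + b / w := by
      simp only [S]
      rw [show (a * w - b / w) ^ 2 + 4 * a * b = (a * w + b / w) ^ 2 by field_simp; ring]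
      exact Real.sqrt_sq (by positivity)
    simp only [h]; rw [this]; field_simp; ring
  have himg : h '' Set.univ = Set.Ioi 0 := by
    ext w; simp only [Set.image_univ, Set.mem_range, Set.mem_Ioi]
    exact ⟨fun ⟨v, hv⟩ => hv ▸ hpos v, fun hw => ⟨_, hhg w hw⟩⟩
  have hinj : Set.InjOn h Set.univ := fun x _ y _ hxy => by rw [← hgh x, ← hgh y, hxy]
  set h' : ℝ → ℝ := fun v => (1 + v / S v) / (2 * a)
  have hSpos : ∀ v, 0 < S v := fun v => (abs_nonneg v).trans_lt (hS0 v)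
  have hder : ∀ v ∈ Set.univ, HasDerivWithinAt h (h' v) Set.univ v := fun v _ => by
    refine HasDerivAt.hasDerivWithinAt (HasDerivAt.div_const ?_ _)
    refine (hasDerivAt_id v).add ?_
    have h1 : HasDerivAt (fun v : ℝ => v ^ 2 + 4 * a * b) (2 * v) v := by
      simpa using (hasDerivAt_pow 2 v).add_const (4 * a * b)
    have h2 := h1.sqrt (by positivity)
    rw [mul_div_mul_left _ _ two_ne_zero] at h2
    exact h2
  have habs : ∀ v, |h' v| = h' v := fun v => abs_of_nonneg <| by
    refine div_nonneg ?_ (by positivity)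
    have : -1 ≤ v / S v := by rw [le_div_iff₀ (hSpos v)]; linarith [hS0 v, neg_abs_le v]
    linarith
  have hint := integrable_exp_neg_mul_sq (b := 1) one_pos
  simp only [neg_mul, one_mul] at hint
  have hodd : Integrable fun v => v / S v * Real.exp (-v ^ 2) := by
    refine hint.bdd_mul (c := 1) ?_ (ae_of_all _ fun v => ?_)
    · exact (by simp only [S]; fun_prop : Measurable fun v => v / S v).aestronglyMeasurable
    · rw [norm_div, Real.norm_eq_abs, Real.norm_of_nonneg (hSpos v).le, div_le_one (hSpos v)]
      exact (hS0 v).le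
  have hodd0 : ∫ v, v / S v * Real.exp (-v ^ 2) = 0 := by
    have := integral_neg_eq_self (fun v => v / S v * Real.exp (-v ^ 2)) volume
    have h2 : ∀ v, -v / S (-v) * Real.exp (-(-v) ^ 2) = -(v / S v * Real.exp (-v ^ 2)) := fun v => by
      simp only [S]; rw [neg_sq]; ring
    simp only [h2, integral_neg] at this
    linarith
  have hfun : (fun v => |h' v| • Real.exp (-(a * h v - b / h v) ^ 2)) =
      fun v => (2 * a)⁻¹ * (Real.exp (-v ^ 2) + v / S v * Real.exp (-v ^ 2)) := by
    ext v; rw [habs, hgh, smul_eq_mul]; simp only [h']; ring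
  constructor
  · have := (integrableOn_image_iff_integrableOn_abs_deriv_smul MeasurableSet.univ hder hinj
      (fun w : ℝ => Real.exp (-(a * w - b / w) ^ 2)))
    rw [himg, hfun, integrableOn_univ] at this
    exact this.2 ((hint.add hodd).const_mul _)
  · have := integral_image_eq_integral_abs_deriv_smul MeasurableSet.univ hder hinj
      (fun w : ℝ => Real.exp (-(a * w - b / w) ^ 2))
    rw [himg, hfun, setIntegral_univ, integral_const_mul, integral_add hint hodd, hodd0] at this
    rw [this]
    have h3 := integral_gaussian 1
    simp only [neg_mul, one_mul, div_one] at h3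
    rw [h3]; field_simp; ring

/-- The subordination formula for `exp (-2ab)`. -/
lemma integral_exp_neg_sq_add_inv_sq {a b : ℝ} (ha : 0 < a) (hb : 0 < b) :
    IntegrableOn (fun w : ℝ => Real.exp (-(a ^ 2 * w ^ 2 + b ^ 2 / w ^ 2))) (Set.Ioi 0) ∧
    ∫ w in Set.Ioi (0 : ℝ), Real.exp (-(a ^ 2 * w ^ 2 + b ^ 2 / w ^ 2)) =
      √Real.pi / (2 * a) * Real.exp (-(2 * a * b)) := by
  obtain ⟨h1, h2⟩ := integral_exp_neg_sq_sub_div ha hb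
  have h3 : Set.EqOn (fun w : ℝ => Real.exp (-(a * w - b / w) ^ 2) * Real.exp (-(2 * a * b)))
      (fun w : ℝ => Real.exp (-(a ^ 2 * w ^ 2 + b ^ 2 / w ^ 2))) (Set.Ioi 0) := fun w hw => by
    have hw : 0 < w := hw
    simp only
    rw [← Real.exp_add]; congr 1; field_simp; ring
  constructor
  · exact IntegrableOn.congr_fun (h1.mul_const _) h3 measurableSet_Ioi
  · rw [← setIntegral_congr_fun measurableSet_Ioi h3, integral_mul_const, h2]

variable {V : Type*} [NormedAddCommGroup V] [InnerProductSpace ℝ V] [FiniteDimensional ℝ V]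
  [MeasurableSpace V] [BorelSpace V] [Nontrivial V]

lemma integrable_norm_rpow_mul_exp_neg {s c : ℝ} (hs : -(Module.finrank ℝ V : ℝ) < s)
    (hc : 0 < c) : Integrable fun ξ : V => ‖ξ‖ ^ s * Real.exp (-(c * ‖ξ‖)) := by
  refine (integrable_fun_norm_addHaar (f := fun r => r ^ s * Real.exp (-(c * r))) volume).2 ?_
  have h := integrableOn_rpow_mul_exp_neg_mul_rpow (p := 1) (b := c)
    (s := s + (Module.finrank ℝ V - 1 : ℕ)) ?_ one_pos hc
  · refine h.congr_fun (fun r hr => ?_) measurableSet_Ioi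
    have hr : 0 < r := hr
    simp only [Real.rpow_one, smul_eq_mul]
    rw [Real.rpow_add hr, Real.rpow_natCast, neg_mul]; ring
  · rw [Nat.cast_sub Module.finrank_pos]; push_cast; linarith

lemma integrable_exp_neg_norm {c : ℝ} (hc : 0 < c) :
    Integrable fun ξ : V => Real.exp (-(c * ‖ξ‖)) := by
  have := integrable_norm_rpow_mul_exp_neg (V := V) (s := 0) (c := c)
    (by simpa using Module.finrank_pos) hc
  simpa using this

lemma integral_exp_neg_sq_mul_inner {w : ℝ} (hw : 0 < w) (x : V) :
    ∫ ξ : V, (Real.exp (-(Real.pi ^ 2 * ‖ξ‖ ^ 2 / w ^ 2)) : ℂ) *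
        Complex.exp (2 * Real.pi * Complex.I * inner ℝ ξ x) =
      (((w ^ 2 / Real.pi) ^ ((Module.finrank ℝ V : ℝ) / 2) * Real.exp (-(w ^ 2 * ‖x‖ ^ 2)) : ℝ) : ℂ)
      := by
  have hπ := Real.pi_pos
  have hb : 0 < ((Real.pi ^ 2 / w ^ 2 : ℝ) : ℂ).re := by rw [Complex.ofReal_re]; positivity
  have h := fourier_gaussian_innerProductSpace hb (-x)
  rw [Real.fourier_eq'] at h
  calc _ = _ := by
        congr 1; ext ξ
        rw [smul_eq_mul, mul_comm, inner_neg_right]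
        congr 1
        · push_cast; ring_nf
        · push_cast; ring_nf
    _ = _ := h
    _ = _ := by
        have e1 : (Real.pi : ℂ) / ((Real.pi ^ 2 / w ^ 2 : ℝ) : ℂ) = ((w ^ 2 / Real.pi : ℝ) : ℂ) := by
          rw [← Complex.ofReal_div]; congr 1; field_simp
        rw [e1, Complex.ofReal_mul, Complex.ofReal_cpow (by positivity)]
        congr 1
        · push_cast; rfl
        · rw [Complex.ofReal_exp]; congr 1
          have : (w:ℂ) ≠ 0 := by exact_mod_cast hw.ne'
          have : (Real.pi:ℂ) ≠ 0 := by exact_mod_cast hπ.ne'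
          push_cast [norm_neg]; field_simp

/-- Subordination writes `exp(-2πa|ξ|)` as a superposition of Gaussians in `ξ`. After Fubini and the
Gaussian Fourier transform, the integral over the parameter `w` is a Gamma integral. -/
lemma integral_poisson_real {a : ℝ} (ha : 0 < a) (x : V) :
    ∫ ξ : V, (Real.exp (-(2 * Real.pi * a * ‖ξ‖)) : ℂ) *
        Complex.exp (2 * Real.pi * Complex.I * inner ℝ ξ x) =
      ((a * Real.Gamma (((Module.finrank ℝ V : ℝ) + 1) / 2) *
        (Real.pi * (a ^ 2 + ‖x‖ ^ 2)) ^ (-(((Module.finrank ℝ V : ℝ) + 1) / 2)) : ℝ) : ℂ) := by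
  have hπ := Real.pi_pos
  set n : ℝ := (Module.finrank ℝ V : ℝ)
  have hn : 0 ≤ n := Nat.cast_nonneg _
  set k : V → ℝ → ℝ := fun ξ w => Real.exp (-(a ^ 2 * w ^ 2 + (Real.pi * ‖ξ‖) ^ 2 / w ^ 2))
  set χ : V → ℂ := fun ξ => Complex.exp (2 * Real.pi * Complex.I * inner ℝ ξ x)
  have hχ : ∀ ξ, ‖χ ξ‖ = 1 := fun ξ => by
    simp only [χ]
    rw [show (2 * Real.pi * Complex.I * inner ℝ ξ x : ℂ) =
      ((2 * Real.pi * inner ℝ ξ x : ℝ) : ℂ) * Complex.I by push_cast; ring,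
      Complex.norm_exp_ofReal_mul_I]
  have hsub : ∀ ξ : V, ξ ≠ 0 → IntegrableOn (k ξ) (Set.Ioi 0) ∧
      ∫ w in Set.Ioi (0 : ℝ), k ξ w =
        √Real.pi / (2 * a) * Real.exp (-(2 * Real.pi * a * ‖ξ‖)) := fun ξ hξ => by
    have := integral_exp_neg_sq_add_inv_sq ha (mul_pos hπ (norm_pos_iff.2 hξ))
    refine ⟨this.1, this.2.trans ?_⟩
    ring_nf
  have hne : ∀ᵐ ξ : V, ξ ≠ 0 := by simp [ae_iff]
  have hmeas : Measurable fun p : V × ℝ => χ p.1 * (k p.1 p.2 : ℂ) := by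
    simp only [k, χ]; fun_prop
  have hint : Integrable (fun p : V × ℝ => χ p.1 * (k p.1 p.2 : ℂ))
      ((volume : Measure V).prod (volume.restrict (Set.Ioi 0))) := by
    refine (integrable_prod_iff hmeas.aestronglyMeasurable).2 ⟨?_, ?_⟩
    · filter_upwards [hne] with ξ hξ
      exact (hsub ξ hξ).1.ofReal.const_mul _
    · refine ((integrable_exp_neg_norm (V := V) (c := 2 * Real.pi * a)
        (by positivity)).const_mul (√Real.pi / (2 * a))).congr ?_
      filter_upwards [hne] with ξ hξ
      rw [← (hsub ξ hξ).2]
      congr 1; ext w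
      rw [norm_mul, hχ, one_mul, Complex.norm_real, Real.norm_of_nonneg (Real.exp_pos _).le]
  have hswap := integral_integral_swap (f := fun ξ w => χ ξ * (k ξ w : ℂ)) hint
  have hL : ∫ ξ, (∫ w in Set.Ioi (0 : ℝ), χ ξ * (k ξ w : ℂ)) =
      ((√Real.pi / (2 * a) : ℝ) : ℂ) * ∫ ξ : V, (Real.exp (-(2 * Real.pi * a * ‖ξ‖)) : ℂ) * χ ξ := by
    rw [← integral_const_mul]
    refine integral_congr_ae ?_
    filter_upwards [hne] with ξ hξ
    rw [integral_const_mul, integral_complex_ofReal, (hsub ξ hξ).2]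
    push_cast; ring
  have hR : ∫ w in Set.Ioi (0 : ℝ), (∫ ξ : V, χ ξ * (k ξ w : ℂ)) =
      ((Real.pi ^ (-(n / 2)) * ((a ^ 2 + ‖x‖ ^ 2) ^ (-(n + 1) / 2) * (1 / 2) *
        Real.Gamma ((n + 1) / 2)) : ℝ) : ℂ) := by
    have h1 := integral_rpow_mul_exp_neg_mul_rpow (p := 2) (q := n) (b := a ^ 2 + ‖x‖ ^ 2)
      two_pos (by linarith) (by positivity)
    rw [← h1, ← integral_const_mul, ← integral_complex_ofReal]
    refine setIntegral_congr_fun measurableSet_Ioi fun w hw => ?_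
    have hw : 0 < w := hw
    have h2 : ∀ ξ : V, χ ξ * (k ξ w : ℂ) = (Real.exp (-(a ^ 2 * w ^ 2)) : ℂ) *
        ((Real.exp (-(Real.pi ^ 2 * ‖ξ‖ ^ 2 / w ^ 2)) : ℂ) * χ ξ) := fun ξ => by
      simp only [k]
      rw [← mul_assoc, ← Complex.ofReal_mul, ← Real.exp_add, mul_comm]
      congr 4; ring
    simp only [h2, integral_const_mul]
    rw [integral_exp_neg_sq_mul_inner hw x, ← Complex.ofReal_mul]
    congr 1
    rw [Real.div_rpow (by positivity) hπ.le, Real.rpow_neg hπ.le, ← Real.rpow_natCast w 2,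
      ← Real.rpow_mul hw.le]
    have e : -(a ^ 2 + ‖x‖ ^ 2) * w ^ (2 : ℝ) = -(a ^ 2 * w ^ 2) + -(w ^ 2 * ‖x‖ ^ 2) := by
      rw [Real.rpow_two]; ring
    rw [e, Real.exp_add, show ((2 : ℕ) : ℝ) * (n / 2) = n by push_cast; ring]
    simp only [Real.rpow_natCast]
    field_simp
    rfl
  rw [hL, hR] at hswap
  have hs : ((√Real.pi / (2 * a) : ℝ) : ℂ) ≠ 0 := by
    exact_mod_cast (div_pos (Real.sqrt_pos.2 hπ) (by positivity)).ne'
  refine mul_left_cancel₀ hs (hswap.trans ?_)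
  rw [← Complex.ofReal_mul]
  congr 1
  have hA : 0 < a ^ 2 + ‖x‖ ^ 2 := by positivity
  rw [Real.mul_rpow hπ.le hA.le, neg_div]
  have : Real.pi ^ (-(n / 2)) = √Real.pi * Real.pi ^ (-((n + 1) / 2)) := by
    rw [Real.sqrt_eq_rpow, ← Real.rpow_add hπ]; congr 1; ring
  rw [this]; field_simp

/-- Differentiation under the integral sign: the factor `ρ` it produces is absorbed by a fraction of
the exponential decay. -/
lemma differentiableOn_laplace {α : Type*} [MeasurableSpace α] {μ : Measure α} {g : α → ℂ}
    {ρ : α → ℝ} (hρm : Measurable ρ) (hρ : ∀ᵐ x ∂μ, 0 ≤ ρ x) (hg : AEStronglyMeasurable g μ)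
    (hint : ∀ c : ℝ, 0 < c → Integrable (fun x => Real.exp (-(c * ρ x)) * ‖g x‖) μ) :
    DifferentiableOn ℂ (fun z : ℂ => ∫ x, Complex.exp (-(z * ρ x)) * g x ∂μ) {z | 0 < z.re} := by
  intro z₀ hz₀
  have hz₀ : 0 < z₀.re := hz₀
  -- On `Re z > 2c` the derivative is dominated by `ρ exp(-2cρ) ≤ c⁻¹ exp(-cρ)`, since `cρ ≤
  -- exp(cρ)`.
  set c := z₀.re / 3
  have hc : 0 < c := by positivity
  have hmeas : ∀ z : ℂ, AEStronglyMeasurable (fun x => Complex.exp (-(z * ρ x)) * g x) μ :=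
    fun z => ((by fun_prop : Measurable fun x => Complex.exp (-(z * ρ x)))
      |>.aestronglyMeasurable).mul hg
  have hnorm : ∀ (z : ℂ) (r : ℝ), ‖Complex.exp (-(z * r))‖ = Real.exp (-(z.re * r)) := fun z r => by
    rw [Complex.norm_exp]; simp
  refine DifferentiableAt.differentiableWithinAt (HasDerivAt.differentiableAt
    (hasDerivAt_integral_of_dominated_loc_of_deriv_le (s := {z : ℂ | 2 * c < z.re})
      (F' := fun z x => -(ρ x : ℂ) * (Complex.exp (-(z * ρ x)) * g x))
      (bound := fun x => c⁻¹ * (Real.exp (-(c * ρ x)) * ‖g x‖)) ?_ ?_ ?_ ?_ ?_ ?_ ?_).2)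
  · exact (isOpen_lt continuous_const Complex.continuous_re).mem_nhds
      (show 2 * (z₀.re / 3) < z₀.re by linarith)
  · exact Eventually.of_forall hmeas
  · refine (hint z₀.re hz₀).mono' (hmeas z₀) (ae_of_all _ fun x => ?_)
    rw [norm_mul, hnorm]
  · exact ((by fun_prop : Measurable fun x => -(ρ x : ℂ)).aestronglyMeasurable).mul (hmeas z₀)
  · filter_upwards [hρ] with x hx z hz
    have hz : 2 * c < z.re := hz
    rw [norm_mul, norm_mul, hnorm, norm_neg, Complex.norm_real, Real.norm_of_nonneg hx,
      ← mul_assoc, ← mul_assoc]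
    refine mul_le_mul_of_nonneg_right ?_ (norm_nonneg _)
    have h1 : c * ρ x ≤ Real.exp (c * ρ x) := by linarith [Real.add_one_le_exp (c * ρ x)]
    have h2 : Real.exp (-(z.re * ρ x)) ≤ Real.exp (-(2 * c * ρ x)) := by
      apply Real.exp_le_exp.2; nlinarith
    calc ρ x * Real.exp (-(z.re * ρ x)) ≤ ρ x * Real.exp (-(2 * c * ρ x)) := by gcongr
      _ = c⁻¹ * ((c * ρ x) * Real.exp (-(2 * c * ρ x))) := by field_simp
      _ ≤ c⁻¹ * (Real.exp (c * ρ x) * Real.exp (-(2 * c * ρ x))) := by gcongr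
      _ = _ := by rw [← Real.exp_add]; congr 2; ring
  · exact (hint c hc).const_mul _
  · refine ae_of_all _ fun x z _ => ?_
    have h1 : HasDerivAt (fun z : ℂ => -(z * ρ x)) (-(ρ x : ℂ)) z := by
      convert! ((hasDerivAt_id z).mul_const (ρ x : ℂ)).neg using 1
      simp
    convert! h1.cexp.mul_const (g x) using 1
    ring

/-- Identity theorem on the connected right half plane: the positive reals accumulate at `1`. -/
lemma eqOn_re_pos {f g : ℂ → ℂ} (hf : DifferentiableOn ℂ f {z | 0 < z.re})
    (hg : DifferentiableOn ℂ g {z | 0 < z.re}) (h : ∀ a : ℝ, 0 < a → f a = g a) {z : ℂ}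
    (hz : 0 < z.re) : f z = g z := by
  have ho : IsOpen {z : ℂ | 0 < z.re} := isOpen_lt continuous_const Complex.continuous_re
  refine (hf.analyticOnNhd ho).eqOn_of_preconnected_of_frequently_eq (hg.analyticOnNhd ho)
    (convex_halfSpace_re_gt 0).isPreconnected (z₀ := 1) (by simp) ?_ hz
  have h1 : Tendsto (fun a : ℝ => (a : ℂ)) (𝓝[≠] 1) (𝓝[≠] 1) := by
    refine tendsto_nhdsWithin_iff.2 ⟨?_, ?_⟩
    · exact (Complex.continuous_ofReal.tendsto' 1 1 (by simp)).mono_left nhdsWithin_le_nhds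
    · filter_upwards [self_mem_nhdsWithin] with a ha
      simpa using ha
  refine h1.frequently (Eventually.frequently ?_)
  filter_upwards [nhdsWithin_le_nhds (lt_mem_nhds one_pos)] with a ha using h a ha

/-- Keeps the principal branch of the power in the Poisson kernel holomorphic throughout the right
half plane. -/
lemma sq_add_sq_mem_slitPlane {z : ℂ} (hz : 0 < z.re) (r : ℝ) :
    z ^ 2 + (r : ℂ) ^ 2 ∈ Complex.slitPlane := by
  rw [Complex.mem_slitPlane_iff]
  by_cases h : z.im = 0
  · left; simp only [pow_two, Complex.add_re, Complex.mul_re, Complex.ofReal_re,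
      Complex.ofReal_im, h]; nlinarith [mul_self_nonneg r]
  · right; simp only [pow_two, Complex.add_im, Complex.mul_im, Complex.ofReal_re,
      Complex.ofReal_im]
    rw [show z.re * z.im + z.im * z.re + (r * 0 + 0 * r) = 2 * (z.re * z.im) by ring]
    exact mul_ne_zero two_ne_zero (mul_ne_zero hz.ne' h)

/-- The Poisson kernel of the half-space at complex heights. -/
lemma integral_poisson {z : ℂ} (hz : 0 < z.re) (x : V) :
    ∫ ξ : V, Complex.exp (-(z * (2 * Real.pi * ‖ξ‖ : ℝ))) *
        Complex.exp (2 * Real.pi * Complex.I * inner ℝ ξ x) =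
      z * Real.Gamma (((Module.finrank ℝ V : ℝ) + 1) / 2) *
        ((Real.pi : ℂ) ^ (-(((Module.finrank ℝ V : ℝ) + 1) / 2) : ℂ) *
        (z ^ 2 + (‖x‖ : ℂ) ^ 2) ^ (-(((Module.finrank ℝ V : ℝ) + 1) / 2) : ℂ)) := by
  have hπ := Real.pi_pos
  refine eqOn_re_pos (f := fun z => ∫ ξ : V, Complex.exp (-(z * (2 * Real.pi * ‖ξ‖ : ℝ))) *
        Complex.exp (2 * Real.pi * Complex.I * inner ℝ ξ x))
    (g := fun z => z * Real.Gamma (((Module.finrank ℝ V : ℝ) + 1) / 2) *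
        ((Real.pi : ℂ) ^ (-(((Module.finrank ℝ V : ℝ) + 1) / 2) : ℂ) *
        (z ^ 2 + (‖x‖ : ℂ) ^ 2) ^ (-(((Module.finrank ℝ V : ℝ) + 1) / 2) : ℂ))) ?_ ?_ ?_ hz
  · refine differentiableOn_laplace (by fun_prop) (ae_of_all _ fun ξ => by positivity)
      (by fun_prop : Measurable _).aestronglyMeasurable fun c hc => ?_
    refine (integrable_exp_neg_norm (V := V) (c := c * (2 * Real.pi)) (by positivity)).congr
      (ae_of_all _ fun ξ => ?_)
    beta_reduce
    rw [show (2 * Real.pi * Complex.I * inner ℝ ξ x : ℂ) =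
      ((2 * Real.pi * inner ℝ ξ x : ℝ) : ℂ) * Complex.I by push_cast; ring,
      Complex.norm_exp_ofReal_mul_I, mul_one, mul_assoc c]
  · intro z hz
    refine DifferentiableAt.differentiableWithinAt ?_
    refine (differentiableAt_id.mul_const _).mul (DifferentiableAt.const_mul ?_ _)
    exact DifferentiableAt.cpow (by fun_prop) (by fun_prop) (sq_add_sq_mem_slitPlane hz _)
  · intro a ha
    have h := integral_poisson_real (V := V) ha x
    have hA : 0 < a ^ 2 + ‖x‖ ^ 2 := by positivity
    rw [Real.mul_rpow hπ.le hA.le, Complex.ofReal_mul, Complex.ofReal_mul, Complex.ofReal_mul,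
      Complex.ofReal_cpow hA.le, Complex.ofReal_cpow hπ.le] at h
    convert h using 1
    · congr 1; ext ξ
      rw [Complex.ofReal_exp]; congr 2; push_cast; ring
    · push_cast; rfl

/-- Both sides are holomorphic in `z`, and for real `z` this is Euler's integral. -/
lemma integral_rpow_mul_cexp_neg_mul {m : ℝ} (hm : -1 < m) {z : ℂ} (hz : 0 < z.re) :
    ∫ κ in Set.Ioi (0 : ℝ), Complex.exp (-(z * κ)) * ((κ ^ m : ℝ) : ℂ) =
      Real.Gamma (m + 1) * z ^ (-(m + 1) : ℂ) := by
  refine eqOn_re_pos (f := fun z => ∫ κ in Set.Ioi (0 : ℝ), Complex.exp (-(z * κ)) *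
    ((κ ^ m : ℝ) : ℂ)) (g := fun z => Real.Gamma (m + 1) * z ^ (-(m + 1) : ℂ)) ?_ ?_ ?_ hz
  · refine differentiableOn_laplace measurable_id ?_
      (by fun_prop : Measurable _).aestronglyMeasurable fun c hc => ?_
    · filter_upwards [ae_restrict_mem measurableSet_Ioi] with κ hκ using le_of_lt hκ
    · refine IntegrableOn.congr_fun (integrableOn_rpow_mul_exp_neg_mul_rpow hm one_pos hc)
        (fun κ hκ => ?_) measurableSet_Ioi
      have hκ : 0 < κ := hκ
      simp only [Real.rpow_one, Complex.norm_real]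
      rw [Real.norm_of_nonneg (by positivity), neg_mul, mul_comm]
  · intro z hz
    refine DifferentiableAt.differentiableWithinAt (DifferentiableAt.const_mul ?_ _)
    exact DifferentiableAt.cpow (by fun_prop) (by fun_prop) (Or.inl hz)
  · intro a ha
    have h := Real.integral_rpow_mul_exp_neg_mul_Ioi (a := m + 1) (by linarith) ha
    have h2 : ∫ κ in Set.Ioi (0 : ℝ), Complex.exp (-((a : ℂ) * κ)) * ((κ ^ m : ℝ) : ℂ) =
        ((∫ κ in Set.Ioi (0 : ℝ), κ ^ (m + 1 - 1) * Real.exp (-(a * κ)) : ℝ) : ℂ) := by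
      rw [← integral_complex_ofReal]
      refine setIntegral_congr_fun measurableSet_Ioi fun κ hκ => ?_
      simp only [add_sub_cancel_right]
      push_cast; rw [mul_comm]
    rw [h2, h, one_div, Real.inv_rpow ha.le, ← Real.rpow_neg ha.le, mul_comm, Complex.ofReal_mul,
      Complex.ofReal_cpow ha.le]
    push_cast; rfl

end PoissonKernel

/-! ### An explicit half wave and its limit along rays -/

section PoissonWave

variable {d : ℕ}

/-- The solution at time `t` of the half wave equation with the data whose Fourier transform is
`exp (-2π|ξ|) exp (-2πi⟨ξ, y⟩)`. -/
def poissonWave (y : EuclideanSpace ℝ (Fin d)) (t : ℝ) (x : EuclideanSpace ℝ (Fin d)) : ℂ :=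
  (1 + t * Complex.I) * Real.Gamma (((d : ℝ) + 1) / 2) *
    ((Real.pi : ℂ) ^ ((-(((d : ℝ) + 1) / 2) : ℝ) : ℂ) *
      ((1 + t * Complex.I) ^ 2 + (‖x - y‖ : ℂ) ^ 2) ^ ((-(((d : ℝ) + 1) / 2) : ℝ) : ℂ))

/-- `poissonWave` along the ray in the direction `θ`, at the distance `t + s`. -/
def poissonWaveRay (y : EuclideanSpace ℝ (Fin d)) (t : ℝ) (θ : EuclideanSpace ℝ (Fin d))
    (s : ℝ) : ℂ :=
  if 0 < t + s then (((t + s) ^ (((d : ℝ) - 1) / 2) : ℝ) : ℂ) * poissonWave y t ((t + s) • θ)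
  else 0

/-- The radiation profile of `poissonWave`. -/
def poissonProfile (y θ : EuclideanSpace ℝ (Fin d)) (s : ℝ) : ℂ :=
  Complex.exp (-(Complex.I * (((d : ℝ) - 1) / 4 * Real.pi : ℝ))) *
    (Real.Gamma (((d : ℝ) + 1) / 2) * (((2 * Real.pi : ℝ) : ℂ) *
      (1 - Complex.I * ((s - inner ℝ θ y : ℝ) : ℂ))) ^ ((-(((d : ℝ) + 1) / 2) : ℝ) : ℂ))

lemma ofReal_mul_cpow {r : ℝ} (hr : 0 < r) {z : ℂ} (hz : z ≠ 0) (c : ℂ) :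
    ((r : ℂ) * z) ^ c = (r : ℂ) ^ c * z ^ c := by
  have hr' : (r : ℂ) ≠ 0 := by exact_mod_cast hr.ne'
  rw [Complex.cpow_def_of_ne_zero (mul_ne_zero hr' hz), Complex.cpow_def_of_ne_zero hr',
    Complex.cpow_def_of_ne_zero hz, Complex.log_ofReal_mul hr hz, ← Complex.ofReal_log hr.le,
    add_mul, Complex.exp_add]

/-- The left side is `(ρ - t + i)(ρ + t - i)`. Near the light cone `ρ - t` stays bounded, and `ρ +
t`, of size `2t`, carries the decay. -/
lemma one_add_mul_I_sq_add_sq {ρ t : ℝ} (h : ρ + t ≠ 0) :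
    (1 + t * Complex.I) ^ 2 + (ρ : ℂ) ^ 2 = ((ρ + t : ℝ) : ℂ) *
      ((((ρ - t : ℝ) : ℂ) + Complex.I) * (1 - Complex.I / ((ρ + t : ℝ) : ℂ))) := by
  have h' : ((ρ + t : ℝ) : ℂ) ≠ 0 := by exact_mod_cast h
  field_simp
  push_cast
  linear_combination (t ^ 2 + 1) * Complex.I_sq

lemma le_norm_one_add_mul_I_sq_add_sq {ρ t : ℝ} (h : 0 < ρ + t) :
    (ρ + t) * ‖((ρ - t : ℝ) : ℂ) + Complex.I‖ ≤ ‖(1 + t * Complex.I) ^ 2 + (ρ : ℂ) ^ 2‖ := by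
  rw [one_add_mul_I_sq_add_sq h.ne', norm_mul, norm_mul, Complex.norm_real,
    Real.norm_of_nonneg h.le, ← mul_assoc]
  refine le_mul_of_one_le_right (by positivity) ?_
  have := Complex.abs_re_le_norm (1 - Complex.I / ((ρ + t : ℝ) : ℂ))
  rw [Complex.sub_re, Complex.div_ofReal_re, Complex.I_re, zero_div, sub_zero, Complex.one_re,
    abs_one] at this
  exact this

lemma abs_norm_smul_sub_sub_le {θ y : EuclideanSpace ℝ (Fin d)} (hθ : ‖θ‖ = 1) {r : ℝ}
    (hr : 0 ≤ r) : |‖r • θ - y‖ - r| ≤ ‖y‖ := by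
  have h1 : ‖r • θ‖ = r := by rw [norm_smul, hθ, mul_one, Real.norm_of_nonneg hr]
  have h2 := abs_norm_sub_norm_le (r • θ - y) (r • θ)
  rwa [h1, show r • θ - y - r • θ = -y by abel, norm_neg] at h2

/-- With `ρ` the distance from `(t+s)θ` to `y`, the powers of `ρ + t` are `(d-1)/2` from the weight,
`1` from the prefactor and `-(d+1)/2` from the kernel; they cancel. What remains is `|ρ - t +
i|^(-(d+1)/2)`, comparable to a power of `1 + |s|` since `ρ - t` differs from `s` by at most `|y|`.
-/
lemma exists_poissonWaveRay_le (hd : 1 ≤ d) (y : EuclideanSpace ℝ (Fin d)) :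
    ∃ C : ℝ, 0 ≤ C ∧ ∀ t : ℝ, 1 ≤ t → ∀ θ : EuclideanSpace ℝ (Fin d), ‖θ‖ = 1 → ∀ s : ℝ,
      ‖poissonWaveRay y t θ s‖ ≤ C * (1 + |s|) ^ (-(((d : ℝ) + 1) / 2)) := by
  have hd' : (1 : ℝ) ≤ d := by exact_mod_cast hd
  have hπ := Real.pi_pos
  set M : ℝ := ((d : ℝ) + 1) / 2
  set m : ℝ := ((d : ℝ) - 1) / 2
  have hM : M = m + 1 := by simp only [M, m]; ring
  have hm : 0 ≤ m := by simp only [m]; linarith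
  have hΓ : 0 < Real.Gamma M := Real.Gamma_pos_of_pos (by linarith)
  set Y := 1 + ‖y‖
  have hY : 1 ≤ Y := by simp only [Y]; linarith [norm_nonneg y]
  refine ⟨Real.Gamma M * Real.pi ^ (-M) * 2 * Y ^ m * (2 * Y) ^ M, by positivity,
    fun t ht θ hθ s => ?_⟩
  by_cases hr : 0 < t + s
  swap
  · rw [poissonWaveRay, if_neg hr, norm_zero]; positivity
  rw [poissonWaveRay, if_pos hr]
  have h1 := abs_le.1 (abs_norm_smul_sub_sub_le (y := y) hθ hr.le)
  set ρ := ‖(t + s) • θ - y‖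
  have hρ : 0 ≤ ρ := norm_nonneg _
  have hρt : 0 < ρ + t := by linarith
  set N := ‖((ρ - t : ℝ) : ℂ) + Complex.I‖
  have hN1 : 1 ≤ N := by
    have := Complex.abs_im_le_norm (((ρ - t : ℝ) : ℂ) + Complex.I)
    simpa [N] using this
  have hNr : |ρ - t| ≤ N := by
    have := Complex.abs_re_le_norm (((ρ - t : ℝ) : ℂ) + Complex.I)
    simpa [N] using this
  have hs : 1 + |s| ≤ 2 * Y * N := by
    have h2 : |s| ≤ |ρ - t| + ‖y‖ := by
      rw [abs_le]; constructor <;> linarith [neg_abs_le (ρ - t), le_abs_self (ρ - t)]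
    have h3 : ‖y‖ ≤ ‖y‖ * N := le_mul_of_one_le_right (norm_nonneg _) hN1
    have h4 : 0 ≤ ‖y‖ * N := by positivity
    simp only [Y]; linarith
  have hA := le_norm_one_add_mul_I_sq_add_sq hρt
  rw [poissonWave, norm_mul, norm_mul, norm_mul, norm_mul, Complex.norm_cpow_real,
    Complex.norm_cpow_real, Complex.norm_real, Complex.norm_real, Complex.norm_real,
    Real.norm_of_nonneg hπ.le, Real.norm_of_nonneg hΓ.le, Real.norm_of_nonneg (by positivity)]
  have e1 : (t + s) ^ m ≤ Y ^ m * (ρ + t) ^ m := by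
    rw [← Real.mul_rpow (by positivity) hρt.le]
    refine Real.rpow_le_rpow hr.le ?_ hm
    have : ‖y‖ ≤ ‖y‖ * (ρ + t) := le_mul_of_one_le_right (norm_nonneg _) (by linarith)
    simp only [Y]; linarith
  have e2 : ‖1 + (t : ℂ) * Complex.I‖ ≤ 2 * (ρ + t) := by
    refine (norm_add_le _ _).trans ?_
    rw [norm_one, norm_mul, Complex.norm_I, mul_one, Complex.norm_real,
      Real.norm_of_nonneg (by linarith)]
    linarith
  have e3 : ‖(1 + (t : ℂ) * Complex.I) ^ 2 + (ρ : ℂ) ^ 2‖ ^ (-M) ≤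
      (ρ + t) ^ (-M) * ((2 * Y) ^ M * (1 + |s|) ^ (-M)) := by
    have hs0 : 0 < 1 + |s| := by positivity
    have e4 : (2 * Y) ^ M * (1 + |s|) ^ (-M) = ((1 + |s|) / (2 * Y)) ^ (-M) := by
      rw [Real.div_rpow hs0.le (by positivity), Real.rpow_neg (by positivity : 0 ≤ 2 * Y),
        div_inv_eq_mul, mul_comm]
    rw [e4, ← Real.mul_rpow hρt.le (by positivity)]
    refine Real.rpow_le_rpow_of_nonpos (by positivity) (le_trans ?_ hA) (by linarith)
    refine mul_le_mul_of_nonneg_left ?_ hρt.le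
    rw [div_le_iff₀ (by positivity)]; linarith
  have e5 : (ρ + t) ^ m * (ρ + t) * (ρ + t) ^ (-M) = 1 := by
    rw [← Real.rpow_add_one hρt.ne', ← hM, ← Real.rpow_add hρt, add_neg_cancel, Real.rpow_zero]
  calc _ ≤ (Y ^ m * (ρ + t) ^ m) * (2 * (ρ + t) * Real.Gamma M * (Real.pi ^ (-M) *
        ((ρ + t) ^ (-M) * ((2 * Y) ^ M * (1 + |s|) ^ (-M))))) := by gcongr
    _ = (Real.Gamma M * Real.pi ^ (-M) * 2 * Y ^ m * (2 * Y) ^ M * (1 + |s|) ^ (-M)) *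
        ((ρ + t) ^ m * (ρ + t) * (ρ + t) ^ (-M)) := by ring
    _ = _ := by rw [e5, mul_one]

/-- The argument of `z` lies in `[0, π]`, so subtracting `π/2` stays within the principal range. -/
lemma neg_I_mul_cpow {z : ℂ} (hz : 0 < z.im) (c : ℂ) :
    (-Complex.I * z) ^ c = Complex.exp (-(Real.pi / 2) * Complex.I * c) * z ^ c := by
  have hz0 : z ≠ 0 := fun h => by simp [h] at hz
  have hI : -Complex.I ≠ 0 := neg_ne_zero.2 Complex.I_ne_zero
  have harg : 0 ≤ z.arg := Complex.arg_nonneg_iff.2 hz.le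
  have h1 : Complex.log (-Complex.I * z) = Complex.log (-Complex.I) + Complex.log z := by
    refine Complex.log_mul hI hz0 ?_
    rw [Complex.arg_neg_I]
    constructor <;> linarith [Complex.arg_le_pi z, Real.pi_pos]
  rw [Complex.cpow_def_of_ne_zero (mul_ne_zero hI hz0), h1, Complex.log_neg_I, add_mul,
    Complex.exp_add, Complex.cpow_def_of_ne_zero hz0]

/-- With `σ = s - ⟨θ, y⟩`, write `1 - iσ = -i(σ + i)`. The phase `exp(iπ(d+1)/4)` from the power of
`-i` and the phase `exp(-iπ(d-1)/4)` of the profile multiply to `i`. -/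
lemma poissonProfile_eq (y θ : EuclideanSpace ℝ (Fin d)) (s : ℝ) :
    poissonProfile y θ s = (Real.Gamma (((d : ℝ) + 1) / 2) *
      (2 * Real.pi : ℝ) ^ ((-(((d : ℝ) + 1) / 2) : ℝ) : ℂ)) * (Complex.I *
      (((s - inner ℝ θ y : ℝ) : ℂ) + Complex.I) ^ ((-(((d : ℝ) + 1) / 2) : ℝ) : ℂ)) := by
  set σ : ℝ := s - inner ℝ θ y
  have e1 : (1 - Complex.I * (σ : ℂ)) = -Complex.I * ((σ : ℂ) + Complex.I) := by
    linear_combination Complex.I_sq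
  have him : 0 < ((σ : ℂ) + Complex.I).im := by simp
  have hne : -Complex.I * ((σ : ℂ) + Complex.I) ≠ 0 :=
    mul_ne_zero (neg_ne_zero.2 Complex.I_ne_zero) fun h => by simp [h] at him
  have e2 : Complex.exp (-(Complex.I * (((d : ℝ) - 1) / 4 * Real.pi : ℝ))) *
      Complex.exp (-(Real.pi / 2) * Complex.I * ((-(((d : ℝ) + 1) / 2) : ℝ) : ℂ)) =
      Complex.I := by
    rw [← Complex.exp_add]
    refine (congrArg Complex.exp ?_).trans Complex.exp_pi_div_two_mul_I
    push_cast; ring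
  rw [poissonProfile, e1, ofReal_mul_cpow (by positivity) hne, neg_I_mul_cpow him]
  linear_combination (Real.Gamma (((d : ℝ) + 1) / 2) *
      ((2 * Real.pi : ℝ) : ℂ) ^ ((-(((d : ℝ) + 1) / 2) : ℝ) : ℂ)) *
      ((σ : ℂ) + Complex.I) ^ ((-(((d : ℝ) + 1) / 2) : ℝ) : ℂ) * e2

/-- In the factorised kernel, `ρ - t → s - ⟨θ, y⟩` while `t/(ρ+t)` and `(t+s)/(ρ+t)` tend to `1/2`;
the powers of `1/2` combine with those of `π` into a power of `2π`. -/
lemma tendsto_poissonWaveRay (y : EuclideanSpace ℝ (Fin d)) {θ : EuclideanSpace ℝ (Fin d)}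
    (hθ : ‖θ‖ = 1) (s : ℝ) :
    Tendsto (fun t => poissonWaveRay y t θ s) atTop (𝓝 (poissonProfile y θ s)) := by
  have hπ := Real.pi_pos
  set M : ℝ := ((d : ℝ) + 1) / 2 with hMdef
  set m : ℝ := ((d : ℝ) - 1) / 2 with hmdef
  have hM : M = m + 1 := by simp only [M, m]; ring
  set p : ℝ := inner ℝ θ y with hp
  set ρ : ℝ → ℝ := fun t => ‖(t + s) • θ - y‖ with hρdef
  have hρ : ∀ t, 0 ≤ ρ t := fun t => norm_nonneg _
  have hpos : ∀ᶠ t : ℝ in atTop, 0 < t ∧ 0 < t + s := by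
    filter_upwards [eventually_gt_atTop 0, eventually_gt_atTop (-s)] with t h1 h2
    exact ⟨h1, by linarith⟩
  have hρsq : ∀ t, ρ t ^ 2 = (t + s) ^ 2 - 2 * (t + s) * p + ‖y‖ ^ 2 := fun t => by
    simp only [hρdef]
    rw [norm_sub_sq_real, norm_smul, hθ, mul_one, Real.norm_eq_abs, sq_abs, real_inner_smul_left]
    ring
  have hinv : Tendsto (fun t => (ρ t + t)⁻¹) atTop (𝓝 0) := by
    refine squeeze_zero' ?_ ?_ tendsto_inv_atTop_zero
    · filter_upwards [hpos] with t ht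
      have := hρ t; have := ht.1; positivity
    · filter_upwards [hpos] with t ht
      exact inv_anti₀ ht.1 (by linarith [hρ t])
  have hhalf : Tendsto (fun t => t / (ρ t + t)) atTop (𝓝 (1 / 2)) := by
    have h0 : Tendsto (fun t => (|s| + ‖y‖) / 2 * (ρ t + t)⁻¹) atTop (𝓝 0) := by
      simpa using hinv.const_mul ((|s| + ‖y‖) / 2)
    rw [tendsto_iff_norm_sub_tendsto_zero]
    refine squeeze_zero' (Eventually.of_forall fun _ => norm_nonneg _) ?_ h0
    filter_upwards [hpos] with t ht
    have h1 := abs_le.1 (abs_norm_smul_sub_sub_le (y := y) hθ ht.2.le)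
    have h2 : 0 < ρ t + t := by linarith [hρ t]
    have h3 : t / (ρ t + t) - 1 / 2 = -(ρ t - t) / 2 * (ρ t + t)⁻¹ := by field_simp; ring
    rw [h3, norm_mul, Real.norm_of_nonneg (inv_pos.2 h2).le]
    refine mul_le_mul_of_nonneg_right ?_ (inv_pos.2 h2).le
    rw [norm_div, norm_neg, Real.norm_two, Real.norm_eq_abs]
    refine div_le_div_of_nonneg_right (abs_le.2 ⟨?_, ?_⟩) two_pos.le
    · change -‖y‖ ≤ ρ t - (t + s) ∧ _ at h1; linarith [neg_abs_le s]
    · change _ ∧ ρ t - (t + s) ≤ ‖y‖ at h1; linarith [le_abs_self s]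
  -- Computed as `(ρ² - t²)/(ρ + t)`, where the numerator is linear in `t`.
  have hdiff : Tendsto (fun t => ρ t - t) atTop (𝓝 (s - p)) := by
    have h1 := (hhalf.mul_const (2 * s - 2 * p)).add
      (hinv.const_mul (s ^ 2 - 2 * s * p + ‖y‖ ^ 2))
    rw [show 1 / 2 * (2 * s - 2 * p) + (s ^ 2 - 2 * s * p + ‖y‖ ^ 2) * 0 = s - p by ring] at h1
    refine h1.congr' ?_
    filter_upwards [hpos] with t ht
    have h2 : 0 < ρ t + t := by linarith [hρ t]
    field_simp
    linear_combination -hρsq t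
  have hq : Tendsto (fun t => (t + s) / (ρ t + t)) atTop (𝓝 (1 / 2)) := by
    have h1 := hhalf.add (hinv.const_mul s)
    rw [mul_zero, add_zero] at h1
    exact h1.congr fun t => by rw [add_div, div_eq_mul_inv s]
  have hinvC : Tendsto (fun t => (((ρ t + t)⁻¹ : ℝ) : ℂ)) atTop (𝓝 0) := by
    exact (Complex.continuous_ofReal.tendsto' 0 0 Complex.ofReal_zero).comp hinv
  have hfac : Tendsto (fun t => (((ρ t + t)⁻¹ : ℝ) : ℂ) + ((t / (ρ t + t) : ℝ) : ℂ) * Complex.I)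
      atTop (𝓝 (0 + ((1 / 2 : ℝ) : ℂ) * Complex.I)) :=
    hinvC.add (((Complex.continuous_ofReal.tendsto _).comp hhalf).mul_const _)
  have hslit : (((s - p : ℝ) : ℂ) + Complex.I) * (1 - Complex.I * 0) ∈ Complex.slitPlane := by
    rw [mul_zero, sub_zero, mul_one, Complex.mem_slitPlane_iff]; right; simp
  have hpow := (((Complex.continuous_ofReal.tendsto _).comp hdiff).add_const Complex.I).mul
    ((hinvC.const_mul Complex.I).const_sub 1)
  have hpow2 := (continuousAt_cpow_const (b := ((-M : ℝ) : ℂ)) hslit).tendsto.comp hpow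
  have hqm : Tendsto (fun t => ((((t + s) / (ρ t + t)) ^ m : ℝ) : ℂ)) atTop
      (𝓝 (((1 / 2 : ℝ) ^ m : ℝ) : ℂ)) :=
    (Complex.continuous_ofReal.tendsto _).comp (hq.rpow_const (Or.inl (by norm_num)))
  have hall := ((hqm.mul hfac).const_mul
    ((Real.Gamma M : ℂ) * (Real.pi : ℂ) ^ ((-M : ℝ) : ℂ))).mul hpow2
  have hlim : poissonProfile y θ s = (Real.Gamma M : ℂ) * (Real.pi : ℂ) ^ ((-M : ℝ) : ℂ) *
      ((((1 / 2 : ℝ) ^ m : ℝ) : ℂ) * (0 + ((1 / 2 : ℝ) : ℂ) * Complex.I)) *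
      ((((s - p : ℝ) : ℂ) + Complex.I) * (1 - Complex.I * 0)) ^ ((-M : ℝ) : ℂ) := by
    have e : (((1 / 2 : ℝ) ^ m : ℝ) : ℂ) * ((1 / 2 : ℝ) : ℂ) = ((2 : ℝ) : ℂ) ^ ((-M : ℝ) : ℂ) := by
      rw [← Complex.ofReal_mul, ← Complex.ofReal_cpow two_pos.le,
        ← Real.rpow_add_one (by norm_num), ← hM, Real.rpow_neg two_pos.le, one_div,
        Real.inv_rpow two_pos.le]
    have hne : ((Real.pi : ℝ) : ℂ) ≠ 0 := by exact_mod_cast hπ.ne'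
    rw [poissonProfile_eq, Complex.ofReal_mul, ofReal_mul_cpow two_pos hne, ← e, mul_zero,
      sub_zero, mul_one]
    ring
  rw [hlim]
  refine hall.congr' ?_
  filter_upwards [hpos] with t ht
  have h2 : 0 < ρ t + t := by linarith [hρ t]
  have h2c : ((ρ t + t : ℝ) : ℂ) ≠ 0 := by exact_mod_cast h2.ne'
  rw [poissonWaveRay, if_pos ht.2, poissonWave]
  change _ = _ * (_ * ((Real.pi : ℂ) ^ ((-M : ℝ) : ℂ) *
    ((1 + t * Complex.I) ^ 2 + (ρ t : ℂ) ^ 2) ^ ((-M : ℝ) : ℂ)))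
  have hz : (((ρ t - t : ℝ) : ℂ) + Complex.I) * (1 - Complex.I / ((ρ t + t : ℝ) : ℂ)) ≠ 0 := by
    have := le_norm_one_add_mul_I_sq_add_sq h2
    rw [one_add_mul_I_sq_add_sq h2.ne'] at this
    intro h0
    rw [h0, mul_zero, norm_zero] at this
    have h5 := Complex.abs_im_le_norm (((ρ t - t : ℝ) : ℂ) + Complex.I)
    have h6 : (((ρ t - t : ℝ) : ℂ) + Complex.I).im = 1 := by simp
    rw [h6, abs_one] at h5
    nlinarith
  rw [one_add_mul_I_sq_add_sq h2.ne', ofReal_mul_cpow h2 hz]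
  simp only [Function.comp]
  have e1 : ((((t + s) / (ρ t + t)) ^ m : ℝ) : ℂ) * (((ρ t + t)⁻¹ : ℝ) : ℂ) =
      (((t + s) ^ m : ℝ) : ℂ) * ((ρ t + t : ℝ) : ℂ) ^ ((-M : ℝ) : ℂ) := by
    rw [← Complex.ofReal_cpow h2.le, ← Complex.ofReal_mul, ← Complex.ofReal_mul]
    congr 1
    rw [Real.div_rpow ht.2.le h2.le, Real.rpow_neg h2.le, hM, Real.rpow_add_one h2.ne', mul_inv]
    ring
  have e2 : (((ρ t + t)⁻¹ : ℝ) : ℂ) + ((t / (ρ t + t) : ℝ) : ℂ) * Complex.I =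
      (1 + t * Complex.I) * (((ρ t + t)⁻¹ : ℝ) : ℂ) := by
    rw [div_eq_mul_inv]; push_cast; ring
  have e3 : Complex.I * (((ρ t + t)⁻¹ : ℝ) : ℂ) = Complex.I / ((ρ t + t : ℝ) : ℂ) := by
    rw [Complex.ofReal_inv, div_eq_mul_inv]
  rw [e2, e3]
  linear_combination ((Real.Gamma M : ℂ) * (Real.pi : ℂ) ^ ((-M : ℝ) : ℂ) *
    (1 + t * Complex.I) * ((((ρ t - t : ℝ) : ℂ) + Complex.I) *
      (1 - Complex.I / ((ρ t + t : ℝ) : ℂ))) ^ ((-M : ℝ) : ℂ)) * e1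

end PoissonWave

/-! ### `L²` convergence to the profile, and spectra along rays -/

section PoissonLimit

variable {d : ℕ}

lemma measurable_poissonWave (y : EuclideanSpace ℝ (Fin d)) (t : ℝ) :
    Measurable (poissonWave y t) := by
  unfold poissonWave
  refine Measurable.const_mul (Measurable.const_mul ?_ _) _
  exact Measurable.pow_const (by fun_prop) _

lemma measurable_poissonWaveRay (y : EuclideanSpace ℝ (Fin d)) (t : ℝ) :
    Measurable fun p : EuclideanSpace ℝ (Fin d) × ℝ => poissonWaveRay y t p.1 p.2 := by
  unfold poissonWaveRay
  refine Measurable.ite (measurableSet_lt measurable_const (by fun_prop)) ?_ measurable_const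
  exact Measurable.mul (by fun_prop) ((measurable_poissonWave y t).comp (by fun_prop))

lemma measurable_poissonProfile (y : EuclideanSpace ℝ (Fin d)) :
    Measurable fun p : EuclideanSpace ℝ (Fin d) × ℝ => poissonProfile y p.1 p.2 := by
  unfold poissonProfile
  refine Measurable.const_mul (Measurable.const_mul ?_ _) _
  exact Measurable.pow_const (by fun_prop) _

lemma measurable_poissonError (y : EuclideanSpace ℝ (Fin d)) (t : ℝ) :
    Measurable fun p : UnitSphere d × ℝ =>
      poissonWaveRay y t p.1 p.2 - poissonProfile y p.1 p.2 := by
  have hc : Measurable fun p : UnitSphere d × ℝ => ((p.1 : EuclideanSpace ℝ (Fin d)), p.2) := by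
    fun_prop
  have h1 := (measurable_poissonWaveRay y t).comp hc
  have h2 := (measurable_poissonProfile y).comp hc
  exact h1.sub h2

/-- Dominated convergence: the majorant of the square is `(1+|s|)^(-(d+1))` up to a constant,
integrable over the product because the sphere has finite measure. -/
lemma tendsto_lintegral_poissonWaveRay (hd : 1 ≤ d) (y : EuclideanSpace ℝ (Fin d)) :
    Tendsto (fun t : ℝ => ∫⁻ p : UnitSphere d × ℝ,
      ‖poissonWaveRay y t p.1 p.2 - poissonProfile y p.1 p.2‖ₑ ^ 2
        ∂((volume : Measure (EuclideanSpace ℝ (Fin d))).toSphere.prod volume)) atTop (𝓝 0) := by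
  have hd' : (1 : ℝ) ≤ d := by exact_mod_cast hd
  obtain ⟨C, hC, h⟩ := exists_poissonWaveRay_le hd y
  -- The profile inherits the uniform bound as a pointwise limit.
  have hprof : ∀ (θ : EuclideanSpace ℝ (Fin d)), ‖θ‖ = 1 → ∀ s : ℝ,
      ‖poissonProfile y θ s‖ ≤ C * (1 + |s|) ^ (-(((d : ℝ) + 1) / 2)) := fun θ hθ s =>
    le_of_tendsto (tendsto_poissonWaveRay y hθ s).norm
      ((eventually_ge_atTop 1).mono fun t ht => h t ht θ hθ s)
  set b : UnitSphere d × ℝ → ℝ := fun p => (2 * C) ^ 2 * (1 + ‖p.2‖) ^ (-((d : ℝ) + 1))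
  have hb : Integrable b ((volume : Measure (EuclideanSpace ℝ (Fin d))).toSphere.prod volume) := by
    have h1 := integrable_one_add_norm (E := ℝ) (μ := volume) (r := (d : ℝ) + 1)
      (by simp; linarith)
    exact (h1.comp_snd _).const_mul _
  have h0 : (0 : ℝ≥0∞) = ∫⁻ _ : UnitSphere d × ℝ, 0
      ∂((volume : Measure (EuclideanSpace ℝ (Fin d))).toSphere.prod volume) := by simp
  rw [h0]
  refine tendsto_lintegral_filter_of_dominated_convergence (fun p => ENNReal.ofReal (b p))
    ?_ ?_ ?_ ?_
  · refine Eventually.of_forall fun t => Measurable.pow_const (Measurable.enorm ?_) _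
    exact measurable_poissonError y t
  · filter_upwards [eventually_ge_atTop 1] with t ht
    refine ae_of_all _ fun p => ?_
    have hω : ‖(p.1 : EuclideanSpace ℝ (Fin d))‖ = 1 := by simp
    rw [← ofReal_norm, ← ENNReal.ofReal_pow (norm_nonneg _)]
    refine ENNReal.ofReal_le_ofReal ?_
    have h1 := (norm_sub_le (poissonWaveRay y t p.1 p.2) (poissonProfile y p.1 p.2)).trans
      (add_le_add (h t ht _ hω _) (hprof _ hω _))
    refine (pow_le_pow_left₀ (norm_nonneg _) h1 2).trans (le_of_eq ?_)
    have e : (1 + |p.2|) ^ (-((d : ℝ) + 1)) = ((1 + |p.2|) ^ (-(((d : ℝ) + 1) / 2))) ^ 2 := by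
      rw [← Real.rpow_natCast, ← Real.rpow_mul (by positivity)]; congr 1; push_cast; ring
    simp only [b, Real.norm_eq_abs, e]
    ring
  · exact hb.lintegral_lt_top.ne
  · refine ae_of_all _ fun p => ?_
    have hω : ‖(p.1 : EuclideanSpace ℝ (Fin d))‖ = 1 := by simp
    have h1 := (ENNReal.continuous_pow 2).continuousAt.tendsto.comp
      ((tendsto_poissonWaveRay y hω p.2).sub_const (poissonProfile y p.1 p.2)).enorm
    simpa [Function.comp_def] using h1

lemma wnorm_zero_fourierInv_sq (hd : 1 ≤ d) (φ : 𝓢(EuclideanSpace ℝ (Fin d), ℂ)) :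
    wnorm 0 (𝓕⁻ φ : 𝓢(EuclideanSpace ℝ (Fin d), ℂ)) ^ 2 =
      ∫⁻ ω : UnitSphere d, (∫⁻ r, ‖radialPull φ ω r‖ₑ ^ 2)
        ∂(volume : Measure (EuclideanSpace ℝ (Fin d))).toSphere := by
  have : Nonempty (Fin d) := ⟨⟨0, hd⟩⟩
  have h0 : wnorm 0 (𝓕⁻ φ : 𝓢(EuclideanSpace ℝ (Fin d), ℂ)) ^ 2 = ∫⁻ x, ‖φ x‖ₑ ^ 2 := by
    rw [← lintegral_enorm_sq_fourierInv φ.integrable (φ.memLp 2), wnorm_sq]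
    refine lintegral_congr fun x => ?_
    rw [wt_zero, SchwartzMap.fourierInv_coe]; simp
  rw [h0, lintegral_polar (φ.continuous.measurable.enorm.pow_const 2).aemeasurable]
  simp only [lintegral_enorm_sq_radialPull hd, finrank_euclideanSpace_fin]

/-- Cauchy–Schwarz over directions and radii. The shift by `t` does not change the `L²` norm of `g`,
so the bound is uniform in time. -/
lemma enorm_integral_mul_radialPull_le (hd : 1 ≤ d) {g : UnitSphere d × ℝ → ℂ}
    (hg : Measurable g) (t : ℝ) (φ : 𝓢(EuclideanSpace ℝ (Fin d), ℂ)) :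
    ‖∫ ω : UnitSphere d, (∫ r in Set.Ioi (0 : ℝ), g (ω, r - t) * radialPull φ ω r)
        ∂(volume : Measure (EuclideanSpace ℝ (Fin d))).toSphere‖ₑ ≤
      (∫⁻ p, ‖g p‖ₑ ^ 2
        ∂((volume : Measure (EuclideanSpace ℝ (Fin d))).toSphere.prod volume)) ^ (1 / 2 : ℝ) *
      wnorm 0 (𝓕⁻ φ : 𝓢(EuclideanSpace ℝ (Fin d), ℂ)) := by
  set S := (volume : Measure (EuclideanSpace ℝ (Fin d))).toSphere
  have hm1 : Measurable fun p : UnitSphere d × ℝ => ‖g (p.1, p.2 - t)‖ₑ :=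
    (hg.comp (by fun_prop : Measurable fun p : UnitSphere d × ℝ => (p.1, p.2 - t))).enorm
  have hm2 : Measurable fun p : UnitSphere d × ℝ => ‖radialPull φ p.1 p.2‖ₑ :=
    ((measurable_radialPull_uncurry φ.continuous.measurable).comp (by fun_prop :
      Measurable fun p : UnitSphere d × ℝ => ((p.1 : EuclideanSpace ℝ (Fin d)), p.2))).enorm
  have h1 := ENNReal.lintegral_mul_le_Lp_mul_Lq (S.prod (volume : Measure ℝ))
    Real.HolderConjugate.two_two hm1.aemeasurable hm2.aemeasurable
  have e1 : ∫⁻ p : UnitSphere d × ℝ, ‖g (p.1, p.2 - t)‖ₑ ^ (2 : ℝ) ∂(S.prod volume) =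
      ∫⁻ p, ‖g p‖ₑ ^ 2 ∂(S.prod volume) := by
    simp only [ENNReal.rpow_two]
    rw [lintegral_prod _ (hm1.pow_const 2).aemeasurable,
      lintegral_prod _ (hg.enorm.pow_const 2).aemeasurable]
    exact lintegral_congr fun ω => lintegral_sub_right_eq_self (fun r => ‖g (ω, r)‖ₑ ^ 2) t
  have e2 : (∫⁻ p : UnitSphere d × ℝ, ‖radialPull φ p.1 p.2‖ₑ ^ (2 : ℝ) ∂(S.prod volume)) ^
      (1 / 2 : ℝ) = wnorm 0 (𝓕⁻ φ : 𝓢(EuclideanSpace ℝ (Fin d), ℂ)) := by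
    simp only [ENNReal.rpow_two]
    rw [lintegral_prod _ (hm2.pow_const 2).aemeasurable, ← wnorm_zero_fourierInv_sq hd,
      ← ENNReal.rpow_natCast, ← ENNReal.rpow_mul]
    simp
  rw [e1, e2] at h1
  refine le_trans ?_ h1
  rw [lintegral_prod _ (hm1.mul hm2).aemeasurable]
  refine (enorm_integral_le_lintegral_enorm _).trans (lintegral_mono fun ω => ?_)
  refine (enorm_integral_le_lintegral_enorm _).trans ((setLIntegral_le_lintegral _ _).trans
    (le_of_eq (lintegral_congr fun r => ?_)))
  simp [enorm_mul]

/-- The multiplier `exp (-it|2πξ|)` of the half wave group. -/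
def phase {V : Type*} [NormedAddCommGroup V] (t : ℝ) (ξ : V) : ℂ :=
  Complex.exp (-(((2 * Real.pi * ‖ξ‖ * t : ℝ) : ℂ) * Complex.I))

lemma norm_phase {V : Type*} [NormedAddCommGroup V] (t : ℝ) (ξ : V) : ‖phase t ξ‖ = 1 := by
  rw [phase, ← neg_mul, ← Complex.ofReal_neg, Complex.norm_exp_ofReal_mul_I]

lemma continuous_phase {V : Type*} [NormedAddCommGroup V] (t : ℝ) :
    Continuous (phase t : V → ℂ) := by unfold phase; fun_prop

/-- The Fourier transform of the Poisson kernel with pole above `y`. -/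
def poissonData (y ξ : EuclideanSpace ℝ (Fin d)) : ℂ :=
  (Real.exp (-(2 * Real.pi * ‖ξ‖)) : ℂ) * Complex.exp (-(2 * Real.pi * Complex.I * inner ℝ ξ y))

lemma continuous_poissonData (y : EuclideanSpace ℝ (Fin d)) : Continuous (poissonData y) := by
  unfold poissonData; fun_prop

lemma norm_poissonData (y ξ : EuclideanSpace ℝ (Fin d)) :
    ‖poissonData y ξ‖ = Real.exp (-(2 * Real.pi * ‖ξ‖)) := by
  rw [poissonData, norm_mul, Complex.norm_real, Real.norm_of_nonneg (Real.exp_pos _).le,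
    show -(2 * Real.pi * Complex.I * inner ℝ ξ y : ℂ) =
      ((-(2 * Real.pi * inner ℝ ξ y) : ℝ) : ℂ) * Complex.I by push_cast; ring,
    Complex.norm_exp_ofReal_mul_I, mul_one]

lemma wnorm_poissonData_lt_top (hd : 1 ≤ d) {s : ℝ} (hs : -(d : ℝ) < 2 * s)
    (y : EuclideanSpace ℝ (Fin d)) : wnorm s (poissonData y) < ∞ := by
  have : Nonempty (Fin d) := ⟨⟨0, hd⟩⟩
  have h1 := integrable_norm_rpow_mul_exp_neg (V := EuclideanSpace ℝ (Fin d)) (s := 2 * s)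
    (c := 4 * Real.pi) (by simpa using hs) (by positivity)
  have hm := aestronglyMeasurable_wt_mul s (continuous_poissonData y).aestronglyMeasurable
  have h2 : MemLp (fun ξ => (wt s ξ : ℂ) * poissonData y ξ) 2 volume := by
    rw [memLp_two_iff_integrable_sq_norm hm]
    refine (h1.const_mul ((2 * Real.pi) ^ (2 * s))).congr (ae_of_all _ fun ξ => ?_)
    beta_reduce
    rw [norm_mul, Complex.norm_real, Real.norm_of_nonneg (wt_nonneg _ _), norm_poissonData, wt,
      mul_pow, ← Real.rpow_natCast, ← Real.rpow_mul (by positivity), ← Real.exp_nat_mul,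
      Real.mul_rpow (by positivity) (norm_nonneg _)]
    push_cast
    ring_nf
  exact h2.2

lemma integrable_phase_mul_poissonData (hd : 1 ≤ d) (y : EuclideanSpace ℝ (Fin d)) (t : ℝ) :
    Integrable fun ξ => phase t ξ * poissonData y ξ := by
  have : Nonempty (Fin d) := ⟨⟨0, hd⟩⟩
  refine (integrable_exp_neg_norm (V := EuclideanSpace ℝ (Fin d)) (c := 2 * Real.pi)
    (by positivity)).mono' ((continuous_phase t).mul (continuous_poissonData y)).aestronglyMeasurable
    (ae_of_all _ fun ξ => ?_)
  rw [norm_mul, norm_phase, one_mul, norm_poissonData]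

lemma fourierInv_phase_mul_poissonData (hd : 1 ≤ d) (y : EuclideanSpace ℝ (Fin d)) (t : ℝ)
    (x : EuclideanSpace ℝ (Fin d)) :
    𝓕⁻ (fun ξ => phase t ξ * poissonData y ξ) x = poissonWave y t x := by
  have : Nonempty (Fin d) := ⟨⟨0, hd⟩⟩
  have h := integral_poisson (z := 1 + t * Complex.I) (by simp) (x - y)
  rw [finrank_euclideanSpace_fin] at h
  rw [Real.fourierInv_eq', poissonWave]
  push_cast at h ⊢
  refine Eq.trans ?_ h
  congr 1; ext ξ
  rw [phase, poissonData, smul_eq_mul, inner_sub_right, Complex.ofReal_exp, ← Complex.exp_add,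
    ← Complex.exp_add, ← Complex.exp_add, ← Complex.exp_add]
  congr 1; push_cast; ring

lemma phase_mul_poissonData_smul (y : EuclideanSpace ℝ (Fin d)) (t : ℝ)
    {θ : EuclideanSpace ℝ (Fin d)} (hθ : ‖θ‖ = 1) {κ : ℝ} (hκ : 0 < κ) :
    phase t (κ • θ) * poissonData y (κ • θ) = Complex.exp (-(((2 * Real.pi : ℝ) : ℂ) *
      (1 - Complex.I * ((-t - inner ℝ θ y : ℝ) : ℂ)) * κ)) := by
  have h1 : ‖κ • θ‖ = κ := by rw [norm_smul, hθ, mul_one, Real.norm_of_nonneg hκ.le]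
  rw [phase, poissonData, h1, real_inner_smul_left, Complex.ofReal_exp, ← Complex.exp_add,
    ← Complex.exp_add]
  congr 1; push_cast; ring

/-- The frequency profile of `poissonProfile` along a ray, translated by `t`. -/
def poissonSpectrum (y : EuclideanSpace ℝ (Fin d)) (t : ℝ) (θ : EuclideanSpace ℝ (Fin d))
    (κ : ℝ) : ℂ :=
  (Set.Ioi (0 : ℝ)).indicator (fun κ : ℝ =>
    Complex.exp (-(Complex.I * (((d : ℝ) - 1) / 4 * Real.pi : ℝ))) *
      (((κ ^ (((d : ℝ) - 1) / 2) : ℝ) : ℂ) * (phase t (κ • θ) * poissonData y (κ • θ)))) κ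

lemma integrable_poissonSpectrum (hd : 1 ≤ d) (y : EuclideanSpace ℝ (Fin d)) (t : ℝ)
    {θ : EuclideanSpace ℝ (Fin d)} (hθ : ‖θ‖ = 1) : Integrable (poissonSpectrum y t θ) := by
  have hd' : (1 : ℝ) ≤ d := by exact_mod_cast hd
  unfold poissonSpectrum
  rw [integrable_indicator_iff measurableSet_Ioi]
  refine Integrable.const_mul ?_ _
  have h1 := integrableOn_rpow_mul_exp_neg_mul_rpow (s := ((d : ℝ) - 1) / 2) (p := 1)
    (b := 2 * Real.pi) (by linarith) one_pos (by positivity)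
  have hm : Measurable fun κ : ℝ => (((κ ^ (((d : ℝ) - 1) / 2) : ℝ) : ℂ) *
      (phase t (κ • θ) * poissonData y (κ • θ))) := by
    refine Measurable.mul (by fun_prop) ?_
    exact (((continuous_phase t).mul (continuous_poissonData y)).comp
      (by fun_prop : Continuous fun κ : ℝ => κ • θ)).measurable
  refine h1.mono' hm.aestronglyMeasurable ?_
  filter_upwards [ae_restrict_mem measurableSet_Ioi] with κ hκ
  have hκ : 0 < κ := hκ
  rw [norm_mul, norm_mul, norm_phase, one_mul, norm_poissonData, norm_smul, hθ, mul_one,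
    Real.norm_of_nonneg hκ.le, Complex.norm_real, Real.norm_of_nonneg (by positivity),
    Real.rpow_one, neg_mul]

/-- The inverse transform along a ray is Euler's integral with exponent `(d-1)/2` at `z = 2π(1 - i(r
- t - ⟨θ, y⟩))`. -/
lemma fourierInv_poissonSpectrum (hd : 1 ≤ d) (y : EuclideanSpace ℝ (Fin d)) (t : ℝ)
    {θ : EuclideanSpace ℝ (Fin d)} (hθ : ‖θ‖ = 1) (r : ℝ) :
    𝓕⁻ (poissonSpectrum y t θ) r = poissonProfile y θ (r - t) := by
  have hd' : (1 : ℝ) ≤ d := by exact_mod_cast hd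
  have hre : 0 < (((2 * Real.pi : ℝ) : ℂ) *
      (1 - Complex.I * ((r - t - inner ℝ θ y : ℝ) : ℂ))).re := by
    rw [Complex.re_ofReal_mul]; simp; positivity
  have h := integral_rpow_mul_cexp_neg_mul (m := ((d : ℝ) - 1) / 2) (by linarith) hre
  rw [show ((d : ℝ) - 1) / 2 + 1 = ((d : ℝ) + 1) / 2 by ring,
    show (-((((d : ℝ) - 1) / 2 : ℝ) + 1) : ℂ) = ((-(((d : ℝ) + 1) / 2) : ℝ) : ℂ) by
      push_cast; ring] at h
  rw [poissonProfile, ← h, ← integral_const_mul, Real.fourierInv_eq',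
    ← integral_indicator measurableSet_Ioi]
  congr 1; ext κ
  by_cases hκ : κ ∈ Set.Ioi (0 : ℝ)
  · have hκ0 : 0 < κ := hκ
    rw [poissonSpectrum, Set.indicator_of_mem hκ, Set.indicator_of_mem hκ,
      phase_mul_poissonData_smul y t hθ hκ0, smul_eq_mul, mul_left_comm, mul_left_comm (Complex.exp _)
      (((κ ^ (((d : ℝ) - 1) / 2) : ℝ) : ℂ)), ← Complex.exp_add, mul_comm (((κ ^ _ : ℝ) : ℂ))]
    congr 3
    simp only [RCLike.inner_apply, conj_trivial]
    push_cast; ring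
  · rw [poissonSpectrum, Set.indicator_of_notMem hκ, Set.indicator_of_notMem hκ, smul_zero]

end PoissonLimit

/-! ### The error functional for Poisson data -/

section FarField

variable {d : ℕ}

/-- The pairing with `φ` of the difference between the half wave with data `𝓕⁻ w` and its
radiation field, at time `t`. -/
def farField (t : ℝ) (w : EuclideanSpace ℝ (Fin d) → ℂ) (φ : 𝓢(EuclideanSpace ℝ (Fin d), ℂ)) : ℂ :=
  ∫ ξ, phase t ξ * w ξ * ((𝓕⁻ φ : 𝓢(EuclideanSpace ℝ (Fin d), ℂ)) ξ - outgoing φ ξ)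

lemma integral_poissonWave_mul (hd : 1 ≤ d) (y : EuclideanSpace ℝ (Fin d)) (t : ℝ)
    (φ : 𝓢(EuclideanSpace ℝ (Fin d), ℂ)) :
    ∫ ξ, phase t ξ * poissonData y ξ * (𝓕⁻ φ : 𝓢(EuclideanSpace ℝ (Fin d), ℂ)) ξ =
      ∫ x, poissonWave y t x * φ x := by
  rw [SchwartzMap.fourierInv_coe,
    integral_mul_fourierInv_eq (integrable_phase_mul_poissonData hd y t) φ.integrable]
  simp only [fourierInv_phase_mul_poissonData hd]

lemma integrable_poissonWave_mul (hd : 1 ≤ d) (y : EuclideanSpace ℝ (Fin d)) (t : ℝ)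
    (φ : 𝓢(EuclideanSpace ℝ (Fin d), ℂ)) : Integrable fun x => poissonWave y t x * φ x := by
  have hi := integrable_phase_mul_poissonData hd y t
  refine φ.integrable.bdd_mul (c := ∫ ξ, ‖phase t ξ * poissonData y ξ‖)
    (measurable_poissonWave y t).aestronglyMeasurable (ae_of_all _ fun x => ?_)
  rw [← fourierInv_phase_mul_poissonData hd, Real.fourierInv_eq']
  refine (norm_integral_le_integral_norm _).trans (le_of_eq (integral_congr_ae
    (ae_of_all _ fun ξ => ?_)))
  simp only
  rw [norm_smul, Complex.norm_exp_ofReal_mul_I, one_mul]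

lemma rpow_mul_rpow_half (hd : 1 ≤ d) {r : ℝ} (hr : 0 < r) :
    r ^ (((d : ℝ) - 1) / 2) * r ^ (((d : ℝ) - 1) / 2) = r ^ (d - 1) := by
  rw [← Real.rpow_add hr, ← Real.rpow_natCast, Nat.cast_sub hd]
  congr 1; push_cast; ring

lemma poissonWave_mul_eq (hd : 1 ≤ d) (y : EuclideanSpace ℝ (Fin d)) (t : ℝ)
    (φ : EuclideanSpace ℝ (Fin d) → ℂ) (θ : EuclideanSpace ℝ (Fin d)) {r : ℝ} (hr : 0 < r) :
    ((r ^ (d - 1) : ℝ) : ℂ) * (poissonWave y t (r • θ) * φ (r • θ)) =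
      poissonWaveRay y t θ (r - t) * radialPull φ θ r := by
  rw [poissonWaveRay, add_sub_cancel, if_pos hr, radialPull, if_pos hr,
    ← rpow_mul_rpow_half hd hr]
  push_cast; ring

/-- On each ray the inverse Fourier transform is moved from the restriction of `φ` to the spectrum
of the data, where it produces the profile. -/
lemma setIntegral_phase_mul_outgoing (hd : 1 ≤ d) (y : EuclideanSpace ℝ (Fin d)) (t : ℝ)
    (φ : 𝓢(EuclideanSpace ℝ (Fin d), ℂ)) {θ : EuclideanSpace ℝ (Fin d)} (hθ : ‖θ‖ = 1) :
    ∫ κ in Set.Ioi (0 : ℝ), ((κ ^ (d - 1) : ℝ) : ℂ) *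
        (phase t (κ • θ) * poissonData y (κ • θ) * outgoing φ (κ • θ)) =
      ∫ r in Set.Ioi (0 : ℝ), poissonProfile y θ (r - t) * radialPull φ θ r := by
  have h1 := integral_mul_fourierInv_eq (integrable_poissonSpectrum hd y t hθ)
    (integrable_and_memLp_radialPull hd φ hθ).1
  simp only [fourierInv_poissonSpectrum hd y t hθ] at h1
  rw [← setIntegral_eq_integral_of_forall_compl_eq_zero (s := Set.Ioi (0 : ℝ)),
    ← setIntegral_eq_integral_of_forall_compl_eq_zero (s := Set.Ioi (0 : ℝ))
      (f := fun r => poissonProfile y θ (r - t) * radialPull φ θ r)] at h1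
  · rw [← h1]
    refine setIntegral_congr_fun measurableSet_Ioi fun κ hκ => ?_
    have hκ0 : 0 < κ := hκ
    have hne : ((κ ^ (((d : ℝ) - 1) / 2) : ℝ) : ℂ) ≠ 0 := by
      exact_mod_cast (Real.rpow_pos_of_pos hκ0 _).ne'
    rw [outgoing_smul φ hθ hκ0, poissonSpectrum, Set.indicator_of_mem hκ,
      ← rpow_mul_rpow_half hd hκ0, Complex.ofReal_inv, Complex.ofReal_mul]
    field_simp
  · intro r hr
    rw [radialPull_of_nonpos φ θ (not_lt.1 hr), mul_zero]
  · intro κ hκ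
    rw [poissonSpectrum, Set.indicator_of_notMem hκ, zero_mul]

lemma integrable_poissonProfile_mul (hd : 1 ≤ d) (y : EuclideanSpace ℝ (Fin d)) (t : ℝ)
    (φ : 𝓢(EuclideanSpace ℝ (Fin d), ℂ)) {θ : EuclideanSpace ℝ (Fin d)} (hθ : ‖θ‖ = 1) :
    Integrable fun r => poissonProfile y θ (r - t) * radialPull φ θ r := by
  have hi := integrable_poissonSpectrum hd y t hθ
  refine (integrable_and_memLp_radialPull hd φ hθ).1.bdd_mul
    (c := ∫ κ, ‖poissonSpectrum y t θ κ‖) ?_ (ae_of_all _ fun r => ?_)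
  · exact ((measurable_poissonProfile y).comp
      (by fun_prop : Measurable fun r : ℝ => (θ, r - t))).aestronglyMeasurable
  · rw [← fourierInv_poissonSpectrum hd y t hθ, Real.fourierInv_eq']
    refine (norm_integral_le_integral_norm _).trans (le_of_eq (integral_congr_ae
      (ae_of_all _ fun ξ => ?_)))
    simp only
    rw [norm_smul, Complex.norm_exp_ofReal_mul_I, one_mul]

lemma norm_phase_mul_le {V : Type*} [NormedAddCommGroup V] [InnerProductSpace ℝ V]
    [FiniteDimensional ℝ V] [MeasurableSpace V] [BorelSpace V] (s t : ℝ) (w : V → ℂ) :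
    wnorm s (fun ξ => phase t ξ * w ξ) = wnorm s w := by
  refine eLpNorm_congr_norm_ae (ae_of_all _ fun ξ => ?_)
  rw [norm_mul, norm_mul, norm_mul, norm_phase, one_mul]

lemma farField_poissonData (hd : 1 ≤ d) (y : EuclideanSpace ℝ (Fin d)) (t : ℝ)
    (φ : 𝓢(EuclideanSpace ℝ (Fin d), ℂ)) :
    farField t (poissonData y) φ = ∫ ω : UnitSphere d, (∫ r in Set.Ioi (0 : ℝ),
      (poissonWaveRay y t ω (r - t) - poissonProfile y ω (r - t)) * radialPull φ ω r)
        ∂(volume : Measure (EuclideanSpace ℝ (Fin d))).toSphere := by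
  have : Nonempty (Fin d) := ⟨⟨0, hd⟩⟩
  have hd0 : (0 : ℝ) < d := by exact_mod_cast hd
  have hfin := wnorm_poissonData_lt_top hd (s := 0) (by simpa using hd0) y
  rw [← norm_phase_mul_le 0 t] at hfin
  have hmw : AEStronglyMeasurable (fun ξ => phase t ξ * poissonData y ξ) volume :=
    (integrable_phase_mul_poissonData hd y t).1
  have hφfin : wnorm 0 (𝓕⁻ φ : 𝓢(EuclideanSpace ℝ (Fin d), ℂ)) < ∞ :=
    wnorm_schwartz_lt_top (by simpa using hd0) _
  have i1 : Integrable fun ξ => phase t ξ * poissonData y ξ *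
      (𝓕⁻ φ : 𝓢(EuclideanSpace ℝ (Fin d), ℂ)) ξ := by
    refine (integrable_mul_of_wnorm (s := 0) hmw
      (𝓕⁻ φ : 𝓢(EuclideanSpace ℝ (Fin d), ℂ)).continuous.aestronglyMeasurable hfin ?_).1
    rwa [neg_zero]
  have i2 : Integrable fun ξ => phase t ξ * poissonData y ξ * outgoing φ ξ := by
    refine (integrable_mul_of_wnorm (s := 0) hmw
      (measurable_outgoing φ.continuous.measurable).aestronglyMeasurable hfin ?_).1
    rw [neg_zero]
    exact (wnorm_zero_outgoing_le hd φ).trans_lt hφfin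
  have p1 := integral_polar (integrable_poissonWave_mul hd y t φ)
  have p2 := integral_polar i2
  have p3 := integrable_polar (integrable_poissonWave_mul hd y t φ)
  simp only [finrank_euclideanSpace_fin] at p1 p2 p3
  have hω : ∀ ω : UnitSphere d, ‖(ω : EuclideanSpace ℝ (Fin d))‖ = 1 := fun ω => by simp
  have q1 : ∀ ω : UnitSphere d, Set.EqOn (fun r : ℝ => ((r ^ (d - 1) : ℝ) : ℂ) *
      (poissonWave y t (r • (ω : EuclideanSpace ℝ (Fin d))) *
        φ (r • (ω : EuclideanSpace ℝ (Fin d)))))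
      (fun r => poissonWaveRay y t ω (r - t) * radialPull φ ω r) (Set.Ioi 0) :=
    fun ω r hr => poissonWave_mul_eq hd y t φ ω hr
  simp only [farField, mul_sub]
  rw [integral_sub i1 i2, integral_poissonWave_mul hd, p1.2, p2.2, ← integral_sub p1.1 p2.1]
  refine integral_congr_ae ?_
  filter_upwards [p3] with ω h3
  rw [setIntegral_phase_mul_outgoing hd y t φ (hω ω), setIntegral_congr_fun measurableSet_Ioi (q1 ω),
    ← integral_sub (h3.congr_fun (q1 ω) measurableSet_Ioi)
      (integrable_poissonProfile_mul hd y t φ (hω ω)).integrableOn]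
  simp only [sub_mul]

/-- In physical space the error is the wave along rays minus its profile, which is small in `L²`;
Cauchy–Schwarz makes the estimate uniform in `φ`. -/
lemma exists_farField_poissonData_le (hd : 1 ≤ d) (y : EuclideanSpace ℝ (Fin d)) {ε : ℝ}
    (hε : 0 < ε) : ∀ᶠ t in atTop, ∀ φ : 𝓢(EuclideanSpace ℝ (Fin d), ℂ),
      ‖farField t (poissonData y) φ‖ ≤
        ε * (wnorm 0 (𝓕⁻ φ : 𝓢(EuclideanSpace ℝ (Fin d), ℂ))).toReal := by
  have : Nonempty (Fin d) := ⟨⟨0, hd⟩⟩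
  have hd0 : (0 : ℝ) < d := by exact_mod_cast hd
  have h := (ENNReal.continuous_rpow_const (y := 1 / 2)).continuousAt.tendsto.comp
    (tendsto_lintegral_poissonWaveRay hd y)
  rw [ENNReal.zero_rpow_of_pos (by norm_num)] at h
  filter_upwards [h.eventually_le_const (ENNReal.ofReal_pos.2 hε)] with t ht φ
  have hφfin : wnorm 0 (𝓕⁻ φ : 𝓢(EuclideanSpace ℝ (Fin d), ℂ)) < ∞ :=
    wnorm_schwartz_lt_top (by simpa using hd0) _
  have h1 := enorm_integral_mul_radialPull_le hd (measurable_poissonError y t) t φ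
  rw [← farField_poissonData hd] at h1
  have h2 := h1.trans (mul_le_mul_left ht _)
  have h3 := ENNReal.toReal_mono (ENNReal.mul_lt_top ENNReal.ofReal_lt_top hφfin).ne h2
  rwa [toReal_enorm, ENNReal.toReal_mul, ENNReal.toReal_ofReal hε.le] at h3

end FarField

/-! ### Decay of the error for general data -/

section FarFieldLimit

variable {d : ℕ}

/-- The constant `K` bounds the outgoing operator at the order `θ`; it is left free to cover both `θ
= 1`, where it is `1`, and `θ < 1`, where it is `2`. -/
lemma integrable_farField (hd : 3 ≤ d) {θ : ℝ} (h0 : 0 < θ) {K : ℝ≥0∞} (hK : K ≠ ∞)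
    (φ : 𝓢(EuclideanSpace ℝ (Fin d), ℂ))
    (hout : wnorm θ (outgoing φ) ≤ K * wnorm θ (𝓕⁻ φ : 𝓢(EuclideanSpace ℝ (Fin d), ℂ)))
    {w : EuclideanSpace ℝ (Fin d) → ℂ}
    (hw : AEStronglyMeasurable w volume) (hfin : wnorm (-θ) w < ∞) (t : ℝ) :
    Integrable (fun ξ => phase t ξ * w ξ *
      ((𝓕⁻ φ : 𝓢(EuclideanSpace ℝ (Fin d), ℂ)) ξ - outgoing φ ξ)) ∧
    ‖farField t w φ‖ ≤ (1 + K.toReal) * (wnorm (-θ) w).toReal *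
      (wnorm θ (𝓕⁻ φ : 𝓢(EuclideanSpace ℝ (Fin d), ℂ))).toReal := by
  have : Nonempty (Fin d) := ⟨⟨0, by omega⟩⟩
  have hd0 : (0 : ℝ) < d := by exact_mod_cast (by omega : 0 < d)
  have hφ : wnorm θ (𝓕⁻ φ : 𝓢(EuclideanSpace ℝ (Fin d), ℂ)) < ∞ :=
    wnorm_schwartz_lt_top (by rw [finrank_euclideanSpace_fin]; linarith) _
  have m1 := (𝓕⁻ φ : 𝓢(EuclideanSpace ℝ (Fin d), ℂ)).continuous.aestronglyMeasurable
    (μ := volume)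
  have m2 := (measurable_outgoing (d := d) φ.continuous.measurable).aestronglyMeasurable
    (μ := volume)
  have hdiff : wnorm θ (fun ξ => (𝓕⁻ φ : 𝓢(EuclideanSpace ℝ (Fin d), ℂ)) ξ - outgoing φ ξ) ≤
      (1 + K) * wnorm θ (𝓕⁻ φ : 𝓢(EuclideanSpace ℝ (Fin d), ℂ)) := by
    have h1 := wnorm_add_le (s := θ) m1 (m2.const_mul (-1))
    rw [wnorm_const_mul] at h1
    simp only [neg_one_mul, enorm_neg, enorm_one, one_mul, ← sub_eq_add_neg] at h1
    rw [add_mul, one_mul]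
    exact h1.trans (by gcongr)
  have hfin2 := lt_of_le_of_lt hdiff
    (ENNReal.mul_lt_top (ENNReal.add_lt_top.2 ⟨ENNReal.one_lt_top, hK.lt_top⟩) hφ)
  have h := integrable_mul_of_wnorm (s := -θ)
    ((continuous_phase t).aestronglyMeasurable.mul hw) (m1.sub m2)
    (by erw [norm_phase_mul_le]; exact hfin) (by rw [neg_neg]; exact hfin2)
  refine ⟨h.1, h.2.trans ?_⟩
  rw [neg_neg]
  erw [norm_phase_mul_le]
  rw [mul_comm (1 + K.toReal), mul_assoc]
  refine mul_le_mul_of_nonneg_left ?_ ENNReal.toReal_nonneg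
  have h2 := ENNReal.toReal_mono
    (ENNReal.mul_lt_top (ENNReal.add_lt_top.2 ⟨ENNReal.one_lt_top, hK.lt_top⟩) hφ).ne hdiff
  rwa [ENNReal.toReal_mul, ENNReal.toReal_add ENNReal.one_ne_top hK, ENNReal.toReal_one] at h2

/-- Uniform decay of `farField t w`, in the dual norm of order `-θ`, as `t → ∞`. -/
def FarFieldDecay (θ : ℝ) (w : EuclideanSpace ℝ (Fin d) → ℂ) : Prop :=
  ∀ ε : ℝ, 0 < ε → ∀ᶠ t in atTop, ∀ φ : 𝓢(EuclideanSpace ℝ (Fin d), ℂ),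
    ‖farField t w φ‖ ≤ ε * (wnorm θ (𝓕⁻ φ : 𝓢(EuclideanSpace ℝ (Fin d), ℂ))).toReal

lemma farField_congr_ae {w w' : EuclideanSpace ℝ (Fin d) → ℂ} (h : w =ᵐ[volume] w') (t : ℝ)
    (φ : 𝓢(EuclideanSpace ℝ (Fin d), ℂ)) : farField t w φ = farField t w' φ :=
  integral_congr_ae (h.mono fun ξ hξ => by simp only [hξ])

lemma FarFieldDecay.congr_ae {θ : ℝ} {w w' : EuclideanSpace ℝ (Fin d) → ℂ}
    (hw : FarFieldDecay θ w) (h : w =ᵐ[volume] w') : FarFieldDecay θ w' := fun ε hε => by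
  filter_upwards [hw ε hε] with t ht φ
  rw [← farField_congr_ae h]; exact ht φ

lemma integrable_farField_of_lt_one (hd : 3 ≤ d) {θ : ℝ} (h0 : 0 < θ) (h1 : θ < 1)
    (φ : 𝓢(EuclideanSpace ℝ (Fin d), ℂ)) {w : EuclideanSpace ℝ (Fin d) → ℂ}
    (hw : AEStronglyMeasurable w volume) (hfin : wnorm (-θ) w < ∞) (t : ℝ) :
    Integrable (fun ξ => phase t ξ * w ξ *
      ((𝓕⁻ φ : 𝓢(EuclideanSpace ℝ (Fin d), ℂ)) ξ - outgoing φ ξ)) ∧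
    ‖farField t w φ‖ ≤ 3 * (wnorm (-θ) w).toReal *
      (wnorm θ (𝓕⁻ φ : 𝓢(EuclideanSpace ℝ (Fin d), ℂ))).toReal := by
  have h := integrable_farField hd h0 ENNReal.ofNat_ne_top φ (wnorm_outgoing_le hd h0 h1 φ) hw hfin t
  rw [ENNReal.toReal_ofNat] at h
  norm_num at h
  exact h

/-- Smallness at order `0` and boundedness at order `1` give smallness in between. Poisson data have
finite norm of order `-1` because `d ≥ 3`. -/
lemma farFieldDecay_poissonData (hd : 3 ≤ d) {θ : ℝ} (h0 : 0 < θ) (h1 : θ < 1)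
    (y : EuclideanSpace ℝ (Fin d)) : FarFieldDecay θ (poissonData y) := by
  intro ε hε
  have hd0 : (3 : ℝ) ≤ d := by exact_mod_cast hd
  have hm := (continuous_poissonData y).aestronglyMeasurable (μ := volume)
  have hfin1 := wnorm_poissonData_lt_top (s := -1) (by omega) (by linarith) y
  have hfin := wnorm_poissonData_lt_top (s := -θ) (by omega) (by linarith) y
  set C : ℝ := 2 * (wnorm (-1) (poissonData y)).toReal
  have hC : 0 ≤ C := by positivity
  have ht : Tendsto (fun l : ℝ => C * l ^ (1 - θ)) (𝓝[>] 0) (𝓝 0) := by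
    have : Tendsto (fun l : ℝ => C * l ^ (1 - θ)) (𝓝 0) (𝓝 (C * 0 ^ (1 - θ))) :=
      ((Real.continuous_rpow_const (by linarith)).tendsto 0).const_mul C
    rw [Real.zero_rpow (by linarith), mul_zero] at this
    exact this.mono_left nhdsWithin_le_nhds
  -- The cutoff `l` is fixed first, so that the part of order `1` costs at most `ε/2`; the tolerance
  -- `ε/2 * l^θ` at order `0` then cancels the loss `l^(-θ)`.
  obtain ⟨l, hl1, hl⟩ := ((ht.eventually_le_const (half_pos hε)).and self_mem_nhdsWithin).exists
  have hl : 0 < l := hl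
  have hlθ : l ^ θ * l ^ (-θ) = 1 := by rw [← Real.rpow_add hl, add_neg_cancel, Real.rpow_zero]
  filter_upwards [exists_farField_poissonData_le (by omega) y
    (ε := ε / 2 * l ^ θ) (by positivity)] with t ht φ
  have b1 : ∀ φ : 𝓢(EuclideanSpace ℝ (Fin d), ℂ), ‖farField t (poissonData y) φ‖ ≤
      C * (wnorm 1 (𝓕⁻ φ : 𝓢(EuclideanSpace ℝ (Fin d), ℂ))).toReal := fun φ => by
    have h := (integrable_farField hd one_pos ENNReal.one_ne_top φ
      (by rw [one_mul]; exact wnorm_one_outgoing_le hd φ) hm hfin1 t).2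
    rw [ENNReal.toReal_one, one_add_one_eq_two] at h
    exact h
  have hadd : ∀ φ ψ, farField t (poissonData y) (φ + ψ) =
      farField t (poissonData y) φ + farField t (poissonData y) ψ := fun φ ψ => by
    rw [farField, farField, farField, ← integral_add
      (integrable_farField_of_lt_one hd h0 h1 φ hm hfin t).1
      (integrable_farField_of_lt_one hd h0 h1 ψ hm hfin t).1]
    congr 1; ext ξ
    rw [outgoing_add (by omega), FourierTransform.fourierInv_add, add_apply]
    ring
  refine (norm_le_of_split h0 h1 _ hadd (by positivity) hC ht b1 (by omega) hl φ).trans ?_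
  refine mul_le_mul_of_nonneg_right ?_ ENNReal.toReal_nonneg
  rw [mul_assoc, hlθ, mul_one]
  linarith

lemma FarFieldDecay.add (hd : 3 ≤ d) {θ : ℝ} (h0 : 0 < θ) (h1 : θ < 1)
    {w w' : EuclideanSpace ℝ (Fin d) → ℂ} (hw : AEStronglyMeasurable w volume)
    (hfin : wnorm (-θ) w < ∞) (hw' : AEStronglyMeasurable w' volume) (hfin' : wnorm (-θ) w' < ∞)
    (h : FarFieldDecay θ w) (h' : FarFieldDecay θ w') :
    FarFieldDecay θ fun ξ => w ξ + w' ξ := by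
  intro ε hε
  filter_upwards [h _ (half_pos hε), h' _ (half_pos hε)] with t ht ht' φ
  have e : farField t (fun ξ => w ξ + w' ξ) φ = farField t w φ + farField t w' φ := by
    rw [farField, farField, farField, ← integral_add
      (integrable_farField_of_lt_one hd h0 h1 φ hw hfin t).1
      (integrable_farField_of_lt_one hd h0 h1 φ hw' hfin' t).1]
    congr 1; ext ξ; ring
  rw [e]
  refine (norm_add_le _ _).trans ((add_le_add (ht φ) (ht' φ)).trans (le_of_eq ?_))
  ring

lemma FarFieldDecay.const_mul {θ : ℝ} {w : EuclideanSpace ℝ (Fin d) → ℂ} (c : ℂ)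
    (h : FarFieldDecay θ w) : FarFieldDecay θ fun ξ => c * w ξ := by
  intro ε hε
  filter_upwards [h (ε / (‖c‖ + 1)) (by positivity)] with t ht φ
  have e : farField t (fun ξ => c * w ξ) φ = c * farField t w φ := by
    rw [farField, farField, ← integral_const_mul]
    congr 1; ext ξ; ring
  rw [e, norm_mul]
  have h2 : ‖c‖ * (ε / (‖c‖ + 1)) ≤ ε := by
    rw [mul_div_assoc', div_le_iff₀ (by positivity)]; nlinarith [norm_nonneg c]
  calc _ ≤ ‖c‖ * (ε / (‖c‖ + 1) * (wnorm θ (𝓕⁻ φ : 𝓢(EuclideanSpace ℝ (Fin d), ℂ))).toReal) :=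
        mul_le_mul_of_nonneg_left (ht φ) (norm_nonneg _)
    _ ≤ _ := by
        rw [← mul_assoc]; exact mul_le_mul_of_nonneg_right h2 ENNReal.toReal_nonneg

lemma ae_eq_zero_of_fourierInv_eq_zero {V : Type*} [NormedAddCommGroup V] [InnerProductSpace ℝ V]
    [FiniteDimensional ℝ V] [MeasurableSpace V] [BorelSpace V] {g : V → ℂ}
    (hg : Integrable g volume) (h : ∀ y, 𝓕⁻ g y = 0) : g =ᵐ[volume] 0 := by
  refine ae_eq_zero_of_forall_integral_mul_schwartz hg.locallyIntegrable fun φ _ => ?_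
  have h1 := integral_mul_fourierInv_eq hg (𝓕 φ : 𝓢(V, ℂ)).integrable
  rw [← SchwartzMap.fourierInv_coe, FourierTransform.fourierInv_fourier_eq] at h1
  rw [h1]; simp [h]

/-- The functions `w` with `|2πξ|^s w` in the span of the functions `|2πξ|^s poissonData y`
are dense in the weighted `L²` space. -/
lemma exists_mem_span_poissonData (hd : 1 ≤ d) {s : ℝ} (hs : -(d : ℝ) < 2 * s)
    (f : Lp ℂ 2 (volume : Measure (EuclideanSpace ℝ (Fin d)))) {δ : ℝ} (hδ : 0 < δ) :
    ∃ v ∈ Submodule.span ℂ (Set.range fun y => (memLp_wt_mul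
      (continuous_poissonData y).aestronglyMeasurable
      (wnorm_poissonData_lt_top hd hs y)).toLp _), ‖f - v‖ < δ := by
  set p : EuclideanSpace ℝ (Fin d) → Lp ℂ 2 (volume : Measure (EuclideanSpace ℝ (Fin d))) :=
    fun y => (memLp_wt_mul (continuous_poissonData y).aestronglyMeasurable
      (wnorm_poissonData_lt_top hd hs y)).toLp _
  have : Nonempty (Fin d) := ⟨⟨0, hd⟩⟩
  have htop : (Submodule.span ℂ (Set.range p)).topologicalClosure = ⊤ := by
    rw [Submodule.topologicalClosure_eq_top_iff, Submodule.eq_bot_iff]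
    intro f hf
    rw [Submodule.mem_orthogonal] at hf
    have hm := (memLp_wt_mul (continuous_poissonData (0 : EuclideanSpace ℝ (Fin d))).aestronglyMeasurable
      (wnorm_poissonData_lt_top hd hs 0))
    have hgi := hm.integrable_mul (Lp.memLp f)
    have hg0 : ∀ ξ : EuclideanSpace ℝ (Fin d), poissonData 0 ξ =
      (Real.exp (-(2 * Real.pi * ‖ξ‖)) : ℂ) := fun ξ => by simp [poissonData]
    -- Orthogonality to the vector with parameter `y` says that the inverse Fourier transform of `wt
    -- s * exp(-2π|ξ|) * f` vanishes at `y`. The factor in front of `f` is nonzero off the origin.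
    have hz := ae_eq_zero_of_fourierInv_eq_zero hgi fun y => by
      have h1 := hf (p y) (Submodule.subset_span ⟨y, rfl⟩)
      rw [L2.inner_def] at h1
      rw [← h1, Real.fourierInv_eq']
      refine integral_congr_ae ?_
      filter_upwards [(memLp_wt_mul (continuous_poissonData y).aestronglyMeasurable
        (wnorm_poissonData_lt_top hd hs y)).coeFn_toLp] with ξ hξ
      simp only [p, hξ, RCLike.inner_apply, map_mul, Complex.conj_ofReal, smul_eq_mul, Pi.mul_apply,
        hg0]
      rw [poissonData, map_mul, Complex.conj_ofReal, ← Complex.exp_conj]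
      have : (starRingEnd ℂ) (-(2 * Real.pi * Complex.I * inner ℝ ξ y)) =
          ((2 * Real.pi * inner ℝ ξ y : ℝ) : ℂ) * Complex.I := by
        simp only [map_neg, map_mul, Complex.conj_ofReal, Complex.conj_I, map_ofNat]
        push_cast; ring
      rw [this]; ring
    rw [Lp.eq_zero_iff_ae_eq_zero]
    filter_upwards [hz, ae_ne_zero (V := EuclideanSpace ℝ (Fin d))] with ξ hξ hne
    have h2 : (wt s ξ : ℂ) * poissonData 0 ξ ≠ 0 := by
      rw [hg0]
      exact mul_ne_zero (by exact_mod_cast (wt_pos s hne).ne') (by exact_mod_cast (Real.exp_pos _).ne')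
    exact (mul_eq_zero.1 hξ).resolve_left h2
  have hf : f ∈ (Submodule.span ℂ (Set.range p)).topologicalClosure := by rw [htop]; trivial
  rw [← SetLike.mem_coe, Submodule.topologicalClosure_coe] at hf
  obtain ⟨v, hv, h⟩ := Metric.mem_closure_iff.1 hf δ hδ
  exact ⟨v, hv, by rwa [← dist_eq_norm]⟩

lemma wnorm_wt_neg_mul {V : Type*} [NormedAddCommGroup V] [InnerProductSpace ℝ V]
    [FiniteDimensional ℝ V] [MeasurableSpace V] [BorelSpace V] [Nontrivial V] (s : ℝ) (f : V → ℂ) :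
    wnorm s (fun ξ => (wt (-s) ξ : ℂ) * f ξ) = eLpNorm f 2 volume := by
  refine eLpNorm_congr_ae ?_
  filter_upwards [ae_ne_zero (V := V)] with ξ hξ
  rw [← mul_assoc, ← Complex.ofReal_mul, wt_mul_wt_neg s hξ, Complex.ofReal_one, one_mul]

/-- The asymptotics of half waves with data in the homogeneous Sobolev space of order `-θ`. -/
lemma farFieldDecay (hd : 3 ≤ d) {θ : ℝ} (h0 : 0 < θ) (h1 : θ < 1)
    {w : EuclideanSpace ℝ (Fin d) → ℂ} (hw : AEStronglyMeasurable w volume)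
    (hfin : wnorm (-θ) w < ∞) : FarFieldDecay θ w := by
  have : Nonempty (Fin d) := ⟨⟨0, by omega⟩⟩
  have hd0 : (3 : ℝ) ≤ d := by exact_mod_cast hd
  have hs : -(d : ℝ) < 2 * -θ := by linarith
  set toFun : Lp ℂ 2 (volume : Measure (EuclideanSpace ℝ (Fin d))) →
    EuclideanSpace ℝ (Fin d) → ℂ := fun f ξ => (wt (- -θ) ξ : ℂ) * f ξ
  have hmeas : ∀ f, AEStronglyMeasurable (toFun f) volume := fun f =>
    aestronglyMeasurable_wt_mul _ (Lp.memLp f).1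
  have hnorm : ∀ f, wnorm (-θ) (toFun f) = ‖f‖ₑ := fun f => by
    rw [wnorm_wt_neg_mul, Lp.enorm_def]
  have hfinite : ∀ f, wnorm (-θ) (toFun f) < ∞ := fun f => by rw [hnorm]; exact enorm_lt_top
  have hspan : ∀ v ∈ Submodule.span ℂ (Set.range fun y => (memLp_wt_mul
      (continuous_poissonData y).aestronglyMeasurable
      (wnorm_poissonData_lt_top (by omega) hs y)).toLp _), FarFieldDecay θ (toFun v) := by
    intro v hv
    induction hv using Submodule.span_induction with
    | mem v hv =>
      obtain ⟨y, rfl⟩ := hv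
      refine (farFieldDecay_poissonData hd h0 h1 y).congr_ae ?_
      filter_upwards [ae_ne_zero (V := EuclideanSpace ℝ (Fin d)), (memLp_wt_mul
        (continuous_poissonData y).aestronglyMeasurable
        (wnorm_poissonData_lt_top (by omega) hs y)).coeFn_toLp] with ξ hξ he
      simp only [toFun, he]
      rw [← mul_assoc, ← Complex.ofReal_mul, mul_comm (wt (- -θ) ξ), wt_mul_wt_neg _ hξ,
        Complex.ofReal_one, one_mul]
    | zero =>
      have h := (farFieldDecay_poissonData hd h0 h1 (0 : EuclideanSpace ℝ (Fin d))).const_mul 0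
      refine h.congr_ae ?_
      exact ae_of_all _ fun ξ => by simp [toFun]
    | add f g _ _ hf hg =>
      refine (hf.add hd h0 h1 (hmeas f) (hfinite f) (hmeas g) (hfinite g) hg).congr_ae ?_
      filter_upwards [Lp.coeFn_add f g] with ξ hξ
      simp only [toFun, hξ, Pi.add_apply]; ring
    | smul c f _ hf =>
      refine (hf.const_mul c).congr_ae ?_
      filter_upwards [Lp.coeFn_smul c f] with ξ hξ
      simp only [toFun, hξ, Pi.smul_apply, smul_eq_mul]; ring
  set f := (memLp_wt_mul hw hfin).toLp _
  have hwf : w =ᵐ[volume] toFun f := by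
    filter_upwards [ae_ne_zero (V := EuclideanSpace ℝ (Fin d)),
      (memLp_wt_mul hw hfin).coeFn_toLp] with ξ hξ he
    simp only [toFun, f, he]
    rw [← mul_assoc, ← Complex.ofReal_mul, mul_comm (wt (- -θ) ξ), wt_mul_wt_neg _ hξ,
      Complex.ofReal_one, one_mul]
  refine FarFieldDecay.congr_ae ?_ hwf.symm
  intro ε hε
  -- The uniform bound has the constant `3`, so an approximation within `ε/6` costs at most `ε/2`.
  obtain ⟨v, hv, hfv⟩ := exists_mem_span_poissonData (by omega) hs f (δ := ε / 6) (by positivity)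
  filter_upwards [hspan v hv (ε / 2) (half_pos hε)] with t ht φ
  have hsum : toFun f =ᵐ[volume] fun ξ => toFun v ξ + toFun (f - v) ξ := by
    filter_upwards [Lp.coeFn_sub f v] with ξ hξ
    simp only [toFun, hξ, Pi.sub_apply]; ring
  have i1 := integrable_farField_of_lt_one hd h0 h1 φ (hmeas v) (hfinite v) t
  have i2 := integrable_farField_of_lt_one hd h0 h1 φ (hmeas (f - v)) (hfinite (f - v)) t
  have e : farField t (toFun f) φ = farField t (toFun v) φ + farField t (toFun (f - v)) φ := by
    rw [farField_congr_ae hsum, farField, farField, farField, ← integral_add i1.1 i2.1]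
    congr 1; ext ξ; ring
  rw [e]
  have h3 := i2.2
  rw [hnorm, toReal_enorm] at h3
  refine (norm_add_le _ _).trans ((add_le_add (ht φ) h3).trans ?_)
  rw [← add_mul]
  refine mul_le_mul_of_nonneg_right ?_ ENNReal.toReal_nonneg
  linarith

end FarFieldLimit

/-! ### Uniqueness of free waves -/

section Uniqueness

/-- Taylor's remainder estimate, by induction on `n`: the bound for `f (k+1)` is integrated from
`0`, where every `f k` vanishes. -/
lemma norm_le_of_hasDerivAt_seq {f : ℕ → ℝ → ℂ} (hf : ∀ k s, HasDerivAt (f k) (f (k + 1) s) s)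
    (h0 : ∀ k, f k 0 = 0) {M R T : ℝ} (hb : ∀ k, ∀ s ∈ Set.Icc 0 T, ‖f k s‖ ≤ M * R ^ k) (n : ℕ) :
    ∀ k, ∀ s ∈ Set.Icc 0 T, ‖f k s‖ ≤ M * R ^ (k + n) * (s ^ n / n.factorial) := by
  induction n with
  | zero => intro k s hs; simpa using hb k s hs
  | succ n ih =>
    intro k s hs
    refine image_norm_le_of_norm_deriv_right_le_deriv_boundary (f := f k) (f' := f (k + 1))
      (a := 0) (b := T) (B := fun s => M * R ^ (k + (n + 1)) * (s ^ (n + 1) / (n + 1).factorial))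
      (B' := fun s => M * R ^ (k + (n + 1)) * (s ^ n / n.factorial))
      (fun s _ => (hf k s).continuousAt.continuousWithinAt)
      (fun s _ => (hf k s).hasDerivWithinAt) ?_ ?_ ?_ hs
    · simp [h0]
    · intro s
      refine HasDerivAt.const_mul _ ?_
      have h1 := (hasDerivAt_pow (n + 1) s).div_const ((n + 1).factorial : ℝ)
      convert h1 using 1
      rw [Nat.factorial_succ]; push_cast
      field_simp
    · intro s hs
      have := ih (k + 1) s ⟨hs.1, hs.2.le⟩
      rwa [add_assoc, add_comm 1 n] at this

lemma eq_zero_of_hasDerivAt_seq {f : ℕ → ℝ → ℂ} (hf : ∀ k s, HasDerivAt (f k) (f (k + 1) s) s)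
    (h0 : ∀ k, f k 0 = 0) {M R T : ℝ} (hb : ∀ k, ∀ s ∈ Set.Icc 0 T, ‖f k s‖ ≤ M * R ^ k) {s : ℝ}
    (hs : s ∈ Set.Icc 0 T) : f 0 s = 0 := by
  have h1 : Tendsto (fun n : ℕ => M * ((R * s) ^ n / n.factorial)) atTop (𝓝 0) := by
    simpa using (FloorSemiring.tendsto_pow_div_factorial_atTop (R * s)).const_mul M
  have h2 : ∀ n : ℕ, ‖f 0 s‖ ≤ M * ((R * s) ^ n / n.factorial) := fun n => by
    have := norm_le_of_hasDerivAt_seq hf h0 hb n 0 s hs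
    rw [zero_add] at this
    refine this.trans (le_of_eq ?_)
    rw [mul_pow]; ring
  exact norm_le_zero_iff.1 (ge_of_tendsto' h1 h2)

/-- Negative times follow by reflection, which multiplies the `k`-th derivative by `(-1)^k`. -/
lemma eq_zero_of_hasDerivAt_seq_of_abs_le {f : ℕ → ℝ → ℂ}
    (hf : ∀ k s, HasDerivAt (f k) (f (k + 1) s) s)
    (h0 : ∀ k, f k 0 = 0) {M R T : ℝ} (hb : ∀ k s, |s| ≤ T → ‖f k s‖ ≤ M * R ^ k) {s : ℝ}
    (hs : |s| ≤ T) : f 0 s = 0 := by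
  rcases le_total 0 s with h | h
  · refine eq_zero_of_hasDerivAt_seq hf h0 (T := T) (fun k r hr => hb k r ?_)
      ⟨h, (le_abs_self s).trans hs⟩
    rw [abs_of_nonneg hr.1]; exact hr.2
  · have := eq_zero_of_hasDerivAt_seq (f := fun k r => (-1) ^ k * f k (-r)) (M := M) (R := R) (T := T)
      (fun k r => ?_) (fun k => by simp [h0]) (fun k r hr => ?_) (s := -s)
      ⟨by linarith, (neg_le_abs s).trans hs⟩
    · simpa using this
    · have h1 := ((hf k (-r)).scomp r (hasDerivAt_neg r)).const_mul ((-1 : ℂ) ^ k)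
      convert! h1 using 1
      rw [pow_succ]; simp
    · rw [norm_mul, norm_pow, norm_neg, norm_one, one_pow, one_mul]
      refine hb k _ ?_
      rw [abs_neg, abs_of_nonneg hr.1]; exact hr.2

variable {V : Type*} [NormedAddCommGroup V] [InnerProductSpace ℝ V] [FiniteDimensional ℝ V]
  [MeasurableSpace V] [BorelSpace V]

lemma fourierInv_laplacian_apply (φ : 𝓢(V, ℂ)) (ξ : V) :
    (𝓕⁻ (Δ φ) : 𝓢(V, ℂ)) ξ = -((2 * Real.pi * ‖ξ‖ : ℝ) : ℂ) ^ 2 * (𝓕⁻ φ : 𝓢(V, ℂ)) ξ := by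
  have e : ∀ ψ : 𝓢(V, ℂ), (𝓕⁻ ψ : 𝓢(V, ℂ)) ξ = (𝓕 ψ : 𝓢(V, ℂ)) (-ξ) := fun ψ => by
    rw [SchwartzMap.fourierInv_coe, SchwartzMap.fourier_coe, Real.fourierInv_eq_fourier_neg]
  rw [e, e, SchwartzMap.laplacian_eq_fourierMultiplierCLM, FourierTransform.fourier_smul,
    SchwartzMap.fourierMultiplierCLM_apply, FourierTransform.fourier_fourierInv_eq, smul_apply,
    SchwartzMap.smulLeftCLM_apply_apply (by fun_prop)]
  simp
  ring

lemma MemHomSobolev.aestronglyMeasurable {s : ℝ} {f : 𝓢'(V, ℂ)} (h : MemHomSobolev s f) :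
    AEStronglyMeasurable (fourierDensity f) volume :=
  h.hasDensity.1.aestronglyMeasurable

lemma MemHomSobolev.hasDensity_sub {s r : ℝ} {f g : 𝓢'(V, ℂ)} (hf : MemHomSobolev s f)
    (hg : MemHomSobolev r g) :
    HasDensity (𝓕 (f - g)) fun ξ => fourierDensity f ξ - fourierDensity g ξ := by
  rw [sub_eq_add_neg, FourierTransform.fourier_add, FourierTransform.fourier_neg,
    ← sub_eq_add_neg]
  exact hf.hasDensity.sub hg.hasDensity

lemma homSobolevENorm_le_sub_add {s : ℝ} {f g : 𝓢'(V, ℂ)} (hf : MemHomSobolev s f)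
    (hg : MemHomSobolev s g) :
    homSobolevENorm s f ≤ homSobolevENorm s (f - g) + homSobolevENorm s g := by
  rw [homSobolevENorm_eq hf.hasDensity, homSobolevENorm_eq hg.hasDensity,
    homSobolevENorm_eq (hf.hasDensity_sub hg)]
  have := wnorm_add_le (s := s) (hf.aestronglyMeasurable.sub hg.aestronglyMeasurable)
    hg.aestronglyMeasurable
  simp only [Pi.sub_apply, sub_add_cancel] at this
  exact this

lemma MemHomSobolev.norm_apply_le [Nontrivial V] {s : ℝ} {f : 𝓢'(V, ℂ)} (hf : MemHomSobolev s f)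
    (hs : 2 * s < Module.finrank ℝ V) (φ : 𝓢(V, ℂ)) :
    ‖f φ‖ ≤ (homSobolevENorm s f).toReal * (wnorm (-s) (𝓕⁻ φ : 𝓢(V, ℂ))).toReal := by
  rw [(hf.hasDensity.apply_eq φ).2, homSobolevENorm_eq hf.hasDensity]
  exact (integrable_mul_of_wnorm hf.aestronglyMeasurable
    (𝓕⁻ φ : 𝓢(V, ℂ)).continuous.aestronglyMeasurable hf.wnorm_lt_top
    (wnorm_schwartz_lt_top (by linarith) _)).2

/-- Local boundedness from continuity, made global on the interval by compactness. -/
lemma exists_homSobolevENorm_le {s : ℝ} {N : ℝ → 𝓢'(V, ℂ)} (hmem : ∀ t, MemHomSobolev s (N t))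
    (hc : ∀ t, Tendsto (fun τ => homSobolevENorm s (N τ - N t)) (𝓝 t) (𝓝 0)) (T : ℝ) :
    ∃ M : ℝ≥0∞, M < ∞ ∧ ∀ t ∈ Set.Icc (-T) T, homSobolevENorm s (N t) ≤ M := by
  refine isCompact_Icc.induction_on (p := fun S => ∃ M : ℝ≥0∞, M < ∞ ∧
    ∀ t ∈ S, homSobolevENorm s (N t) ≤ M) ⟨0, by simp, by simp⟩ ?_ ?_ ?_
  · rintro S S' h ⟨M, hM, h2⟩
    exact ⟨M, hM, fun t ht => h2 t (h ht)⟩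
  · rintro S S' ⟨M, hM, h⟩ ⟨M', hM', h'⟩
    refine ⟨M + M', ENNReal.add_lt_top.2 ⟨hM, hM'⟩, ?_⟩
    rintro t (ht | ht)
    · exact (h t ht).trans le_self_add
    · exact (h' t ht).trans le_add_self
  · intro t _
    refine ⟨{τ | homSobolevENorm s (N τ - N t) ≤ 1}, mem_nhdsWithin_of_mem_nhds
      ((hc t).eventually_le_const one_pos), 1 + homSobolevENorm s (N t),
      ENNReal.add_lt_top.2 ⟨ENNReal.one_lt_top, hmem t⟩, fun τ hτ => ?_⟩
    exact (homSobolevENorm_le_sub_add (hmem τ) (hmem t)).trans (by gcongr; exact hτ)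

/-- The successive time derivatives of `t ↦ u t φ` for a free wave `u` with time derivative `v`. -/
def waveSeq (u v : ℝ → 𝓢'(V, ℂ)) : ℕ → 𝓢(V, ℂ) → ℝ → ℂ
  | 0, φ => fun s => u s φ
  | 1, φ => fun s => v s φ
  | n + 2, φ => waveSeq u v n (Δ φ)

lemma IsFreeWave.hasDerivAt_waveSeq {β : ℝ} {u₀ u₁ : 𝓢'(V, ℂ)} {u v : ℝ → 𝓢'(V, ℂ)}
    (h : IsFreeWave β u₀ u₁ u v) : ∀ (k : ℕ) (φ : 𝓢(V, ℂ)) (s : ℝ),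
      HasDerivAt (waveSeq u v k φ) (waveSeq u v (k + 1) φ s) s
  | 0, φ, s => h.deriv_left φ s
  | 1, φ, s => by
    have := h.deriv_right φ s
    rw [TemperedDistribution.laplacian_apply_apply] at this
    exact this
  | k + 2, φ, s => h.hasDerivAt_waveSeq k (Δ φ) s

lemma IsFreeWave.waveSeq_zero {β : ℝ} {u₀ u₁ : 𝓢'(V, ℂ)} {u v u' v' : ℝ → 𝓢'(V, ℂ)}
    (h : IsFreeWave β u₀ u₁ u v) (h' : IsFreeWave β u₀ u₁ u' v') : ∀ (k : ℕ) (φ : 𝓢(V, ℂ)),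
      waveSeq u v k φ 0 = waveSeq u' v' k φ 0
  | 0, φ => by simp only [waveSeq, h.init_left, h'.init_left]
  | 1, φ => by simp only [waveSeq, h.init_right, h'.init_right]
  | k + 2, φ => h.waveSeq_zero h' k (Δ φ)

lemma wnorm_fourierInv_laplacian_le (s : ℝ) {R : ℝ} {φ : 𝓢(V, ℂ)}
    (hφ : ∀ ξ : V, R < 2 * Real.pi * ‖ξ‖ → (𝓕⁻ φ : 𝓢(V, ℂ)) ξ = 0) :
    wnorm s (𝓕⁻ (Δ φ) : 𝓢(V, ℂ)) ≤ ENNReal.ofReal (R ^ 2) * wnorm s (𝓕⁻ φ : 𝓢(V, ℂ)) := by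
  have h1 := wnorm_const_mul s ((R ^ 2 : ℝ) : ℂ) (𝓕⁻ φ : 𝓢(V, ℂ))
  rw [← ofReal_norm, Complex.norm_real, Real.norm_of_nonneg (sq_nonneg R)] at h1
  rw [← h1]
  refine wnorm_mono (ae_of_all _ fun ξ => mul_le_mul_of_nonneg_left ?_ (wt_nonneg _ _))
  rw [fourierInv_laplacian_apply, norm_mul, norm_mul, norm_neg, norm_pow, Complex.norm_real,
    Complex.norm_real, Real.norm_of_nonneg (by positivity : 0 ≤ 2 * Real.pi * ‖ξ‖),
    Real.norm_of_nonneg (sq_nonneg R)]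
  by_cases h : R < 2 * Real.pi * ‖ξ‖
  · rw [hφ ξ h]; simp
  · push Not at h
    gcongr

/-- Two time derivatives amount to one Laplacian on the test function, which costs a factor `R²`
when its frequencies are at most `R`. -/
lemma norm_waveSeq_le [Nontrivial V] {β : ℝ} (hβ0 : 0 < β) (hβ1 : β < 1)
    (hn : 2 ≤ Module.finrank ℝ V)
    {u v : ℝ → 𝓢'(V, ℂ)} (hu : ∀ t, MemHomSobolev β (u t)) (hv : ∀ t, MemHomSobolev (β - 1) (v t))
    {T R : ℝ} (hR : 1 ≤ R) {M : ℝ≥0∞} (hM : M < ∞)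
    (hMu : ∀ t ∈ Set.Icc (-T) T, homSobolevENorm β (u t) ≤ M)
    (hMv : ∀ t ∈ Set.Icc (-T) T, homSobolevENorm (β - 1) (v t) ≤ M) :
    ∀ (k : ℕ) (φ : 𝓢(V, ℂ)), (∀ ξ : V, R < 2 * Real.pi * ‖ξ‖ → (𝓕⁻ φ : 𝓢(V, ℂ)) ξ = 0) →
      ∀ s, |s| ≤ T → ‖waveSeq u v k φ s‖ ≤ M.toReal * ((wnorm (-β) (𝓕⁻ φ : 𝓢(V, ℂ))).toReal +
        (wnorm (-(β - 1)) (𝓕⁻ φ : 𝓢(V, ℂ))).toReal) * R ^ k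
  | 0, φ, _, s, hs => by
    have hn' : (2 : ℝ) ≤ Module.finrank ℝ V := by exact_mod_cast hn
    rw [pow_zero, mul_one]
    refine ((hu s).norm_apply_le (by linarith) φ).trans ?_
    have h1 := ENNReal.toReal_mono hM.ne (hMu s (abs_le.1 hs))
    refine mul_le_mul h1 (le_add_of_nonneg_right ENNReal.toReal_nonneg) ENNReal.toReal_nonneg
      ENNReal.toReal_nonneg
  | 1, φ, _, s, hs => by
    have hn' : (2 : ℝ) ≤ Module.finrank ℝ V := by exact_mod_cast hn
    rw [pow_one]
    refine ((hv s).norm_apply_le (by linarith) φ).trans ?_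
    have h1 := ENNReal.toReal_mono hM.ne (hMv s (abs_le.1 hs))
    refine le_trans ?_ (le_mul_of_one_le_right (by positivity) hR)
    refine mul_le_mul h1 (le_add_of_nonneg_left ENNReal.toReal_nonneg) ENNReal.toReal_nonneg
      ENNReal.toReal_nonneg
  | k + 2, φ, hφ, s, hs => by
    have hn' : (2 : ℝ) ≤ Module.finrank ℝ V := by exact_mod_cast hn
    have h := norm_waveSeq_le hβ0 hβ1 hn hu hv hR hM hMu hMv k (Δ φ) (fun ξ hξ => by
      rw [fourierInv_laplacian_apply, hφ ξ hξ, mul_zero]) s hs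
    refine h.trans ?_
    have e : ∀ r : ℝ, -(Module.finrank ℝ V : ℝ) < 2 * r → (wnorm r (𝓕⁻ (Δ φ) : 𝓢(V, ℂ))).toReal ≤
        R ^ 2 * (wnorm r (𝓕⁻ φ : 𝓢(V, ℂ))).toReal := fun r hr => by
      have h1 := ENNReal.toReal_mono
        (ENNReal.mul_lt_top ENNReal.ofReal_lt_top (wnorm_schwartz_lt_top hr _)).ne
        (wnorm_fourierInv_laplacian_le r hφ)
      rwa [ENNReal.toReal_mul, ENNReal.toReal_ofReal (sq_nonneg R)] at h1
    calc _ ≤ M.toReal * (R ^ 2 * (wnorm (-β) (𝓕⁻ φ : 𝓢(V, ℂ))).toReal +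
          R ^ 2 * (wnorm (-(β - 1)) (𝓕⁻ φ : 𝓢(V, ℂ))).toReal) * R ^ k := by
          gcongr
          · exact e _ (by linarith)
          · exact e _ (by linarith)
      _ = _ := by ring

/-- Free waves are determined by their data. -/
lemma IsFreeWave.unique [Nontrivial V] {β : ℝ} (hβ0 : 0 < β) (hβ1 : β < 1)
    (hn : 2 ≤ Module.finrank ℝ V) {u₀ u₁ : 𝓢'(V, ℂ)} {u v u' v' : ℝ → 𝓢'(V, ℂ)}
    (h : IsFreeWave β u₀ u₁ u v) (h' : IsFreeWave β u₀ u₁ u' v') : u = u' ∧ v = v' := by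
  -- For band-limited `φ` all time derivatives of the difference vanish at `0` and grow at most
  -- geometrically in their order.
  have key : ∀ (φ : 𝓢(V, ℂ)), HasCompactSupport (𝓕⁻ φ : 𝓢(V, ℂ)) → ∀ s, u s φ = u' s φ := by
    intro φ hφ s
    obtain ⟨ρ, hρ⟩ := hφ.isCompact.isBounded.exists_norm_le
    set R : ℝ := max 1 (2 * Real.pi * ρ)
    have hR : 1 ≤ R := le_max_left _ _
    have hsupp : ∀ ξ : V, R < 2 * Real.pi * ‖ξ‖ → (𝓕⁻ φ : 𝓢(V, ℂ)) ξ = 0 := fun ξ hξ => by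
      by_contra hne
      have h1 := hρ ξ (subset_tsupport _ hne)
      have h2 : 2 * Real.pi * ‖ξ‖ ≤ 2 * Real.pi * ρ := by
        have := Real.pi_pos; gcongr
      exact absurd (hξ.trans_le h2) (not_lt.2 (le_max_right _ _))
    obtain ⟨M1, hM1, b1⟩ := exists_homSobolevENorm_le h.mem_left h.continuous_left |s|
    obtain ⟨M2, hM2, b2⟩ := exists_homSobolevENorm_le h.mem_right h.continuous_right |s|
    obtain ⟨M3, hM3, b3⟩ := exists_homSobolevENorm_le h'.mem_left h'.continuous_left |s|
    obtain ⟨M4, hM4, b4⟩ := exists_homSobolevENorm_le h'.mem_right h'.continuous_right |s|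
    have c1 := norm_waveSeq_le hβ0 hβ1 hn h.mem_left h.mem_right hR (max_lt hM1 hM2)
      (fun t ht => (b1 t ht).trans (le_max_left _ _)) (fun t ht => (b2 t ht).trans (le_max_right _ _))
    have c2 := norm_waveSeq_le hβ0 hβ1 hn h'.mem_left h'.mem_right hR (max_lt hM3 hM4)
      (fun t ht => (b3 t ht).trans (le_max_left _ _)) (fun t ht => (b4 t ht).trans (le_max_right _ _))
    set A := (wnorm (-β) (𝓕⁻ φ : 𝓢(V, ℂ))).toReal + (wnorm (-(β - 1)) (𝓕⁻ φ : 𝓢(V, ℂ))).toReal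
    have h0 := eq_zero_of_hasDerivAt_seq_of_abs_le
      (f := fun k r => waveSeq u v k φ r - waveSeq u' v' k φ r)
      (M := (max M1 M2).toReal * A + (max M3 M4).toReal * A) (R := R) (T := |s|)
      (fun k r => (h.hasDerivAt_waveSeq k φ r).sub (h'.hasDerivAt_waveSeq k φ r))
      (fun k => sub_eq_zero.2 (h.waveSeq_zero h' k φ))
      (fun k r hr => ?_) le_rfl
    · exact sub_eq_zero.1 h0
    · refine (norm_sub_le _ _).trans ((add_le_add (c1 k φ hsupp r hr) (c2 k φ hsupp r hr)).trans
        (le_of_eq ?_))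
      ring
  have hu : u = u' := by
    funext s
    have hd := (h.mem_left s).hasDensity
    have hd' := (h'.mem_left s).hasDensity
    -- Band-limited test functions are the transforms of compactly supported ones, and the latter
    -- determine the density of `𝓕 (u s)`.
    have e : (fun ξ => fourierDensity (u s) ξ - fourierDensity (u' s) ξ) =ᵐ[volume] 0 := by
      refine ae_eq_zero_of_forall_integral_mul_schwartz (hd.1.sub hd'.1) fun χ hχ => ?_
      have h1 := key (𝓕 χ) (by rwa [FourierTransform.fourierInv_fourier_eq]) s
      rw [(hd.apply_eq _).2, (hd'.apply_eq _).2, FourierTransform.fourierInv_fourier_eq] at h1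
      simp only [sub_mul]
      rw [integral_sub (hd.2 χ).1 (hd'.2 χ).1, h1, sub_self]
    have e2 : fourierDensity (u s) =ᵐ[volume] fourierDensity (u' s) :=
      e.mono fun ξ hξ => sub_eq_zero.1 hξ
    have h3 := (hd.congr e2).ext hd'
    have h4 := congrArg (fun T : 𝓢'(V, ℂ) => (𝓕⁻ T : 𝓢'(V, ℂ))) h3
    simpa only [FourierTransform.fourierInv_fourier_eq] using h4
  refine ⟨hu, ?_⟩
  funext s
  ext φ
  have d1 := h.deriv_left φ s
  rw [hu] at d1
  exact d1.unique (h'.deriv_left φ s)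

end Uniqueness

/-! ### Existence of free waves on the Fourier side -/

section Existence

variable {V : Type*} [NormedAddCommGroup V] [InnerProductSpace ℝ V] [FiniteDimensional ℝ V]
  [MeasurableSpace V] [BorelSpace V]

lemma HasDensity.fourier_inj {f f' : 𝓢'(V, ℂ)} {g : V → ℂ} (h : HasDensity (𝓕 f) g)
    (h' : HasDensity (𝓕 f') g) : f = f' := by
  have h4 := congrArg (fun T : 𝓢'(V, ℂ) => (𝓕⁻ T : 𝓢'(V, ℂ))) (h.ext h')
  simpa only [FourierTransform.fourierInv_fourier_eq] using h4

lemma phase_zero (ξ : V) : phase 0 ξ = 1 := by simp [phase]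

lemma hasDerivAt_phase (ξ : V) (t : ℝ) : HasDerivAt (fun t => phase t ξ)
    (-(((2 * Real.pi * ‖ξ‖ : ℝ) : ℂ) * Complex.I) * phase t ξ) t := by
  have h1 : HasDerivAt (fun t : ℝ => -(((2 * Real.pi * ‖ξ‖ * t : ℝ) : ℂ) * Complex.I))
      (-(((2 * Real.pi * ‖ξ‖ : ℝ) : ℂ) * Complex.I)) t := by
    have h2 : HasDerivAt (fun t : ℝ => 2 * Real.pi * ‖ξ‖ * t) (2 * Real.pi * ‖ξ‖) t := by
      simpa using (hasDerivAt_id t).const_mul (2 * Real.pi * ‖ξ‖)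
    convert! (h2.ofReal_comp.mul_const Complex.I).neg using 1
  convert! h1.cexp using 1
  rw [phase]; ring

/-- Dominated convergence for the squares: the phases differ by at most `2`, hence the majorant with
factor `4`. -/
lemma tendsto_wnorm_phase_sub {s : ℝ} {w : V → ℂ} (hw : AEStronglyMeasurable w volume)
    (hfin : wnorm s w < ∞) (t : ℝ) :
    Tendsto (fun τ => wnorm s fun ξ => (phase τ ξ - phase t ξ) * w ξ) (𝓝 t) (𝓝 0) := by
  have hsq : Tendsto (fun τ => ∫⁻ ξ, ‖(wt s ξ : ℂ) * ((phase τ ξ - phase t ξ) * w ξ)‖ₑ ^ 2)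
      (𝓝 t) (𝓝 (∫⁻ _ : V, 0)) := by
    refine tendsto_lintegral_filter_of_dominated_convergence'
      (fun ξ => 4 * ‖(wt s ξ : ℂ) * w ξ‖ₑ ^ 2) ?_ ?_ ?_ ?_
    · refine Eventually.of_forall fun τ => AEMeasurable.pow_const (AEStronglyMeasurable.enorm ?_) _
      exact aestronglyMeasurable_wt_mul s (((continuous_phase τ).sub
        (continuous_phase t)).aestronglyMeasurable.mul hw)
    · refine Eventually.of_forall fun τ => ae_of_all _ fun ξ => ?_
      have h2 : ‖phase τ ξ - phase t ξ‖ₑ ≤ 2 := by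
        rw [← ofReal_norm, ← ENNReal.ofReal_ofNat 2]
        refine ENNReal.ofReal_le_ofReal ((norm_sub_le _ _).trans ?_)
        rw [norm_phase, norm_phase]; norm_num
      rw [mul_left_comm, enorm_mul, mul_pow]
      refine mul_le_mul_left ?_ _
      calc _ ≤ (2 : ℝ≥0∞) ^ 2 := pow_le_pow_left' h2 2
        _ = 4 := by norm_num
    · rw [lintegral_const_mul' _ _ (by simp), ← wnorm_sq]
      exact (ENNReal.mul_lt_top (by simp) (ENNReal.pow_lt_top hfin)).ne
    · refine ae_of_all _ fun ξ => ?_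
      have h1 : Tendsto (fun τ => (wt s ξ : ℂ) * ((phase τ ξ - phase t ξ) * w ξ)) (𝓝 t)
          (𝓝 ((wt s ξ : ℂ) * ((phase t ξ - phase t ξ) * w ξ))) :=
        (((hasDerivAt_phase ξ t).continuousAt.tendsto.sub_const _).mul_const _).const_mul _
      have h2 := (ENNReal.continuous_pow 2).continuousAt.tendsto.comp h1.enorm
      simpa [Function.comp_def] using h2
  rw [lintegral_zero] at hsq
  have h3 := (ENNReal.continuous_rpow_const (y := 1 / 2)).continuousAt.tendsto.comp hsq
  rw [ENNReal.zero_rpow_of_pos (by norm_num)] at h3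
  refine h3.congr fun τ => ?_
  simp only [Function.comp]
  rw [← wnorm_sq, ← ENNReal.rpow_natCast, ← ENNReal.rpow_mul]
  simp

/-- Differentiation under the integral sign; `hg1` makes the factor `2π|ξ|` integrable against `w
g`. -/
lemma hasDerivAt_integral_phase [Nontrivial V] {s : ℝ} {w g : V → ℂ}
    (hw : AEStronglyMeasurable w volume)
    (hwfin : wnorm s w < ∞) (hg : AEStronglyMeasurable g volume) (hg0 : wnorm (-s) g < ∞)
    (hg1 : wnorm (-s) (fun ξ => ((2 * Real.pi * ‖ξ‖ : ℝ) : ℂ) * g ξ) < ∞) (t : ℝ) :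
    HasDerivAt (fun τ => ∫ ξ, phase τ ξ * w ξ * g ξ)
      (∫ ξ, -(((2 * Real.pi * ‖ξ‖ : ℝ) : ℂ) * Complex.I) * (phase t ξ * w ξ * g ξ)) t := by
  have m1 : Measurable fun ξ : V => ((2 * Real.pi * ‖ξ‖ : ℝ) : ℂ) := by fun_prop
  have i0 := (integrable_mul_of_wnorm hw hg hwfin hg0).1
  have i1 := (integrable_mul_of_wnorm hw (m1.aestronglyMeasurable.mul hg) hwfin hg1).1
  have mt : ∀ τ : ℝ, AEStronglyMeasurable (fun ξ => phase τ ξ * w ξ * g ξ) volume := fun τ =>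
    ((continuous_phase τ).aestronglyMeasurable.mul hw).mul hg
  refine (hasDerivAt_integral_of_dominated_loc_of_deriv_le (s := Set.univ) univ_mem
    (F' := fun τ ξ => -(((2 * Real.pi * ‖ξ‖ : ℝ) : ℂ) * Complex.I) * (phase τ ξ * w ξ * g ξ))
    (bound := fun ξ => ‖w ξ * (((2 * Real.pi * ‖ξ‖ : ℝ) : ℂ) * g ξ)‖)
    (Eventually.of_forall mt) ?_ ?_ ?_ i1.norm ?_).2
  · refine i0.mono (mt t) (ae_of_all _ fun ξ => le_of_eq ?_)
    rw [norm_mul, norm_mul, norm_mul, norm_phase, one_mul]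
  · exact ((by fun_prop : Measurable fun ξ : V => -(((2 * Real.pi * ‖ξ‖ : ℝ) : ℂ) * Complex.I))
      |>.aestronglyMeasurable).mul (mt t)
  · refine ae_of_all _ fun ξ τ _ => le_of_eq ?_
    rw [norm_mul, norm_mul, norm_mul, norm_mul, norm_mul, norm_neg, norm_mul, norm_phase,
      Complex.norm_I]
    ring
  · refine ae_of_all _ fun ξ τ _ => ?_
    convert! ((hasDerivAt_phase ξ τ).mul_const (w ξ)).mul_const (g ξ) using 1
    ring

/-- Fourier transform of the data of the half wave `(∂ₜ - σ i|∇|) u`. -/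
def halfData (σ : ℝ) (u₀ u₁ : 𝓢'(V, ℂ)) (ξ : V) : ℂ :=
  fourierDensity u₁ ξ - σ * Complex.I * ((2 * Real.pi * ‖ξ‖ : ℝ) : ℂ) * fourierDensity u₀ ξ

/-- The Fourier transform of the free wave at time `t`. -/
def waveHat (u₀ u₁ : 𝓢'(V, ℂ)) (t : ℝ) (ξ : V) : ℂ :=
  (phase t ξ * halfData 1 u₀ u₁ ξ - phase (-t) ξ * halfData (-1) u₀ u₁ ξ) *
    (Complex.I / (2 * ((2 * Real.pi * ‖ξ‖ : ℝ) : ℂ)))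

/-- The Fourier transform of the time derivative of the free wave at time `t`. -/
def velHat (u₀ u₁ : 𝓢'(V, ℂ)) (t : ℝ) (ξ : V) : ℂ :=
  (phase t ξ * halfData 1 u₀ u₁ ξ + phase (-t) ξ * halfData (-1) u₀ u₁ ξ) * (1 / 2)

lemma aestronglyMeasurable_halfData {β : ℝ} {u₀ u₁ : 𝓢'(V, ℂ)} (h₀ : MemHomSobolev β u₀)
    (h₁ : MemHomSobolev (β - 1) u₁) (σ : ℝ) :
    AEStronglyMeasurable (halfData σ u₀ u₁) volume := by
  refine h₁.aestronglyMeasurable.sub (AEStronglyMeasurable.mul ?_ h₀.aestronglyMeasurable)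
  exact (by fun_prop : Measurable fun ξ : V => σ * Complex.I * ((2 * Real.pi * ‖ξ‖ : ℝ) : ℂ))
    |>.aestronglyMeasurable

lemma wnorm_norm_mul [Nontrivial V] (s : ℝ) (g : V → ℂ) :
    wnorm s (fun ξ => ((2 * Real.pi * ‖ξ‖ : ℝ) : ℂ) * g ξ) = wnorm (s + 1) g := by
  refine eLpNorm_congr_ae ?_
  filter_upwards [ae_ne_zero (V := V)] with ξ hξ
  rw [← mul_assoc, ← Complex.ofReal_mul, ← wt_one, ← wt_add s 1 hξ]

lemma wnorm_halfData_lt_top [Nontrivial V] {β : ℝ} {u₀ u₁ : 𝓢'(V, ℂ)} (h₀ : MemHomSobolev β u₀)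
    (h₁ : MemHomSobolev (β - 1) u₁) (σ : ℝ) : wnorm (β - 1) (halfData σ u₀ u₁) < ∞ := by
  have m1 : Measurable fun ξ : V => ((2 * Real.pi * ‖ξ‖ : ℝ) : ℂ) := by fun_prop
  have e : halfData σ u₀ u₁ = fun ξ => fourierDensity u₁ ξ +
      -(σ * Complex.I) * (((2 * Real.pi * ‖ξ‖ : ℝ) : ℂ) * fourierDensity u₀ ξ) := by
    ext ξ; rw [halfData]; ring
  rw [e]
  refine (wnorm_add_le h₁.aestronglyMeasurable
    ((m1.aestronglyMeasurable.mul h₀.aestronglyMeasurable).const_mul _)).trans_lt ?_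
  have h2 := wnorm_const_mul (β - 1) (-(σ * Complex.I))
    (fun ξ => ((2 * Real.pi * ‖ξ‖ : ℝ) : ℂ) * fourierDensity u₀ ξ)
  rw [wnorm_norm_mul, sub_add_cancel] at h2
  refine ENNReal.add_lt_top.2 ⟨h₁.wnorm_lt_top, ?_⟩
  erw [h2]
  exact ENNReal.mul_lt_top enorm_lt_top h₀.wnorm_lt_top

/-- Off the origin, dividing by `2π|ξ|` trades one order of the weight; this is how data of order `β
- 1` yield a wave of order `β`. -/
lemma wnorm_inv_norm_mul [Nontrivial V] (s : ℝ) (g : V → ℂ) :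
    wnorm s (fun ξ => g ξ * (Complex.I / (2 * ((2 * Real.pi * ‖ξ‖ : ℝ) : ℂ)))) =
      2⁻¹ * wnorm (s - 1) g := by
  have h := wnorm_const_mul (s - 1) (2⁻¹ : ℂ) g
  have e2 : ‖(2⁻¹ : ℂ)‖ₑ = 2⁻¹ := by
    rw [enorm_inv (by norm_num)]; congr 1; rw [← ofReal_norm]; simp
  rw [e2] at h
  rw [← h]
  refine eLpNorm_congr_norm_ae ?_
  filter_upwards [ae_ne_zero (V := V)] with ξ hξ
  have hpos : 0 < 2 * Real.pi * ‖ξ‖ := by have := norm_pos_iff.2 hξ; positivity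
  have h3 : wt s ξ = wt (s - 1) ξ * (2 * Real.pi * ‖ξ‖) := by
    rw [← wt_one, ← wt_add _ _ hξ, sub_add_cancel]
  rw [h3]
  simp only [norm_mul, norm_div, Complex.norm_real, Complex.norm_I, norm_inv]
  rw [Real.norm_of_nonneg (Real.pi_pos.le)]
  simp
  have := norm_pos_iff.2 hξ
  field_simp

lemma hasDerivAt_integral_phase_add [Nontrivial V] {s : ℝ} {w w' g : V → ℂ} (α : ℂ)
    (hw : AEStronglyMeasurable w volume) (hwfin : wnorm s w < ∞)
    (hw' : AEStronglyMeasurable w' volume) (hwfin' : wnorm s w' < ∞)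
    (hg : AEStronglyMeasurable g volume) (hg0 : wnorm (-s) g < ∞)
    (hg1 : wnorm (-s) (fun ξ => ((2 * Real.pi * ‖ξ‖ : ℝ) : ℂ) * g ξ) < ∞) (t : ℝ) :
    HasDerivAt (fun τ => ∫ ξ, (phase τ ξ * w ξ + α * (phase (-τ) ξ * w' ξ)) * g ξ)
      (∫ ξ, -(((2 * Real.pi * ‖ξ‖ : ℝ) : ℂ) * Complex.I) *
        ((phase t ξ * w ξ - α * (phase (-t) ξ * w' ξ)) * g ξ)) t := by
  have m1 : Measurable fun ξ : V => ((2 * Real.pi * ‖ξ‖ : ℝ) : ℂ) := by fun_prop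
  have hint : ∀ (w : V → ℂ), AEStronglyMeasurable w volume → wnorm s w < ∞ → ∀ τ : ℝ,
      Integrable (fun ξ => phase τ ξ * w ξ * g ξ) ∧
      Integrable (fun ξ => -(((2 * Real.pi * ‖ξ‖ : ℝ) : ℂ) * Complex.I) *
        (phase τ ξ * w ξ * g ξ)) := fun w hw hf τ => by
    have a1 := (continuous_phase τ).aestronglyMeasurable.mul hw
    have a2 : wnorm s (fun ξ => phase τ ξ * w ξ) < ∞ := by rwa [norm_phase_mul_le]
    refine ⟨(integrable_mul_of_wnorm a1 hg a2 hg0).1, ?_⟩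
    have := (integrable_mul_of_wnorm a1 (m1.aestronglyMeasurable.mul hg) a2 hg1).1.const_mul
      (-Complex.I)
    refine this.congr (ae_of_all _ fun ξ => ?_)
    simp only [Pi.mul_apply]; ring
  have h1 := hasDerivAt_integral_phase hw hwfin hg hg0 hg1 t
  have h2 := ((hasDerivAt_integral_phase hw' hwfin' hg hg0 hg1 (-t)).scomp t
    (hasDerivAt_neg t)).const_mul α
  have h3 := h1.add h2
  convert! h3 using 1
  · funext τ
    simp only [Pi.add_apply, Function.comp]
    rw [← integral_const_mul, ← integral_add (hint w hw hwfin τ).1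
      ((hint w' hw' hwfin' (-τ)).1.const_mul α)]
    congr 1; ext ξ; ring
  · rw [neg_one_smul, mul_neg, ← sub_eq_add_neg, ← integral_const_mul,
      ← integral_sub (hint w hw hwfin t).2 ((hint w' hw' hwfin' (-t)).2.const_mul α)]
    congr 1; ext ξ; ring

/-- Existence of free waves, with their Fourier transforms. -/
lemma exists_isFreeWave [Nontrivial V] {β : ℝ} (hβ0 : 0 < β) (hβ1 : β < 1)
    (hn : 2 ≤ Module.finrank ℝ V) {u₀ u₁ : 𝓢'(V, ℂ)}
    (h₀ : MemHomSobolev β u₀) (h₁ : MemHomSobolev (β - 1) u₁) :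
    ∃ u v : ℝ → 𝓢'(V, ℂ), IsFreeWave β u₀ u₁ u v ∧
      (∀ t, HasDensity (𝓕 (u t)) (waveHat u₀ u₁ t)) ∧
      ∀ t, HasDensity (𝓕 (v t)) (velHat u₀ u₁ t) := by
  have hn' : (2 : ℝ) ≤ Module.finrank ℝ V := by exact_mod_cast hn
  have m1 : Measurable fun ξ : V => Complex.I / (2 * ((2 * Real.pi * ‖ξ‖ : ℝ) : ℂ)) := by fun_prop
  set w := halfData 1 u₀ u₁
  set w' := halfData (-1) u₀ u₁
  have hw := aestronglyMeasurable_halfData h₀ h₁ 1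
  have hw' := aestronglyMeasurable_halfData h₀ h₁ (-1)
  have hwf := wnorm_halfData_lt_top h₀ h₁ 1
  have hwf' := wnorm_halfData_lt_top h₀ h₁ (-1)
  have hpw : ∀ t : ℝ, AEStronglyMeasurable (fun ξ => phase t ξ * w ξ) volume := fun t =>
    (continuous_phase t).aestronglyMeasurable.mul hw
  have hpw' : ∀ t : ℝ, AEStronglyMeasurable (fun ξ => phase t ξ * w' ξ) volume := fun t =>
    (continuous_phase t).aestronglyMeasurable.mul hw'
  have hneg : ∀ {s : ℝ} (g : V → ℂ), wnorm s (fun ξ => -g ξ) = wnorm s g := fun g =>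
    eLpNorm_congr_norm_ae (ae_of_all _ fun ξ => by rw [mul_neg, norm_neg])
  have hsum : ∀ {s : ℝ} {f g : V → ℂ}, AEStronglyMeasurable f volume →
      AEStronglyMeasurable g volume → wnorm s (fun ξ => f ξ - g ξ) ≤ wnorm s f + wnorm s g := by
    intro s f g hf hg
    have := wnorm_add_le (s := s) hf hg.neg
    simp only [Pi.neg_apply, ← sub_eq_add_neg] at this
    refine this.trans (le_of_eq ?_)
    congr 1
    exact hneg g
  have hhalf : ∀ {s : ℝ} (g : V → ℂ), wnorm s (fun ξ => g ξ * (1 / 2)) = ‖(1 / 2 : ℂ)‖ₑ * wnorm s g :=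
    fun {s} g => by rw [← wnorm_const_mul]; congr 1; ext ξ; ring
  have mu : ∀ t, AEStronglyMeasurable (waveHat u₀ u₁ t) volume := fun t =>
    ((hpw t).sub (hpw' (-t))).mul m1.aestronglyMeasurable
  have mv : ∀ t, AEStronglyMeasurable (velHat u₀ u₁ t) volume := fun t =>
    ((hpw t).add (hpw' (-t))).mul_const _
  have hpf : ∀ t : ℝ, wnorm (β - 1) (fun ξ => phase t ξ * w ξ) < ∞ := fun t => by
    rwa [norm_phase_mul_le]
  have hpf' : ∀ t : ℝ, wnorm (β - 1) (fun ξ => phase t ξ * w' ξ) < ∞ := fun t => by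
    rwa [norm_phase_mul_le]
  have fu : ∀ t, wnorm β (waveHat u₀ u₁ t) < ∞ := fun t => by
    unfold waveHat
    rw [wnorm_inv_norm_mul]
    exact ENNReal.mul_lt_top (by simp) ((hsum (hpw t) (hpw' (-t))).trans_lt
      (ENNReal.add_lt_top.2 ⟨hpf t, hpf' (-t)⟩))
  have fv : ∀ t, wnorm (β - 1) (velHat u₀ u₁ t) < ∞ := fun t => by
    unfold velHat
    rw [hhalf]
    exact ENNReal.mul_lt_top enorm_lt_top ((wnorm_add_le (hpw t) (hpw' (-t))).trans_lt
      (ENNReal.add_lt_top.2 ⟨hpf t, hpf' (-t)⟩))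
  -- Both orders are below half the dimension, as `β < 1` and the dimension is at least two, so the
  -- formulas define tempered distributions.
  choose U hU using fun t => exists_hasDensity_of_wnorm (by linarith) (mu t) (fu t)
  choose W hW using fun t => exists_hasDensity_of_wnorm (by linarith) (mv t) (fv t)
  have dU : ∀ t, HasDensity (𝓕 (𝓕⁻ (U t) : 𝓢'(V, ℂ))) (waveHat u₀ u₁ t) := fun t => by
    rw [FourierTransform.fourier_fourierInv_eq]; exact hU t
  have dW : ∀ t, HasDensity (𝓕 (𝓕⁻ (W t) : 𝓢'(V, ℂ))) (velHat u₀ u₁ t) := fun t => by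
    rw [FourierTransform.fourier_fourierInv_eq]; exact hW t
  have hne := ae_ne_zero (V := V)
  have hpos : ∀ ξ : V, ξ ≠ 0 → ((2 * Real.pi * ‖ξ‖ : ℝ) : ℂ) ≠ 0 := fun ξ hξ => by
    have := norm_pos_iff.2 hξ
    exact_mod_cast (by positivity : 0 < 2 * Real.pi * ‖ξ‖).ne'
  have hdiff : ∀ {F F' : 𝓢'(V, ℂ)} {g g' : V → ℂ}, HasDensity (𝓕 F) g → HasDensity (𝓕 F') g' →
      HasDensity (𝓕 (F - F')) fun ξ => g ξ - g' ξ := fun h h' => by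
    rw [sub_eq_add_neg, FourierTransform.fourier_add, FourierTransform.fourier_neg,
      ← sub_eq_add_neg]
    exact h.sub h'
  have lim : ∀ t : ℝ, Tendsto (fun τ : ℝ => wnorm (β - 1) (fun ξ => (phase τ ξ - phase t ξ) * w ξ) +
      wnorm (β - 1) (fun ξ => (phase (-τ) ξ - phase (-t) ξ) * w' ξ)) (𝓝 t) (𝓝 0) := fun t => by
    have h1 := (tendsto_wnorm_phase_sub hw hwf t).add
      ((tendsto_wnorm_phase_sub hw' hwf' (-t)).comp (continuous_neg.tendsto t))
    rw [add_zero] at h1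
    exact h1
  have mdiff : ∀ τ t : ℝ, AEStronglyMeasurable (fun ξ => (phase τ ξ - phase t ξ) * w ξ) volume :=
    fun τ t => ((continuous_phase τ).sub (continuous_phase t)).aestronglyMeasurable.mul hw
  have mdiff' : ∀ τ t : ℝ, AEStronglyMeasurable (fun ξ => (phase τ ξ - phase t ξ) * w' ξ) volume :=
    fun τ t => ((continuous_phase τ).sub (continuous_phase t)).aestronglyMeasurable.mul hw'
  refine ⟨fun t => 𝓕⁻ (U t), fun t => 𝓕⁻ (W t), ?_, dU, dW⟩
  refine ⟨fun t => ?_, fun t => ?_, fun t => ?_, fun t => ?_, fun φ t => ?_, fun φ t => ?_, ?_, ?_⟩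
  · rw [MemHomSobolev, homSobolevENorm_eq (dU t)]; exact fu t
  · rw [MemHomSobolev, homSobolevENorm_eq (dW t)]; exact fv t
  · refine tendsto_of_tendsto_of_tendsto_of_le_of_le tendsto_const_nhds (lim t)
      (fun _ => zero_le) fun τ => ?_
    beta_reduce
    rw [homSobolevENorm_eq (hdiff (dU τ) (dU t))]
    have e : (fun ξ => waveHat u₀ u₁ τ ξ - waveHat u₀ u₁ t ξ) = fun ξ =>
        ((phase τ ξ - phase t ξ) * w ξ - (phase (-τ) ξ - phase (-t) ξ) * w' ξ) *
          (Complex.I / (2 * ((2 * Real.pi * ‖ξ‖ : ℝ) : ℂ))) := by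
      ext ξ; simp only [waveHat, w, w']; ring
    rw [e, wnorm_inv_norm_mul]
    refine le_trans ?_ (hsum (mdiff τ t) (mdiff' (-τ) (-t)))
    exact mul_le_of_le_one_left zero_le (by simp)
  · refine tendsto_of_tendsto_of_tendsto_of_le_of_le tendsto_const_nhds (lim t)
      (fun _ => zero_le) fun τ => ?_
    beta_reduce
    rw [homSobolevENorm_eq (hdiff (dW τ) (dW t))]
    have e : (fun ξ => velHat u₀ u₁ τ ξ - velHat u₀ u₁ t ξ) = fun ξ =>
        ((phase τ ξ - phase t ξ) * w ξ + (phase (-τ) ξ - phase (-t) ξ) * w' ξ) * (1 / 2) := by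
      ext ξ; simp only [velHat, w, w']; ring
    rw [e, hhalf]
    refine le_trans ?_ (wnorm_add_le (mdiff τ t) (mdiff' (-τ) (-t)))
    refine mul_le_of_le_one_left zero_le ?_
    rw [← ofReal_norm, ENNReal.ofReal_le_one]; norm_num
  · set ψ : 𝓢(V, ℂ) := 𝓕⁻ φ
    have mψ := ψ.continuous.aestronglyMeasurable (μ := (volume : Measure V))
    have h := hasDerivAt_integral_phase_add (s := β - 1)
      (g := fun ξ => ψ ξ * (Complex.I / (2 * ((2 * Real.pi * ‖ξ‖ : ℝ) : ℂ)))) (-1) hw hwf hw' hwf'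
      (mψ.mul m1.aestronglyMeasurable) (by
        rw [wnorm_inv_norm_mul]
        exact ENNReal.mul_lt_top (by simp) (wnorm_schwartz_lt_top (by linarith) _)) (by
        rw [wnorm_norm_mul, wnorm_inv_norm_mul]
        exact ENNReal.mul_lt_top (by simp) (wnorm_schwartz_lt_top (by linarith) _)) t
    have e1 : (fun τ => (𝓕⁻ (U τ) : 𝓢'(V, ℂ)) φ) = fun τ => ∫ ξ, (phase τ ξ * w ξ +
        (-1) * (phase (-τ) ξ * w' ξ)) * (ψ ξ * (Complex.I / (2 * ((2 * Real.pi * ‖ξ‖ : ℝ) : ℂ)))) := by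
      funext τ
      rw [((dU τ).apply_eq φ).2]
      congr 1; ext ξ; simp only [waveHat, w, w', ψ]; ring
    have e2 : (𝓕⁻ (W t) : 𝓢'(V, ℂ)) φ = ∫ ξ, -(((2 * Real.pi * ‖ξ‖ : ℝ) : ℂ) * Complex.I) *
        ((phase t ξ * w ξ - (-1) * (phase (-t) ξ * w' ξ)) *
          (ψ ξ * (Complex.I / (2 * ((2 * Real.pi * ‖ξ‖ : ℝ) : ℂ))))) := by
      rw [((dW t).apply_eq φ).2]
      refine integral_congr_ae ?_
      filter_upwards [hne] with ξ hξ
      have := hpos ξ hξ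
      simp only [velHat]
      field_simp
      linear_combination (phase t ξ * w ξ + phase (-t) ξ * w' ξ) * ψ ξ * Complex.I_sq
    rw [e1, e2]
    exact h
  · set ψ : 𝓢(V, ℂ) := 𝓕⁻ φ
    have mψ := ψ.continuous.aestronglyMeasurable (μ := (volume : Measure V))
    have hψ : ∀ s : ℝ, -(Module.finrank ℝ V : ℝ) < 2 * s → wnorm s (fun ξ => ψ ξ * (1 / 2)) < ∞ :=
      fun s hs => by
        rw [hhalf]; exact ENNReal.mul_lt_top enorm_lt_top (wnorm_schwartz_lt_top hs _)
    have h := hasDerivAt_integral_phase_add (s := β - 1)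
      (g := fun ξ => ψ ξ * (1 / 2)) 1 hw hwf hw' hwf'
      (mψ.mul_const _) (hψ _ (by linarith)) (by
        rw [wnorm_norm_mul]
        exact hψ _ (by linarith)) t
    have e1 : (fun τ => (𝓕⁻ (W τ) : 𝓢'(V, ℂ)) φ) = fun τ => ∫ ξ, (phase τ ξ * w ξ +
        1 * (phase (-τ) ξ * w' ξ)) * (ψ ξ * (1 / 2)) := by
      funext τ
      rw [((dW τ).apply_eq φ).2]
      congr 1; ext ξ; simp only [velHat, w, w', ψ]; ring
    have e2 : (Δ (𝓕⁻ (U t) : 𝓢'(V, ℂ))) φ = ∫ ξ, -(((2 * Real.pi * ‖ξ‖ : ℝ) : ℂ) * Complex.I) *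
        ((phase t ξ * w ξ - 1 * (phase (-t) ξ * w' ξ)) * (ψ ξ * (1 / 2))) := by
      rw [TemperedDistribution.laplacian_apply_apply, ((dU t).apply_eq _).2]
      refine integral_congr_ae ?_
      filter_upwards [hne] with ξ hξ
      have := hpos ξ hξ
      rw [fourierInv_laplacian_apply]
      simp only [waveHat, ψ]
      field_simp
      simp only [w, w']
      ring
    rw [e1, e2]
    exact h
  · refine HasDensity.fourier_inj (dU 0) (h₀.hasDensity.congr ?_)
    filter_upwards [hne] with ξ hξ
    have := hpos ξ hξ
    simp only [waveHat, halfData, neg_zero, phase_zero]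
    field_simp
    push_cast
    linear_combination (4 * Real.pi * ‖ξ‖ * fourierDensity u₀ ξ) * Complex.I_sq
  · refine HasDensity.fourier_inj (dW 0) (h₁.hasDensity.congr (ae_of_all _ fun ξ => ?_))
    simp only [velHat, halfData, neg_zero, phase_zero]
    push_cast
    ring

end Existence

/-! ### Conjugation and direction multipliers -/

section Glue

variable {d : ℕ}

/-- The complex conjugate of a Schwartz function. -/
def conjSchwartz {V : Type*} [NormedAddCommGroup V] [NormedSpace ℝ V] (φ : 𝓢(V, ℂ)) : 𝓢(V, ℂ) :=
  SchwartzMap.postcompCLM (𝕜 := ℝ) (Complex.conjCLE : ℂ →L[ℝ] ℂ) φ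

lemma conjSchwartz_apply {V : Type*} [NormedAddCommGroup V] [NormedSpace ℝ V] (φ : 𝓢(V, ℂ))
    (x : V) : conjSchwartz φ x = (starRingEnd ℂ) (φ x) := by
  simp [conjSchwartz]

lemma fourierInv_conj {V : Type*} [NormedAddCommGroup V] [InnerProductSpace ℝ V]
    [FiniteDimensional ℝ V] [MeasurableSpace V] [BorelSpace V] (f : V → ℂ) (x : V) :
    𝓕⁻ (fun y => (starRingEnd ℂ) (f y)) x = (starRingEnd ℂ) (𝓕⁻ f (-x)) := by
  rw [Real.fourierInv_eq', Real.fourierInv_eq', ← integral_conj]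
  congr 1; ext y
  rw [smul_eq_mul, smul_eq_mul, map_mul, ← Complex.exp_conj, inner_neg_right, map_mul,
    Complex.conj_ofReal, Complex.conj_I]
  congr 2
  push_cast; ring

lemma fourierInv_conjSchwartz_apply {V : Type*} [NormedAddCommGroup V] [InnerProductSpace ℝ V]
    [FiniteDimensional ℝ V] [MeasurableSpace V] [BorelSpace V] (φ : 𝓢(V, ℂ)) (x : V) :
    (𝓕⁻ (conjSchwartz φ) : 𝓢(V, ℂ)) x = (starRingEnd ℂ) ((𝓕⁻ φ : 𝓢(V, ℂ)) (-x)) := by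
  rw [SchwartzMap.fourierInv_coe, SchwartzMap.fourierInv_coe, ← fourierInv_conj]
  congr 1

lemma wnorm_conj {V : Type*} [NormedAddCommGroup V] [InnerProductSpace ℝ V]
    [FiniteDimensional ℝ V] [MeasurableSpace V] [BorelSpace V] (s : ℝ) (f : V → ℂ) :
    wnorm s (fun x => (starRingEnd ℂ) (f x)) = wnorm s f :=
  eLpNorm_congr_norm_ae (ae_of_all _ fun x => by rw [norm_mul, norm_mul, RCLike.norm_conj])

lemma wnorm_fourierInv_conjSchwartz {V : Type*} [NormedAddCommGroup V] [InnerProductSpace ℝ V]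
    [FiniteDimensional ℝ V] [MeasurableSpace V] [BorelSpace V] (s : ℝ) (φ : 𝓢(V, ℂ)) :
    wnorm s (𝓕⁻ (conjSchwartz φ) : 𝓢(V, ℂ)) = wnorm s (𝓕⁻ φ : 𝓢(V, ℂ)) := by
  have h : ((𝓕⁻ (conjSchwartz φ) : 𝓢(V, ℂ)) : V → ℂ) =
      fun x => (starRingEnd ℂ) ((𝓕⁻ φ : 𝓢(V, ℂ)) (-x)) :=
    funext fun x => fourierInv_conjSchwartz_apply φ x
  rw [h, wnorm_conj, wnorm_neg_arg s (𝓕⁻ φ : 𝓢(V, ℂ)).continuous.aestronglyMeasurable]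

/-- The components of `(1, -σ ξ/|ξ|)`. -/
def dirMul (σ : ℝ) (k : Fin (d + 1)) (ξ : EuclideanSpace ℝ (Fin d)) : ℝ :=
  (Fin.cons 1 fun j : Fin d => -σ * (‖ξ‖⁻¹ * ξ j) : Fin (d + 1) → ℝ) k

lemma dirMul_smul (σ : ℝ) (k : Fin (d + 1)) (ω : UnitSphere d) {r : ℝ} (hr : 0 < r) :
    dirMul σ k (r • (ω : EuclideanSpace ℝ (Fin d))) = directionCoeff σ ω k := by
  have h1 : ‖r • (ω : EuclideanSpace ℝ (Fin d))‖ = r := by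
    rw [norm_smul]; simp [hr.le]
  refine Fin.cases ?_ (fun j => ?_) k
  · simp [dirMul, directionCoeff]
  · simp only [dirMul, directionCoeff, Fin.cons_succ, h1, PiLp.smul_apply, smul_eq_mul]
    rw [inv_mul_cancel_left₀ hr.ne']

lemma measurable_dirMul (σ : ℝ) (k : Fin (d + 1)) :
    Measurable (dirMul σ k : EuclideanSpace ℝ (Fin d) → ℝ) := by
  refine Fin.cases ?_ (fun j => ?_) k
  · exact (measurable_const : Measurable fun _ : EuclideanSpace ℝ (Fin d) => (1 : ℝ))
  · exact (by fun_prop : Measurable fun ξ : EuclideanSpace ℝ (Fin d) => -σ * (‖ξ‖⁻¹ * ξ j))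

lemma abs_dirMul_le {σ : ℝ} (hσ : |σ| ≤ 1) (k : Fin (d + 1)) (ξ : EuclideanSpace ℝ (Fin d)) :
    |dirMul σ k ξ| ≤ 1 := by
  refine Fin.cases ?_ (fun j => ?_) k
  · simp [dirMul]
  · simp only [dirMul, Fin.cons_succ, abs_mul, abs_neg, abs_inv, abs_norm]
    have h1 : |ξ j| ≤ ‖ξ‖ := PiLp.norm_apply_le ξ j
    have h2 : ‖ξ‖⁻¹ * |ξ j| ≤ 1 := by
      rw [inv_mul_eq_div]; exact div_le_one_of_le₀ h1 (norm_nonneg _)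
    exact mul_le_one₀ hσ (by positivity) h2

lemma wnorm_dirMul_mul_le {σ : ℝ} (hσ : |σ| ≤ 1) (k : Fin (d + 1)) (s : ℝ)
    (w : EuclideanSpace ℝ (Fin d) → ℂ) :
    wnorm s (fun ξ => (dirMul σ k ξ : ℂ) * w ξ) ≤ wnorm s w := by
  refine wnorm_mono (ae_of_all _ fun ξ => mul_le_mul_of_nonneg_left ?_ (wt_nonneg _ _))
  rw [norm_mul, Complex.norm_real]
  exact mul_le_of_le_one_left (norm_nonneg _) (abs_dirMul_le hσ k ξ)

lemma aestronglyMeasurable_dirMul_mul (σ : ℝ) (k : Fin (d + 1))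
    {w : EuclideanSpace ℝ (Fin d) → ℂ} (hw : AEStronglyMeasurable w volume) :
    AEStronglyMeasurable (fun ξ => (dirMul σ k ξ : ℂ) * w ξ) volume :=
  (Complex.measurable_ofReal.comp (measurable_dirMul σ k)).aestronglyMeasurable.mul hw

/-- Conjugating twice reaches the negative frequencies of the ray, with the conjugate phase, so that
one operator serves both halves of the profile. -/
lemma outgoing_conjSchwartz_smul (φ : 𝓢(EuclideanSpace ℝ (Fin d), ℂ))
    {θ : EuclideanSpace ℝ (Fin d)} (hθ : ‖θ‖ = 1) {r : ℝ} (hr : 0 < r) :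
    (starRingEnd ℂ) (outgoing (conjSchwartz φ) (r • θ)) =
      Complex.exp (Complex.I * (((d : ℝ) - 1) / 4 * Real.pi : ℝ)) *
        (((r ^ (((d : ℝ) - 1) / 2))⁻¹ : ℝ) : ℂ) * 𝓕⁻ (radialPull φ θ) (-r) := by
  have h : radialPull (conjSchwartz φ) θ = fun s => (starRingEnd ℂ) (radialPull φ θ s) := by
    ext s
    simp only [radialPull, conjSchwartz_apply]
    split_ifs <;> simp
  rw [outgoing_smul _ hθ hr, h, fourierInv_conj, map_mul, map_mul, Complex.conj_conj,
    Complex.conj_ofReal, ← Complex.exp_conj, map_neg, map_mul, Complex.conj_ofReal,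
    Complex.conj_I, neg_mul, neg_neg]

end Glue

/-! ### The radiation profile along lines -/

section Profile

variable {d : ℕ}

lemma integral_eq_integral_Ioi_add {g : ℝ → ℂ} (h1 : IntegrableOn g (Set.Ioi 0))
    (h2 : IntegrableOn (fun κ => g (-κ)) (Set.Ioi 0)) :
    Integrable g ∧ ∫ κ, g κ = (∫ κ in Set.Ioi 0, g κ) + ∫ κ in Set.Ioi 0, g (-κ) := by
  have h3 : IntegrableOn g (Set.Iic 0) := by
    have h4 := (Measure.measurePreserving_neg (volume : Measure ℝ)).integrableOn_comp_preimage
      (Homeomorph.neg ℝ).measurableEmbedding (f := g) (s := Set.Iio 0)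
    rw [Set.neg_preimage, Set.neg_Iio, neg_zero] at h4
    exact (integrableOn_Iic_iff_integrableOn_Iio).2 (h4.1 h2)
  constructor
  · rw [← integrableOn_univ, ← Set.Iic_union_Ioi (a := (0 : ℝ))]
    exact h3.union h1
  · have h5 := setIntegral_union (Set.Iic_disjoint_Ioi le_rfl) measurableSet_Ioi h3 h1
    rw [Set.Iic_union_Ioi, setIntegral_univ] at h5
    rw [h5, integral_comp_neg_Ioi, neg_zero, add_comm]

/-- Negative multiples of `ω` are handled by applying the statement for rays to the reflected
property. -/
lemma ae_ray [Nonempty (Fin d)] {p : EuclideanSpace ℝ (Fin d) → Prop} (h : ∀ᵐ x, p x) :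
    ∀ᵐ ω : Metric.sphere (0 : EuclideanSpace ℝ (Fin d)) 1
      ∂(volume : Measure (EuclideanSpace ℝ (Fin d))).toSphere,
      ∀ᵐ κ : ℝ, p (κ • (ω : EuclideanSpace ℝ (Fin d))) := by
  have h' : ∀ᵐ x : EuclideanSpace ℝ (Fin d), p (-x) :=
    (Measure.measurePreserving_neg (volume : Measure (EuclideanSpace ℝ (Fin d)))
      ).quasiMeasurePreserving.ae h
  filter_upwards [ae_polar h, ae_polar h'] with ω h1 h2
  rw [ae_restrict_iff' measurableSet_Ioi] at h1 h2
  have h3 := (Measure.measurePreserving_neg (volume : Measure ℝ)).quasiMeasurePreserving.ae h2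
  have h0 : ∀ᵐ κ : ℝ, κ ≠ 0 := by simp [ae_iff]
  filter_upwards [h1, h3, h0] with κ k1 k3 k0
  rcases lt_or_gt_of_ne k0 with hk | hk
  · have := k3 (by simpa using hk)
    simpa using this
  · exact k1 hk

lemma const_mul_rpow (m : ℝ) {κ : ℝ} (hκ : 0 < κ) :
    1 / (2 * (2 * Real.pi) ^ m) * (2 * Real.pi * κ) ^ m = κ ^ m / 2 := by
  rw [Real.mul_rpow (by positivity) hκ.le]
  field_simp

lemma profileHat_of_pos (σ : ℝ) (u₀ u₁ : 𝓢'(EuclideanSpace ℝ (Fin d), ℂ)) (ω : UnitSphere d)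
    {κ : ℝ} (hκ : 0 < κ) : profileHat σ u₀ u₁ ω κ =
      ((κ ^ (((d : ℝ) - 1) / 2) / 2 : ℝ) : ℂ) *
        Complex.exp (-(Complex.I * (((d : ℝ) - 1) / 4 * Real.pi : ℝ))) *
        halfData σ u₀ u₁ (κ • (ω : EuclideanSpace ℝ (Fin d))) := by
  have h1 : ‖κ • (ω : EuclideanSpace ℝ (Fin d))‖ = κ := by
    rw [norm_smul]; simp [hκ.le]
  have hπ := Real.pi_pos
  have h2 : 0 < 2 * Real.pi * κ := by positivity
  simp only [profileHat, halfData, h1]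
  rw [if_neg h2.le.not_gt, abs_of_pos h2, const_mul_rpow _ hκ]

/-- At `-κω` the frequency `ν` is minus the length `|2πξ|`, which turns the sign `σ` in the
half-wave data into `-σ`. -/
lemma profileHat_neg (σ : ℝ) (u₀ u₁ : 𝓢'(EuclideanSpace ℝ (Fin d), ℂ)) (ω : UnitSphere d)
    {κ : ℝ} (hκ : 0 < κ) : profileHat σ u₀ u₁ ω (-κ) =
      ((κ ^ (((d : ℝ) - 1) / 2) / 2 : ℝ) : ℂ) *
        Complex.exp (Complex.I * (((d : ℝ) - 1) / 4 * Real.pi : ℝ)) *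
        halfData (-σ) u₀ u₁ (-(κ • (ω : EuclideanSpace ℝ (Fin d)))) := by
  have h1 : ‖-(κ • (ω : EuclideanSpace ℝ (Fin d)))‖ = κ := by
    rw [norm_neg, norm_smul]; simp [hκ.le]
  have hπ := Real.pi_pos
  have h2 : 2 * Real.pi * -κ < 0 := by
    have : 0 < 2 * Real.pi * κ := by positivity
    linarith
  have h3 : |2 * Real.pi * -κ| = 2 * Real.pi * κ := by rw [abs_of_neg h2]; ring
  simp only [profileHat, halfData, h1]
  rw [if_pos h2, h3, const_mul_rpow _ hκ, neg_smul]
  congr 2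
  push_cast; ring

/-- The shift of `s` by `σt` becomes a phase, which is the wave propagator at frequency `κ`. -/
lemma fourierInv_pulledTest (σ t : ℝ) (k : Fin (d + 1)) (φ : 𝓢(EuclideanSpace ℝ (Fin d), ℂ))
    (ω : UnitSphere d) (κ : ℝ) : 𝓕⁻ (pulledTest σ t k φ ω) κ =
      Complex.exp (-(((2 * Real.pi * κ * (σ * t) : ℝ) : ℂ) * Complex.I)) *
        (directionCoeff σ ω k : ℂ) * 𝓕⁻ (radialPull φ ω) κ := by
  rw [Real.fourierInv_eq', Real.fourierInv_eq', ← integral_const_mul]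
  refine Eq.trans ?_ (integral_add_right_eq_self (μ := volume) (fun s : ℝ =>
    Complex.exp (-(((2 * Real.pi * κ * (σ * t) : ℝ) : ℂ) * Complex.I)) *
      (directionCoeff σ ω k : ℂ) * (Complex.exp (((2 * Real.pi * inner ℝ s κ : ℝ) : ℂ) * Complex.I) •
        radialPull φ ω s)) (σ * t))
  congr 1; ext s
  simp only [pulledTest, radialPull, smul_eq_mul]
  split_ifs
  · have : Complex.exp (((2 * Real.pi * inner ℝ s κ : ℝ) : ℂ) * Complex.I) =
        Complex.exp (-(((2 * Real.pi * κ * (σ * t) : ℝ) : ℂ) * Complex.I)) *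
        Complex.exp (((2 * Real.pi * inner ℝ (s + σ * t) κ : ℝ) : ℂ) * Complex.I) := by
      rw [← Complex.exp_add]
      congr 1
      simp only [RCLike.inner_apply, conj_trivial]
      push_cast; ring
    rw [this]
    push_cast; ring
  · simp

end Profile

/-! ### Pairing the profile with test functions -/

section Pairing

variable {d : ℕ}

/-- The densities are measurable only up to null sets of the whole space; on almost every line they
agree almost everywhere with measurable representatives. -/
lemma ae_aestronglyMeasurable_profileHat [Nonempty (Fin d)] {β : ℝ}
    {u₀ u₁ : 𝓢'(EuclideanSpace ℝ (Fin d), ℂ)} (h₀ : MemHomSobolev β u₀)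
    (h₁ : MemHomSobolev (β - 1) u₁) (σ : ℝ) :
    ∀ᵐ ω : Metric.sphere (0 : EuclideanSpace ℝ (Fin d)) 1
      ∂(volume : Measure (EuclideanSpace ℝ (Fin d))).toSphere,
      AEStronglyMeasurable (profileHat σ u₀ u₁ ω) volume := by
  filter_upwards [ae_ray h₀.aestronglyMeasurable.ae_eq_mk, ae_ray h₁.aestronglyMeasurable.ae_eq_mk]
    with ω e0 e1
  have m0 := h₀.aestronglyMeasurable.stronglyMeasurable_mk.measurable
  have m1 := h₁.aestronglyMeasurable.stronglyMeasurable_mk.measurable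
  set a := h₀.aestronglyMeasurable.mk (fourierDensity u₀)
  set b := h₁.aestronglyMeasurable.mk (fourierDensity u₁)
  have hm : Measurable fun κ : ℝ =>
      ((1 / (2 * (2 * Real.pi) ^ (((d : ℝ) - 1) / 2)) *
        |2 * Real.pi * κ| ^ (((d : ℝ) - 1) / 2) : ℝ) : ℂ) *
      (if 2 * Real.pi * κ < 0 then Complex.exp (Complex.I * (((d : ℝ) - 1) / 4 * Real.pi : ℝ))
        else Complex.exp (-(Complex.I * (((d : ℝ) - 1) / 4 * Real.pi : ℝ)))) *
      (b (κ • (ω : EuclideanSpace ℝ (Fin d))) - σ * Complex.I * ((2 * Real.pi * κ : ℝ) : ℂ) *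
        a (κ • (ω : EuclideanSpace ℝ (Fin d)))) := by
    have ms : Measurable fun κ : ℝ => κ • (ω : EuclideanSpace ℝ (Fin d)) := by fun_prop
    refine Measurable.mul (Measurable.mul (by fun_prop) ?_) ?_
    · exact Measurable.ite (measurableSet_lt (by fun_prop) measurable_const) measurable_const
        measurable_const
    · exact (m1.comp ms).sub (Measurable.mul (by fun_prop) (m0.comp ms))
  refine ⟨_, hm.stronglyMeasurable, ?_⟩
  filter_upwards [e0, e1] with κ k0 k1
  simp only [profileHat, k0, k1, a, b]

/-- By Fubini, the finite norm of order `β - 1` of the half-wave data gives a finite one-dimensional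
norm of the same order on almost every line; `κ^((d-1)/2)` in the profile accounts for the Jacobian.
So the profile is a genuine distribution there rather than the default value. -/
lemma ae_exists_hasDensity_profileHat [Nonempty (Fin d)] {β : ℝ} (hβ1 : β < 1)
    {u₀ u₁ : 𝓢'(EuclideanSpace ℝ (Fin d), ℂ)} (h₀ : MemHomSobolev β u₀)
    (h₁ : MemHomSobolev (β - 1) u₁) (σ : ℝ) :
    ∀ᵐ ω : Metric.sphere (0 : EuclideanSpace ℝ (Fin d)) 1
      ∂(volume : Measure (EuclideanSpace ℝ (Fin d))).toSphere,
      ∃ T : 𝓢'(ℝ, ℂ), HasDensity T (profileHat σ u₀ u₁ ω) := by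
  have hd : 1 ≤ d := Fin.pos (Classical.arbitrary (Fin d))
  have hF : ∀ σ : ℝ, Integrable fun ξ : EuclideanSpace ℝ (Fin d) =>
      ((‖(wt (β - 1) ξ : ℂ) * halfData σ u₀ u₁ ξ‖ ^ 2 : ℝ) : ℂ) := fun σ => by
    have hm := memLp_wt_mul (aestronglyMeasurable_halfData h₀ h₁ σ) (wnorm_halfData_lt_top h₀ h₁ σ)
    exact ((memLp_two_iff_integrable_sq_norm hm.1).1 hm).ofReal
  filter_upwards [ae_aestronglyMeasurable_profileHat h₀ h₁ σ, integrable_polar (hF σ),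
    integrable_polar (hF (-σ)).comp_neg] with ω hmeas i1 i2
  refine exists_hasDensity_of_wnorm (s := β - 1) ?_ hmeas ?_
  · rw [Module.finrank_self]; push_cast; linarith
  have hm := aestronglyMeasurable_wt_mul (β - 1) hmeas
  suffices h : MemLp (fun κ : ℝ => (wt (β - 1) κ : ℂ) * profileHat σ u₀ u₁ ω κ) 2 volume from h.2
  rw [memLp_two_iff_integrable_sq_norm hm]
  have hwt : ∀ κ : ℝ, 0 < κ → wt (β - 1) κ = wt (β - 1) (κ • (ω : EuclideanSpace ℝ (Fin d))) :=
    fun κ hκ => by simp [wt, norm_smul]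
  have hexp : ∀ r : ℝ, ‖Complex.exp (Complex.I * r)‖ = 1 := fun r => by
    rw [mul_comm, Complex.norm_exp_ofReal_mul_I]
  have hexp' : ∀ r : ℝ, ‖Complex.exp (-(Complex.I * r))‖ = 1 := fun r => by
    rw [← mul_neg, ← Complex.ofReal_neg, hexp]
  have hsq : ∀ κ : ℝ, 0 < κ → (κ ^ (((d : ℝ) - 1) / 2) / 2) ^ 2 = κ ^ (d - 1) / 4 := fun κ hκ => by
    rw [div_pow, sq (κ ^ _), rpow_mul_rpow_half hd hκ]; norm_num
  have hi := (integral_eq_integral_Ioi_add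
    (g := fun κ : ℝ => ((‖(wt (β - 1) κ : ℂ) * profileHat σ u₀ u₁ ω κ‖ ^ 2 : ℝ) : ℂ)) ?_ ?_).1
  · exact_mod_cast hi.re
  · refine IntegrableOn.congr_fun (i1.const_mul (1 / 4)) (fun κ hκ => ?_) measurableSet_Ioi
    have hκ : 0 < κ := hκ
    simp only
    rw [profileHat_of_pos σ u₀ u₁ ω hκ, finrank_euclideanSpace_fin, norm_mul, norm_mul, norm_mul,
      norm_mul, hexp', hwt κ hκ, mul_one, mul_pow, mul_pow, mul_pow, Complex.norm_real,
      Complex.norm_real, Real.norm_of_nonneg (by positivity : 0 ≤ κ ^ (((d : ℝ) - 1) / 2) / 2),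
      hsq κ hκ]
    push_cast; ring
  · refine IntegrableOn.congr_fun (i2.const_mul (1 / 4)) (fun κ hκ => ?_) measurableSet_Ioi
    have hκ : 0 < κ := hκ
    simp only
    rw [profileHat_neg σ u₀ u₁ ω hκ, finrank_euclideanSpace_fin, norm_mul, norm_mul, norm_mul,
      norm_mul, hexp, wt_neg_arg, wt_neg_arg, hwt κ hκ, mul_one, mul_pow, mul_pow, mul_pow,
      Complex.norm_real,
      Complex.norm_real, Real.norm_of_nonneg (by positivity : 0 ≤ κ ^ (((d : ℝ) - 1) / 2) / 2),
      hsq κ hκ]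
    push_cast; ring

lemma pairing_radiationProfile {σ : ℝ} {u₀ u₁ : 𝓢'(EuclideanSpace ℝ (Fin d), ℂ)}
    {ω : UnitSphere d} (h : ∃ T : 𝓢'(ℝ, ℂ), HasDensity T (profileHat σ u₀ u₁ ω)) (f : ℝ → ℂ) :
    pairing (radiationProfile σ u₀ u₁ ω) f = ∫ κ, profileHat σ u₀ u₁ ω κ * (𝓕⁻ f) κ := by
  have h1 : HasDensity (𝓕 (radiationProfile σ u₀ u₁ ω)) (profileHat σ u₀ u₁ ω) := by
    rw [radiationProfile, FourierTransform.fourier_fourierInv_eq]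
    exact hasDensity_ofDensity h
  have h2 := (hasDensity_fourierDensity ⟨_, h1⟩).ae_eq h1
  rw [pairing]
  refine integral_congr_ae ?_
  filter_upwards [h2] with κ hκ
  rw [hκ]

/-- The outgoing half of the radiation field on the Fourier side. -/
def posData (σ : ℝ) (u₀ u₁ : 𝓢'(EuclideanSpace ℝ (Fin d), ℂ)) (k : Fin (d + 1))
    (ξ : EuclideanSpace ℝ (Fin d)) : ℂ :=
  (dirMul σ k ξ : ℂ) * halfData σ u₀ u₁ ξ

/-- The conjugate of the incoming half of the radiation field on the Fourier side. -/
def negData (σ : ℝ) (u₀ u₁ : 𝓢'(EuclideanSpace ℝ (Fin d), ℂ)) (k : Fin (d + 1))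
    (ξ : EuclideanSpace ℝ (Fin d)) : ℂ :=
  (dirMul σ k ξ : ℂ) * (starRingEnd ℂ) (halfData (-σ) u₀ u₁ (-ξ))

lemma phase_smul (s : ℝ) (ω : UnitSphere d) {κ : ℝ} (hκ : 0 < κ) :
    phase s (κ • (ω : EuclideanSpace ℝ (Fin d))) =
      Complex.exp (-(((2 * Real.pi * κ * s : ℝ) : ℂ) * Complex.I)) := by
  have h1 : ‖κ • (ω : EuclideanSpace ℝ (Fin d))‖ = κ := by
    rw [norm_smul]; simp [hκ.le]
  rw [phase, h1]

lemma profileHat_mul_of_pos (hd : 1 ≤ d) (σ t : ℝ) (u₀ u₁ : 𝓢'(EuclideanSpace ℝ (Fin d), ℂ))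
    (k : Fin (d + 1)) (φ : 𝓢(EuclideanSpace ℝ (Fin d), ℂ)) (ω : UnitSphere d) {κ : ℝ} (hκ : 0 < κ) :
    profileHat σ u₀ u₁ ω κ * 𝓕⁻ (pulledTest σ t k φ ω) κ = 1 / 2 * (((κ ^ (d - 1) : ℝ) : ℂ) *
      (phase (σ * t) (κ • (ω : EuclideanSpace ℝ (Fin d))) *
        posData σ u₀ u₁ k (κ • (ω : EuclideanSpace ℝ (Fin d))) *
        outgoing φ (κ • (ω : EuclideanSpace ℝ (Fin d))))) := by
  have hω : ‖(ω : EuclideanSpace ℝ (Fin d))‖ = 1 := by simp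
  have hne : ((κ ^ (((d : ℝ) - 1) / 2) : ℝ) : ℂ) ≠ 0 := by
    exact_mod_cast (Real.rpow_pos_of_pos hκ _).ne'
  rw [profileHat_of_pos σ u₀ u₁ ω hκ, fourierInv_pulledTest, posData, dirMul_smul σ k ω hκ,
    phase_smul _ _ hκ, outgoing_smul φ hω hκ, ← rpow_mul_rpow_half hd hκ, Complex.ofReal_inv,
    Complex.ofReal_mul, Complex.ofReal_div]
  field_simp
  push_cast
  ring

lemma profileHat_mul_neg (hd : 1 ≤ d) (σ t : ℝ) (u₀ u₁ : 𝓢'(EuclideanSpace ℝ (Fin d), ℂ))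
    (k : Fin (d + 1)) (φ : 𝓢(EuclideanSpace ℝ (Fin d), ℂ)) (ω : UnitSphere d) {κ : ℝ} (hκ : 0 < κ) :
    profileHat σ u₀ u₁ ω (-κ) * 𝓕⁻ (pulledTest σ t k φ ω) (-κ) = 1 / 2 * (((κ ^ (d - 1) : ℝ) : ℂ) *
      (starRingEnd ℂ) (phase (σ * t) (κ • (ω : EuclideanSpace ℝ (Fin d))) *
        negData σ u₀ u₁ k (κ • (ω : EuclideanSpace ℝ (Fin d))) *
        outgoing (conjSchwartz φ) (κ • (ω : EuclideanSpace ℝ (Fin d))))) := by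
  have hω : ‖(ω : EuclideanSpace ℝ (Fin d))‖ = 1 := by simp
  have hne : ((κ ^ (((d : ℝ) - 1) / 2) : ℝ) : ℂ) ≠ 0 := by
    exact_mod_cast (Real.rpow_pos_of_pos hκ _).ne'
  have he : (starRingEnd ℂ) (Complex.exp (-(((2 * Real.pi * κ * (σ * t) : ℝ) : ℂ) * Complex.I))) =
      Complex.exp (-(((2 * Real.pi * -κ * (σ * t) : ℝ) : ℂ) * Complex.I)) := by
    rw [← Complex.exp_conj, map_neg, map_mul, Complex.conj_ofReal, Complex.conj_I]
    congr 1; push_cast; ring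
  rw [profileHat_neg σ u₀ u₁ ω hκ, fourierInv_pulledTest, negData, dirMul_smul σ k ω hκ,
    phase_smul _ _ hκ, map_mul, map_mul, map_mul, Complex.conj_conj, Complex.conj_ofReal,
    outgoing_conjSchwartz_smul φ hω hκ, ← rpow_mul_rpow_half hd hκ, Complex.ofReal_inv,
    Complex.ofReal_mul, Complex.ofReal_div, he]
  field_simp
  push_cast
  ring

end Pairing

/-! ### The radiation field and the gradient in the same form -/

section Limit

variable {d : ℕ}

lemma phase_neg_arg {V : Type*} [NormedAddCommGroup V] (t : ℝ) (ξ : V) :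
    phase t (-ξ) = phase t ξ := by simp [phase]

lemma conj_phase {V : Type*} [NormedAddCommGroup V] (t : ℝ) (ξ : V) :
    (starRingEnd ℂ) (phase t ξ) = phase (-t) ξ := by
  rw [phase, phase, ← Complex.exp_conj, map_neg, map_mul, Complex.conj_ofReal, Complex.conj_I]
  congr 1; push_cast; ring

lemma dirMul_neg_arg_succ (σ : ℝ) (j : Fin d) (ξ : EuclideanSpace ℝ (Fin d)) :
    dirMul σ j.succ (-ξ) = -dirMul σ j.succ ξ := by
  simp [dirMul]

lemma aestronglyMeasurable_posData {β : ℝ} {u₀ u₁ : 𝓢'(EuclideanSpace ℝ (Fin d), ℂ)}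
    (h₀ : MemHomSobolev β u₀) (h₁ : MemHomSobolev (β - 1) u₁) (σ : ℝ) (k : Fin (d + 1)) :
    AEStronglyMeasurable (posData σ u₀ u₁ k) volume :=
  aestronglyMeasurable_dirMul_mul σ k (aestronglyMeasurable_halfData h₀ h₁ σ)

lemma aestronglyMeasurable_conj_halfData_neg {β : ℝ} {u₀ u₁ : 𝓢'(EuclideanSpace ℝ (Fin d), ℂ)}
    (h₀ : MemHomSobolev β u₀) (h₁ : MemHomSobolev (β - 1) u₁) (σ : ℝ) :
    AEStronglyMeasurable (fun ξ => (starRingEnd ℂ) (halfData σ u₀ u₁ (-ξ))) volume :=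
  Complex.continuous_conj.comp_aestronglyMeasurable
    ((aestronglyMeasurable_halfData h₀ h₁ σ).comp_measurePreserving
      (Measure.measurePreserving_neg volume))

lemma aestronglyMeasurable_negData {β : ℝ} {u₀ u₁ : 𝓢'(EuclideanSpace ℝ (Fin d), ℂ)}
    (h₀ : MemHomSobolev β u₀) (h₁ : MemHomSobolev (β - 1) u₁) (σ : ℝ) (k : Fin (d + 1)) :
    AEStronglyMeasurable (negData σ u₀ u₁ k) volume :=
  aestronglyMeasurable_dirMul_mul σ k (aestronglyMeasurable_conj_halfData_neg h₀ h₁ (-σ))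

lemma wnorm_posData_lt_top [Nonempty (Fin d)] {β : ℝ} {u₀ u₁ : 𝓢'(EuclideanSpace ℝ (Fin d), ℂ)}
    (h₀ : MemHomSobolev β u₀) (h₁ : MemHomSobolev (β - 1) u₁) {σ : ℝ} (hσ : |σ| ≤ 1)
    (k : Fin (d + 1)) : wnorm (β - 1) (posData σ u₀ u₁ k) < ∞ :=
  (wnorm_dirMul_mul_le hσ k _ _).trans_lt (wnorm_halfData_lt_top h₀ h₁ σ)

lemma wnorm_negData_lt_top [Nonempty (Fin d)] {β : ℝ} {u₀ u₁ : 𝓢'(EuclideanSpace ℝ (Fin d), ℂ)}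
    (h₀ : MemHomSobolev β u₀) (h₁ : MemHomSobolev (β - 1) u₁) {σ : ℝ} (hσ : |σ| ≤ 1)
    (k : Fin (d + 1)) : wnorm (β - 1) (negData σ u₀ u₁ k) < ∞ := by
  refine (wnorm_dirMul_mul_le hσ k _ _).trans_lt ?_
  rw [wnorm_conj, wnorm_neg_arg _ (aestronglyMeasurable_halfData h₀ h₁ _)]
  exact wnorm_halfData_lt_top h₀ h₁ _

lemma integrable_phase_mul {V : Type*} [NormedAddCommGroup V] [InnerProductSpace ℝ V]
    [FiniteDimensional ℝ V] [MeasurableSpace V] [BorelSpace V] [Nontrivial V] {s : ℝ}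
    {w f : V → ℂ} (hw : AEStronglyMeasurable w volume) (hf : AEStronglyMeasurable f volume)
    (hwfin : wnorm s w < ∞) (hffin : wnorm (-s) f < ∞) (t : ℝ) :
    Integrable (fun ξ => phase t ξ * w ξ * f ξ) volume := by
  refine (integrable_mul_of_wnorm (s := s) (g := fun ξ => phase t ξ * w ξ)
    ((continuous_phase t).aestronglyMeasurable.mul hw) hf ?_ hffin).1
  rwa [norm_phase_mul_le]

lemma integrable_phase_mul_outgoing (hd : 3 ≤ d) {θ : ℝ} (h0 : 0 < θ) (h1 : θ < 1)
    {w : EuclideanSpace ℝ (Fin d) → ℂ} (hw : AEStronglyMeasurable w volume)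
    (hfin : wnorm (-θ) w < ∞) (t : ℝ) (φ : 𝓢(EuclideanSpace ℝ (Fin d), ℂ)) :
    Integrable (fun ξ => phase t ξ * w ξ * outgoing φ ξ) volume := by
  have : Nonempty (Fin d) := ⟨⟨0, by omega⟩⟩
  refine integrable_phase_mul hw (measurable_outgoing φ.continuous.measurable).aestronglyMeasurable
    hfin ?_ t
  rw [neg_neg]
  refine (wnorm_outgoing_le hd h0 h1 φ).trans_lt (ENNReal.mul_lt_top (by simp) ?_)
  exact wnorm_schwartz_lt_top (by rw [finrank_euclideanSpace_fin]; linarith [(by positivity : (0:ℝ) ≤ d)]) _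

lemma integrable_phase_mul_fourierInv [Nonempty (Fin d)] {θ : ℝ} (h0 : 0 < θ)
    {w : EuclideanSpace ℝ (Fin d) → ℂ} (hw : AEStronglyMeasurable w volume)
    (hfin : wnorm (-θ) w < ∞) (t : ℝ) (φ : 𝓢(EuclideanSpace ℝ (Fin d), ℂ)) :
    Integrable (fun ξ => phase t ξ * w ξ * (𝓕⁻ φ : 𝓢(EuclideanSpace ℝ (Fin d), ℂ)) ξ) volume := by
  refine integrable_phase_mul hw (SchwartzMap.continuous _).aestronglyMeasurable hfin ?_ t
  rw [neg_neg]
  exact wnorm_schwartz_lt_top (by rw [finrank_euclideanSpace_fin]; linarith [(by positivity : (0:ℝ) ≤ d)]) _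

/-- Each line is split into positive and negative frequencies, and polar coordinates turn the two
families of half-line integrals into integrals over the whole frequency space. -/
lemma integral_pairing_radiationProfile (hd : 3 ≤ d) {β : ℝ} (hβ0 : 0 < β) (hβ1 : β < 1)
    {u₀ u₁ : 𝓢'(EuclideanSpace ℝ (Fin d), ℂ)} (h₀ : MemHomSobolev β u₀)
    (h₁ : MemHomSobolev (β - 1) u₁) {σ : ℝ} (hσ : |σ| ≤ 1) (t : ℝ) (k : Fin (d + 1))
    (φ : 𝓢(EuclideanSpace ℝ (Fin d), ℂ)) :
    ∫ ω : UnitSphere d, pairing (radiationProfile σ u₀ u₁ ω) (pulledTest σ t k φ ω)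
        ∂((volume : Measure (EuclideanSpace ℝ (Fin d))).toSphere) =
      1 / 2 * (∫ ξ, phase (σ * t) ξ * posData σ u₀ u₁ k ξ * outgoing φ ξ) +
      1 / 2 * (starRingEnd ℂ) (∫ ξ, phase (σ * t) ξ * negData σ u₀ u₁ k ξ *
        outgoing (conjSchwartz φ) ξ) := by
  have : Nonempty (Fin d) := ⟨⟨0, by omega⟩⟩
  have hA := integrable_phase_mul_outgoing hd (sub_pos.2 hβ1) (by linarith)
    (aestronglyMeasurable_posData h₀ h₁ σ k)
    (by rw [neg_sub]; exact wnorm_posData_lt_top h₀ h₁ hσ k) (σ * t) φ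
  have hB := integrable_phase_mul_outgoing hd (sub_pos.2 hβ1) (by linarith)
    (aestronglyMeasurable_negData h₀ h₁ σ k)
    (by rw [neg_sub]; exact wnorm_negData_lt_top h₀ h₁ hσ k) (σ * t) (conjSchwartz φ)
  replace hB : Integrable (fun ξ => (starRingEnd ℂ) (phase (σ * t) ξ * negData σ u₀ u₁ k ξ *
        outgoing (conjSchwartz φ) ξ)) volume :=
    (Complex.conjCLE : ℂ →L[ℝ] ℂ).integrable_comp hB
  obtain ⟨iA, eA⟩ := integral_polar hA
  obtain ⟨iB, eB⟩ := integral_polar hB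
  rw [← integral_conj, eA, eB, ← integral_const_mul, ← integral_const_mul,
    ← integral_add (iA.const_mul _) (iB.const_mul _)]
  refine integral_congr_ae ?_
  filter_upwards [ae_exists_hasDensity_profileHat hβ1 h₀ h₁ σ, integrable_polar hA,
    integrable_polar hB] with ω hω jA jB
  rw [finrank_euclideanSpace_fin] at jA jB
  rw [pairing_radiationProfile hω, finrank_euclideanSpace_fin]
  have e1 := fun κ (hκ : κ ∈ Set.Ioi (0 : ℝ)) =>
    profileHat_mul_of_pos (by omega) σ t u₀ u₁ k φ ω hκ
  have e2 := fun κ (hκ : κ ∈ Set.Ioi (0 : ℝ)) =>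
    profileHat_mul_neg (by omega) σ t u₀ u₁ k φ ω hκ
  rw [(integral_eq_integral_Ioi_add
    (IntegrableOn.congr_fun (jA.const_mul (1 / 2)) (fun κ hκ => (e1 κ hκ).symm) measurableSet_Ioi)
    (IntegrableOn.congr_fun (jB.const_mul (1 / 2)) (fun κ hκ => (e2 κ hκ).symm)
      measurableSet_Ioi)).2, setIntegral_congr_fun measurableSet_Ioi e1,
    setIntegral_congr_fun measurableSet_Ioi e2, integral_const_mul, integral_const_mul]

/-- The same expression as for the radiation field, with `𝓕⁻` in place of `outgoing`, so that the
difference is made of two `farField` terms. In the second one the reflection `ξ → -ξ` undoes the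
conjugation. -/
lemma spaceTimeGradient_apply [Nonempty (Fin d)] {β : ℝ} (hβ1 : β < 1)
    {u₀ u₁ : 𝓢'(EuclideanSpace ℝ (Fin d), ℂ)} (h₀ : MemHomSobolev β u₀)
    (h₁ : MemHomSobolev (β - 1) u₁) {t : ℝ} {u v : 𝓢'(EuclideanSpace ℝ (Fin d), ℂ)}
    (hu : HasDensity (𝓕 u) (waveHat u₀ u₁ t)) (hv : HasDensity (𝓕 v) (velHat u₀ u₁ t))
    {σ : ℝ} (hσ : σ = 1 ∨ σ = -1) (k : Fin (d + 1)) (φ : 𝓢(EuclideanSpace ℝ (Fin d), ℂ)) :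
    spaceTimeGradient u v k φ =
      1 / 2 * (∫ ξ, phase (σ * t) ξ * posData σ u₀ u₁ k ξ *
        (𝓕⁻ φ : 𝓢(EuclideanSpace ℝ (Fin d), ℂ)) ξ) +
      1 / 2 * (starRingEnd ℂ) (∫ ξ, phase (σ * t) ξ * negData σ u₀ u₁ k ξ *
        (𝓕⁻ (conjSchwartz φ) : 𝓢(EuclideanSpace ℝ (Fin d), ℂ)) ξ) := by
  have hσ' : |σ| ≤ 1 := by rcases hσ with rfl | rfl <;> simp
  have hA := integrable_phase_mul_fourierInv (sub_pos.2 hβ1) (aestronglyMeasurable_posData h₀ h₁ σ k)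
    (by rw [neg_sub]; exact wnorm_posData_lt_top h₀ h₁ hσ' k) (σ * t) φ
  have hB := integrable_phase_mul_fourierInv (sub_pos.2 hβ1) (aestronglyMeasurable_negData h₀ h₁ σ k)
    (by rw [neg_sub]; exact wnorm_negData_lt_top h₀ h₁ hσ' k) (σ * t) (conjSchwartz φ)
  replace hB : Integrable (fun ξ => (starRingEnd ℂ) (phase (σ * t) ξ * negData σ u₀ u₁ k ξ *
        (𝓕⁻ (conjSchwartz φ) : 𝓢(EuclideanSpace ℝ (Fin d), ℂ)) ξ)) volume :=
    (Complex.conjCLE : ℂ →L[ℝ] ℂ).integrable_comp hB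
  have hB' := hB.comp_neg
  rw [← integral_conj, ← integral_neg_eq_self (fun ξ => (starRingEnd ℂ) (phase (σ * t) ξ *
    negData σ u₀ u₁ k ξ * (𝓕⁻ (conjSchwartz φ) : 𝓢(EuclideanSpace ℝ (Fin d), ℂ)) ξ)),
    ← integral_const_mul, ← integral_const_mul,
    ← integral_add (hA.const_mul _) (hB'.const_mul _)]
  have key : ∀ ξ, (starRingEnd ℂ) (phase (σ * t) (-ξ) * negData σ u₀ u₁ k (-ξ) *
      (𝓕⁻ (conjSchwartz φ) : 𝓢(EuclideanSpace ℝ (Fin d), ℂ)) (-ξ)) = phase (-(σ * t)) ξ *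
      ((dirMul σ k (-ξ) : ℂ) * halfData (-σ) u₀ u₁ ξ) *
      (𝓕⁻ φ : 𝓢(EuclideanSpace ℝ (Fin d), ℂ)) ξ := fun ξ => by
    rw [negData, map_mul, map_mul, map_mul, neg_neg, Complex.conj_conj, Complex.conj_ofReal,
      fourierInv_conjSchwartz_apply, neg_neg, Complex.conj_conj, phase_neg_arg, conj_phase]
  simp only [key, posData]
  refine Fin.cases ?_ (fun j => ?_) k
  · rw [spaceTimeGradient, Fin.cons_zero, (hv.apply_eq φ).2]
    refine integral_congr_ae (ae_of_all _ fun ξ => ?_)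
    rcases hσ with rfl | rfl <;> simp [velHat, dirMul] <;> ring
  · have e1 : spaceTimeGradient u v j.succ φ = -u (coordDeriv j φ) := by
      rw [spaceTimeGradient, Fin.cons_succ, TemperedDistribution.lineDerivOp_apply_apply, map_neg]
      rfl
    rw [e1, (hu.apply_eq _).2, ← integral_neg]
    refine integral_congr_ae (ae_of_all _ fun ξ => ?_)
    simp only
    rw [fourierInv_coordDeriv_apply, dirMul_neg_arg_succ]
    -- At the origin both sides vanish, by the convention for division by zero in the direction
    -- multiplier.
    by_cases h : ξ = 0
    · subst h; simp [dirMul]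
    have h' : (‖ξ‖ : ℂ) ≠ 0 := by simpa using h
    have hpi : (Real.pi : ℂ) ≠ 0 := by simp [Real.pi_ne_zero]
    rcases hσ with rfl | rfl
    · simp only [waveHat, dirMul, Fin.cons_succ, one_mul]
      push_cast
      field_simp
      ring_nf
      simp only [Complex.I_sq]; ring
    · simp only [waveHat, dirMul, Fin.cons_succ, neg_neg, one_mul, neg_mul]
      push_cast
      field_simp
      ring_nf
      simp only [Complex.I_sq]; ring

end Limit

/-! ### Convergence in the homogeneous Sobolev norm -/

section MainLimit

variable {d : ℕ}

/-- The pairing of the error of the radiation field approximation with a test function. -/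
def remainder (s : ℝ) (w w' : EuclideanSpace ℝ (Fin d) → ℂ) (φ : 𝓢(EuclideanSpace ℝ (Fin d), ℂ)) :
    ℂ :=
  1 / 2 * farField s w φ + 1 / 2 * (starRingEnd ℂ) (farField s w' (conjSchwartz φ))

lemma farField_eq_sub (hd : 3 ≤ d) {θ : ℝ} (h0 : 0 < θ) (h1 : θ < 1)
    {w : EuclideanSpace ℝ (Fin d) → ℂ} (hw : AEStronglyMeasurable w volume)
    (hfin : wnorm (-θ) w < ∞) (t : ℝ) (φ : 𝓢(EuclideanSpace ℝ (Fin d), ℂ)) :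
    farField t w φ =
      (∫ ξ, phase t ξ * w ξ * (𝓕⁻ φ : 𝓢(EuclideanSpace ℝ (Fin d), ℂ)) ξ) -
      ∫ ξ, phase t ξ * w ξ * outgoing φ ξ := by
  have : Nonempty (Fin d) := ⟨⟨0, by omega⟩⟩
  rw [farField, ← integral_sub (integrable_phase_mul_fourierInv h0 hw hfin t φ)
    (integrable_phase_mul_outgoing hd h0 h1 hw hfin t φ)]
  simp only [mul_sub]

lemma farField_add (hd : 3 ≤ d) {θ : ℝ} (h0 : 0 < θ) (h1 : θ < 1)
    {w : EuclideanSpace ℝ (Fin d) → ℂ} (hw : AEStronglyMeasurable w volume)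
    (hfin : wnorm (-θ) w < ∞) (t : ℝ) (φ ψ : 𝓢(EuclideanSpace ℝ (Fin d), ℂ)) :
    farField t w (φ + ψ) = farField t w φ + farField t w ψ := by
  rw [farField, farField, farField,
    ← integral_add (integrable_farField_of_lt_one hd h0 h1 φ hw hfin t).1
      (integrable_farField_of_lt_one hd h0 h1 ψ hw hfin t).1]
  refine integral_congr_ae (ae_of_all _ fun ξ => ?_)
  simp only
  rw [outgoing_add (by omega), FourierTransform.fourierInv_add, _root_.add_apply]
  ring

lemma farField_smul (t : ℝ) (w : EuclideanSpace ℝ (Fin d) → ℂ) (c : ℂ)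
    (φ : 𝓢(EuclideanSpace ℝ (Fin d), ℂ)) : farField t w (c • φ) = c * farField t w φ := by
  rw [farField, farField, ← integral_const_mul]
  refine integral_congr_ae (ae_of_all _ fun ξ => ?_)
  have h : (⇑(c • φ) : EuclideanSpace ℝ (Fin d) → ℂ) = fun x => c * φ x := rfl
  simp only
  rw [h, outgoing_smul_fun, FourierTransform.fourierInv_smul, _root_.smul_apply, smul_eq_mul]
  ring

lemma conjSchwartz_add {V : Type*} [NormedAddCommGroup V] [NormedSpace ℝ V] (φ ψ : 𝓢(V, ℂ)) :
    conjSchwartz (φ + ψ) = conjSchwartz φ + conjSchwartz ψ := by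
  ext x; simp [conjSchwartz_apply]

lemma conjSchwartz_smul {V : Type*} [NormedAddCommGroup V] [NormedSpace ℝ V] (c : ℂ)
    (φ : 𝓢(V, ℂ)) : conjSchwartz (c • φ) = (starRingEnd ℂ) c • conjSchwartz φ := by
  ext x; simp [conjSchwartz_apply]

lemma norm_remainder_le {θ ε s : ℝ} {w w' : EuclideanSpace ℝ (Fin d) → ℂ}
    (h : ∀ φ : 𝓢(EuclideanSpace ℝ (Fin d), ℂ), ‖farField s w φ‖ ≤
      ε * (wnorm θ (𝓕⁻ φ : 𝓢(EuclideanSpace ℝ (Fin d), ℂ))).toReal)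
    (h' : ∀ φ : 𝓢(EuclideanSpace ℝ (Fin d), ℂ), ‖farField s w' φ‖ ≤
      ε * (wnorm θ (𝓕⁻ φ : 𝓢(EuclideanSpace ℝ (Fin d), ℂ))).toReal)
    (φ : 𝓢(EuclideanSpace ℝ (Fin d), ℂ)) : ‖remainder s w w' φ‖ ≤
      ε * (wnorm θ (𝓕⁻ φ : 𝓢(EuclideanSpace ℝ (Fin d), ℂ))).toReal := by
  have h2 := h' (conjSchwartz φ)
  rw [wnorm_fourierInv_conjSchwartz] at h2
  refine (norm_add_le _ _).trans ?_
  rw [norm_mul, norm_mul, RCLike.norm_conj]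
  norm_num
  linarith [h φ]

/-- The error functional is bounded by `ε` times the norm of order `1 - β`, so duality represents it
by a distribution whose norm of order `β - 1` is at most `ε`. The filter `l` with `σt → ∞` covers
both time directions. -/
lemma tendsto_homSobolevENorm_sub_radiationTerm (hd : 3 ≤ d) {β : ℝ} (hβ0 : 0 < β) (hβ1 : β < 1)
    {u₀ u₁ : 𝓢'(EuclideanSpace ℝ (Fin d), ℂ)} (h₀ : MemHomSobolev β u₀)
    (h₁ : MemHomSobolev (β - 1) u₁) {u v : ℝ → 𝓢'(EuclideanSpace ℝ (Fin d), ℂ)}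
    (hu : ∀ t, HasDensity (𝓕 (u t)) (waveHat u₀ u₁ t))
    (hv : ∀ t, HasDensity (𝓕 (v t)) (velHat u₀ u₁ t))
    {σ : ℝ} (hσ : σ = 1 ∨ σ = -1) {l : Filter ℝ} (hl : Tendsto (fun t => σ * t) l atTop)
    (k : Fin (d + 1)) :
    Tendsto (fun t => homSobolevENorm (β - 1) (spaceTimeGradient (u t) (v t) k -
      radiationTerm σ (radiationProfile σ u₀ u₁) t k)) l (𝓝 0) := by
  have : Nonempty (Fin d) := ⟨⟨0, by omega⟩⟩
  have hσ' : |σ| ≤ 1 := by rcases hσ with rfl | rfl <;> simp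
  have hθ0 : 0 < 1 - β := by linarith
  have hθ1 : 1 - β < 1 := by linarith
  have hm := aestronglyMeasurable_posData h₀ h₁ σ k
  have hm' := aestronglyMeasurable_negData h₀ h₁ σ k
  have hf : wnorm (-(1 - β)) (posData σ u₀ u₁ k) < ∞ := by
    rw [neg_sub]; exact wnorm_posData_lt_top h₀ h₁ hσ' k
  have hf' : wnorm (-(1 - β)) (negData σ u₀ u₁ k) < ∞ := by
    rw [neg_sub]; exact wnorm_negData_lt_top h₀ h₁ hσ' k
  rw [ENNReal.tendsto_nhds_zero]
  intro δ hδ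
  obtain ⟨ε, hε, hεδ⟩ : ∃ ε : ℝ, 0 < ε ∧ ENNReal.ofReal ε ≤ δ := by
    rcases eq_or_ne δ ∞ with rfl | htop
    · exact ⟨1, one_pos, le_top⟩
    · exact ⟨δ.toReal, ENNReal.toReal_pos hδ.ne' htop, ENNReal.ofReal_toReal_le⟩
  filter_upwards [hl.eventually (farFieldDecay hd hθ0 hθ1 hm hf ε hε),
    hl.eventually (farFieldDecay hd hθ0 hθ1 hm' hf' ε hε)] with t b b'
  let L : 𝓢(EuclideanSpace ℝ (Fin d), ℂ) →ₗ[ℂ] ℂ :=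
    { toFun := remainder (σ * t) (posData σ u₀ u₁ k) (negData σ u₀ u₁ k)
      map_add' := fun φ ψ => by
        simp only [remainder, conjSchwartz_add, farField_add hd hθ0 hθ1 hm hf,
          farField_add hd hθ0 hθ1 hm' hf', map_add]
        ring
      map_smul' := fun c φ => by
        simp only [remainder, conjSchwartz_smul, farField_smul, map_mul, Complex.conj_conj,
          RingHom.id_apply, smul_eq_mul]
        ring }
  obtain ⟨W, hW, hWn⟩ := exists_homSobolev_of_bound (s := 1 - β)
    (by rw [finrank_euclideanSpace_fin]; linarith [(by positivity : (0 : ℝ) ≤ d)]) L hε.le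
    (norm_remainder_le b b')
  have hdiff : ∀ φ : 𝓢(EuclideanSpace ℝ (Fin d), ℂ), spaceTimeGradient (u t) (v t) k φ -
      ∫ ω : UnitSphere d, pairing (radiationProfile σ u₀ u₁ ω) (pulledTest σ t k φ ω)
        ∂((volume : Measure (EuclideanSpace ℝ (Fin d))).toSphere) = W φ := fun φ => by
    rw [hW, integral_pairing_radiationProfile hd hβ0 hβ1 h₀ h₁ hσ' t k φ,
      spaceTimeGradient_apply hβ1 h₀ h₁ (hu t) (hv t) hσ k φ]
    change _ = remainder _ _ _ φ
    rw [remainder, farField_eq_sub hd hθ0 hθ1 hm hf, farField_eq_sub hd hθ0 hθ1 hm' hf', map_sub]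
    ring
  -- The polar-coordinate pairing defines a tempered distribution because it is the gradient minus
  -- `W`; hence `radiationTerm` is not its default value `0`.
  have hex : ∃ T : 𝓢'(EuclideanSpace ℝ (Fin d), ℂ), ∀ φ : 𝓢(EuclideanSpace ℝ (Fin d), ℂ),
      T φ = ∫ ω : UnitSphere d, pairing (radiationProfile σ u₀ u₁ ω) (pulledTest σ t k φ ω)
        ∂((volume : Measure (EuclideanSpace ℝ (Fin d))).toSphere) :=
    ⟨spaceTimeGradient (u t) (v t) k - W, fun φ => by
      change spaceTimeGradient (u t) (v t) k φ - W φ = _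
      rw [← hdiff φ]; ring⟩
  have hR : spaceTimeGradient (u t) (v t) k -
      radiationTerm σ (radiationProfile σ u₀ u₁) t k = W := by
    ext φ
    change spaceTimeGradient (u t) (v t) k φ - radiationTerm σ (radiationProfile σ u₀ u₁) t k φ = _
    rw [radiationTerm, dif_pos hex, hex.choose_spec φ, hdiff φ]
  rw [hR, ← neg_sub]
  exact hWn.trans hεδ

lemma tendsto_homSobolevVecENorm {V : Type*} [NormedAddCommGroup V] [InnerProductSpace ℝ V]
    [FiniteDimensional ℝ V] [MeasurableSpace V] [BorelSpace V] {α : Type*} {l : Filter α} {n : ℕ}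
    {s : ℝ} {F : α → Fin n → 𝓢'(V, ℂ)}
    (h : ∀ k, Tendsto (fun t => homSobolevENorm s (F t k)) l (𝓝 0)) :
    Tendsto (fun t => homSobolevVecENorm s (F t)) l (𝓝 0) := by
  have h1 : Tendsto (fun t => ∑ k, homSobolevENorm s (F t k) ^ 2) l (𝓝 0) := by
    have := tendsto_finsetSum Finset.univ fun k _ => ENNReal.Tendsto.pow (n := 2) (h k)
    simpa using this
  simpa [homSobolevVecENorm] using h1.ennrpow_const (1 / 2 : ℝ)

end MainLimit

end RadiationField

end

theorem mainTheorem1 (d : ℕ) (hd : 3 ≤ d) (β : ℝ) (hβ₀ : 0 < β) (hβ₁ : β < 1)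
    (u₀ u₁ : 𝓢'(EuclideanSpace ℝ (Fin d), ℂ))
    (hu₀ : RadiationField.MemHomSobolev β u₀) (hu₁ : RadiationField.MemHomSobolev (β - 1) u₁) :
    (∃ u v : ℝ → 𝓢'(EuclideanSpace ℝ (Fin d), ℂ), RadiationField.IsFreeWave β u₀ u₁ u v) ∧
    ∀ u v : ℝ → 𝓢'(EuclideanSpace ℝ (Fin d), ℂ), RadiationField.IsFreeWave β u₀ u₁ u v →
      Tendsto (fun t : ℝ => RadiationField.homSobolevVecENorm (β - 1) fun k =>
          RadiationField.spaceTimeGradient (u t) (v t) k -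
            RadiationField.radiationTerm 1 (RadiationField.radiationProfile 1 u₀ u₁) t k)
        atTop (𝓝 0) ∧
      Tendsto (fun t : ℝ => RadiationField.homSobolevVecENorm (β - 1) fun k =>
          RadiationField.spaceTimeGradient (u t) (v t) k -
            RadiationField.radiationTerm (-1) (RadiationField.radiationProfile (-1) u₀ u₁) t k)
        atBot (𝓝 0) := by

  have : Nonempty (Fin d) := ⟨⟨0, by omega⟩⟩
  have hfin : 2 ≤ Module.finrank ℝ (EuclideanSpace ℝ (Fin d)) := by
    rw [finrank_euclideanSpace_fin]; omega
  obtain ⟨u', v', hw, hu', hv'⟩ := RadiationField.exists_isFreeWave hβ₀ hβ₁ hfin hu₀ hu₁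
  refine ⟨⟨u', v', hw⟩, fun u v huv => ?_⟩
  -- Uniqueness transfers the explicit Fourier transforms to the given wave.
  obtain ⟨rfl, rfl⟩ := RadiationField.IsFreeWave.unique hβ₀ hβ₁ hfin huv hw
  refine ⟨RadiationField.tendsto_homSobolevVecENorm fun k =>
    RadiationField.tendsto_homSobolevENorm_sub_radiationTerm hd hβ₀ hβ₁ hu₀ hu₁ hu' hv'
      (Or.inl rfl) ?_ k, RadiationField.tendsto_homSobolevVecENorm fun k =>
    RadiationField.tendsto_homSobolevENorm_sub_radiationTerm hd hβ₀ hβ₁ hu₀ hu₁ hu' hv'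
      (Or.inr rfl) ?_ k⟩
  · simp only [one_mul]; exact tendsto_id
  · simpa only [neg_mul, one_mul] using tendsto_neg_atBot_atTop
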